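/- **Conventions.** Let $\Omega\subset\mathbb{R}^2$ be a simply connected polygonal domain, i.e. a bounded, open, simply connected set whose boundary is a union of finitely many line segments. A *polygonal partition* $\Delta$ of $\Omega$ is given by finitely many nondegenerate segments (its edges) whose relative interiors lie in $\Omega$, such that different edges meet at most in common endpoints and every edge separates two different cells; the *cells* are the connected components of $\Omega$ minus the union of the edges (so T-junctions and non-convex cells are allowed), and the *interior vertices* are the endpoints of edges that lie in $\Omega$. A *grid line* is a maximal segment whose relative interior lies in $\Omega$ and in the union of the edges. A grid line is a *cross-cut* if both its endpoints lie on $\partial\Omega$, and a *ray* if exactly one of them does. $\Delta$ is a *quasi-cross-cut partition* if each grid line is a cross-cut or a ray. For integers $0\le\mu\le d$, $$S_d^\mu(\Delta)=\{s\in C^\mu(\Omega): s|_\phi\in\Pi_d \text{ for every cell } \phi \text{ of } \Delta\},$$ where $\Pi_d$ is the space of real bivariate polynomials of total degree at most $d$. For an integer $n \ge 0$ put $$k_d^\mu(n)=\sum_{j=1}^{d-\mu}\bigl(n(d-\mu-j+1)-(d-j+2)\bigr)_+ .$$ **Theorem.** Let $\Delta$ be a polygonal partition of $\Omega$, and let $\Delta'=\mathrm{ext}_s(\Delta)$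 be a quasi-cross-cut partition of $\Omega$ obtained by extending edges of $\Delta$ (the vertices of $\Delta$ are vertices of $\Delta'$, the union of the edges of $\Delta$ is contained in that of $\Delta'$, and every grid line of $\Delta'$ contains an edge of $\Delta$). Let $L_1$ be the number of cross-cuts of $\Delta'$, let $A_1,\dots,A_V$ be its interior vertices, and let $N_i$ be the number of cross-cuts and rays of $\Delta'$ that contain $A_i$. Let $B_1,\dots,B_n$ be a basis of $S_d^\mu(\Delta')$. Call an edge of $\Delta'$ *extended* if it is not contained in the union of the edges of $\Delta$, and for each extended edge $l$ let $\phi_1^l,\phi_2^l$ be the two cells of $\Delta'$ adjacent to $l$, in any order, and $\boldsymbol n_l$ a unit normal of $l$. Let $M$ be the coefficient matrix of the Extended Edge Elimination (EEE) conditions, i.e. of the homogeneous linear system in $c=(c_1,\dots,c_n)$ $$\sum_{i=1}^n c_i\,\frac{\partial^r}{\partial \boldsymbol n_l^r}\bigl(B_i|_{\phi_1^l}-B_i|_{\phi_2^l}\bigr)\Big|_l\equiv 0,\qquad r=\mu+1,\dots,d,\quad l \text{ an extended edge},$$ in which each identity between polynomials along $l$ is written coefficient by coefficient. Then $Mc=0$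 if and only if $\sum_i c_iB_i$ is of class $C^d$ on $\Omega\cap\overline{\phi_1^l\cup\phi_2^l}$ for every extended edge $l$; the space $S_d^\mu(\Delta)$ is finite-dimensional; and $$\dim S_d^\mu(\Delta)=\binom{d+2}{2}+L_1\binom{d-\mu+1}{2}+\sum_{i=1}^V k_d^\mu(N_i)-\operatorname{rank}(M).$$ -/

import Mathlib

noncomputable section

namespace PolySpline

/-- The Euclidean plane. -/
abbrev Plane : Type := EuclideanSpace ℝ (Fin 2)

/-- A simply connected polygonal domain: a bounded open simply connected subset of the plane
whose boundary is a union of finitely many line segments. -/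
structure IsPolygonalDomain (Ω : Set Plane) : Prop where
  isOpen : IsOpen Ω
  isBounded : Bornology.IsBounded Ω
  simplyConnected : SimplyConnectedSpace Ω
  polygonal : ∃ F : Finset (Plane × Plane), frontier Ω = ⋃ e ∈ F, segment ℝ e.1 e.2

/-- The union of the closed segments of a finite family. -/
def segUnion (E : Finset (Plane × Plane)) : Set Plane :=
  ⋃ e ∈ E, segment ℝ e.1 e.2

/-- The cells into which the segments of `E` divide `Ω`: the connected components of what
remains of `Ω` when the segments are removed. -/
def cellsOf (Ω : Set Plane) (E : Finset (Plane × Plane)) : Set (Set Plane) :=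
  {φ | ∃ x ∈ Ω \ segUnion E, φ = connectedComponentIn (Ω \ segUnion E) x}

/-- `φ₁` and `φ₂` are two different cells that both have the segment `e` on their boundary. -/
def AdjacentAlong (Ω : Set Plane) (E : Finset (Plane × Plane)) (e : Plane × Plane)
    (φ₁ φ₂ : Set Plane) : Prop :=
  φ₁ ∈ cellsOf Ω E ∧ φ₂ ∈ cellsOf Ω E ∧ φ₁ ≠ φ₂ ∧
    segment ℝ e.1 e.2 ⊆ closure φ₁ ∧ segment ℝ e.1 e.2 ⊆ closure φ₂

/-- A polygonal partition of `Ω`, given by its (interior) edges. An edge is stored as the pair of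
its endpoints; it runs inside `Ω`, different edges can only meet at common endpoints, and every
edge separates two different cells. T-junctions and non-convex cells are allowed. -/
structure PolygonalPartition (Ω : Set Plane) where
  edges : Finset (Plane × Plane)
  ne_of_mem : ∀ e ∈ edges, e.1 ≠ e.2
  openSegment_subset : ∀ e ∈ edges, openSegment ℝ e.1 e.2 ⊆ Ω
  disjoint_of_ne : ∀ e ∈ edges, ∀ e' ∈ edges, e ≠ e' →
    Disjoint (openSegment ℝ e.1 e.2) (segment ℝ e'.1 e'.2)
  separates : ∀ e ∈ edges, ∃ φ₁ φ₂, AdjacentAlong Ω edges e φ₁ φ₂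

namespace PolygonalPartition

variable {Ω : Set Plane}

/-- The union of all edges. -/
def grid (Δ : PolygonalPartition Ω) : Set Plane := segUnion Δ.edges

/-- The (open) cells of the partition. -/
def cells (Δ : PolygonalPartition Ω) : Set (Set Plane) := cellsOf Ω Δ.edges

open Classical in
/-- The endpoints of the edges. -/
def vertices (Δ : PolygonalPartition Ω) : Finset Plane :=
  Δ.edges.image Prod.fst ∪ Δ.edges.image Prod.snd

open Classical in
/-- The vertices that lie in the open set `Ω`. -/
def interiorVertices (Δ : PolygonalPartition Ω) : Finset Plane :=
  Δ.vertices.filter (fun A => A ∈ Ω)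

/-- A nondegenerate segment that runs inside `Ω` along edges of the partition. -/
def IsGridSegment (Δ : PolygonalPartition Ω) (l : Set Plane) : Prop :=
  ∃ a b : Plane, a ≠ b ∧ l = segment ℝ a b ∧ openSegment ℝ a b ⊆ Ω ∩ Δ.grid

/-- The grid lines: the maximal straight segments that run inside `Ω` along edges. -/
def gridLines (Δ : PolygonalPartition Ω) : Set (Set Plane) :=
  {l | Maximal Δ.IsGridSegment l}

/-- The cross-cuts: grid lines with both endpoints on the boundary of `Ω`. -/
def crossCuts (Δ : PolygonalPartition Ω) : Set (Set Plane) :=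
  {l ∈ Δ.gridLines | ∃ a b : Plane, l = segment ℝ a b ∧ a ∈ frontier Ω ∧ b ∈ frontier Ω}

/-- The rays: grid lines with one endpoint on the boundary of `Ω` and the other inside `Ω`. -/
def rays (Δ : PolygonalPartition Ω) : Set (Set Plane) :=
  {l ∈ Δ.gridLines | ∃ a b : Plane, l = segment ℝ a b ∧ a ∈ frontier Ω ∧ b ∈ Ω}

/-- Every grid line is a cross-cut or a ray. -/
def IsQuasiCrossCut (Δ : PolygonalPartition Ω) : Prop :=
  ∀ l ∈ Δ.gridLines, l ∈ Δ.crossCuts ∨ l ∈ Δ.rays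

/-- The number of cross-cuts and rays that meet at `A` (that pass through `A` or end there). -/
def lineCount (Δ : PolygonalPartition Ω) (A : Plane) : ℕ :=
  {l | (l ∈ Δ.crossCuts ∨ l ∈ Δ.rays) ∧ A ∈ l}.ncard

/-- `Δ'` arises from `Δ` by extending edges: it contains the vertices and edges of `Δ`, and each
of its grid lines is a prolongation of an edge of `Δ`. -/
structure IsExtensionOf (Δ' Δ : PolygonalPartition Ω) : Prop where
  vertices_subset : Δ.vertices ⊆ Δ'.vertices
  grid_subset : Δ.grid ⊆ Δ'.grid
  extends_edge : ∀ l ∈ Δ'.gridLines, ∃ e ∈ Δ.edges, segment ℝ e.1 e.2 ⊆ l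

open Classical in
/-- The extended edges: the edges of `Δ'` that are not covered by edges of `Δ`. -/
def extendedEdges (Δ Δ' : PolygonalPartition Ω) : Finset (Plane × Plane) :=
  Δ'.edges.filter (fun e => ¬ segment ℝ e.1 e.2 ⊆ Δ.grid)

end PolygonalPartition

/-- The function `s` on `Ω` agrees on `φ` with the polynomial `p`. -/
def AgreesOn {Ω : Set Plane} (s : Ω → ℝ) (φ : Set Plane) (p : MvPolynomial (Fin 2) ℝ) : Prop :=
  ∀ x : Ω, (x : Plane) ∈ φ → s x = MvPolynomial.eval (fun i => (x : Plane) i) p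

/-- The function `s` on `Ω` is of class `C^m` on the subset `T` of `Ω`. -/
def SmoothOn {Ω : Set Plane} (m : ℕ) (s : Ω → ℝ) (T : Set Plane) : Prop :=
  ∃ f : Plane → ℝ, ContDiffOn ℝ m f T ∧ ∀ x : Ω, (x : Plane) ∈ T → s x = f x

/-- The spline space `S_d^μ(Δ)`: the functions on `Ω` of class `C^μ` that agree on every cell
with a polynomial of total degree at most `d`. -/
def splineSpace {Ω : Set Plane} (Δ : PolygonalPartition Ω) (d μ : ℕ) :
    Submodule ℝ (Ω → ℝ) where
  carrier := {s | SmoothOn μ s Ω ∧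
    ∀ φ ∈ Δ.cells, ∃ p : MvPolynomial (Fin 2) ℝ, p.totalDegree ≤ d ∧ AgreesOn s φ p}
  zero_mem' := by
    refine ⟨⟨fun _ => 0, contDiffOn_const, fun _ _ => rfl⟩, fun φ _ => ⟨0, by simp, ?_⟩⟩
    intro x _
    simp
  add_mem' := by
    rintro s t ⟨⟨f, hf, hsf⟩, hs⟩ ⟨⟨g, hg, htg⟩, ht⟩
    refine ⟨⟨fun x => f x + g x, hf.add hg, fun x hx => ?_⟩, fun φ hφ => ?_⟩
    · simp [hsf x hx, htg x hx]
    · obtain ⟨p, hp, hsp⟩ := hs φ hφ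
      obtain ⟨q, hq, htq⟩ := ht φ hφ
      refine ⟨p + q, (MvPolynomial.totalDegree_add p q).trans (max_le hp hq), fun x hx => ?_⟩
      simp [hsp x hx, htq x hx]
  smul_mem' := by
    rintro c s ⟨⟨f, hf, hsf⟩, hs⟩
    refine ⟨⟨fun x => c * f x, contDiffOn_const.mul hf, fun x hx => ?_⟩, fun φ hφ => ?_⟩
    · simp [hsf x hx]
    · obtain ⟨p, hp, hsp⟩ := hs φ hφ
      refine ⟨c • p, (MvPolynomial.totalDegree_smul_le c p).trans hp, fun x hx => ?_⟩
      simp [hsp x hx, MvPolynomial.smul_eval]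

open Classical in
/-- The polynomial that `s` agrees with on `φ`, which is unique when `φ` is a cell
(and `0` if there is none). -/
def piece {Ω : Set Plane} (s : Ω → ℝ) (φ : Set Plane) : MvPolynomial (Fin 2) ℝ :=
  if h : ∃ p : MvPolynomial (Fin 2) ℝ, AgreesOn s φ p then h.choose else 0

/-- The derivative of a polynomial in the direction of the unit normal
`(a₁ - b₁, b₀ - a₀) / ‖b - a‖` of the edge from `a` to `b`. -/
def normalDeriv (e : Plane × Plane) (p : MvPolynomial (Fin 2) ℝ) : MvPolynomial (Fin 2) ℝ :=
  ((e.1 1 - e.2 1) / ‖e.2 - e.1‖) • MvPolynomial.pderiv 0 p +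
    ((e.2 0 - e.1 0) / ‖e.2 - e.1‖) • MvPolynomial.pderiv 1 p

/-- The restriction of a polynomial to the line through the edge from `a` to `b`, as a polynomial
in the parameter `t` of `a + t (b - a)`. -/
def edgeRestrict (e : Plane × Plane) (p : MvPolynomial (Fin 2) ℝ) : Polynomial ℝ :=
  MvPolynomial.aeval
    (fun i => Polynomial.C (e.1 i) + Polynomial.C (e.2 i - e.1 i) * Polynomial.X) p

/-- The Extended Edge Elimination condition for a function `s` on `Ω` with respect to two adjacent
cells `φ₁`, `φ₂`: `s` is of class `C^d` on the closure of `φ₁ ∪ φ₂` in `Ω`. -/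
def EEECondition {Ω : Set Plane} (d : ℕ) (s : Ω → ℝ) (φ₁ φ₂ : Set Plane) : Prop :=
  SmoothOn d s (Ω ∩ closure (φ₁ ∪ φ₂))

/-- The coefficient matrix of the EEE conditions
`∑ i, c i * ∂ʳ/∂nʳ (N i |_φ₁ - N i |_φ₂) |_e ≡ 0` (`r = μ+1, …, d`, `e` an extended edge) for the
family `N`. Each such identity between polynomials of degree at most `d` along `e` is written as
one linear equation for each of the coefficients of `t^0, …, t^d`. -/
def eeeMatrix {Ω : Set Plane} (Δ Δ' : PolygonalPartition Ω) (d μ : ℕ) {ι : Type*}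
    (N : ι → Ω → ℝ) (φ₁ φ₂ : Plane × Plane → Set Plane) :
    Matrix (Δ.extendedEdges Δ' × Finset.Icc (μ + 1) d × Fin (d + 1)) ι ℝ :=
  fun row i =>
    (edgeRestrict row.1.1
      ((normalDeriv row.1.1)^[row.2.1.1]
        (piece (N i) (φ₁ row.1.1) - piece (N i) (φ₂ row.1.1)))).coeff row.2.2

/-- `k_d^μ(n) = ∑_{j=1}^{d-μ} (n (d - μ - j + 1) - (d - j + 2))₊`. -/
def kNum (d μ n : ℕ) : ℤ :=
  ∑ j ∈ Finset.Icc 1 (d - μ),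
    max 0 ((n : ℤ) * ((d : ℤ) - μ - j + 1) - ((d : ℤ) - j + 2))

end PolySpline

end

noncomputable section

open Filter Topology

/-! ### Gluing local data over a simply connected space -/

namespace PolySpline

/-! The matrix enters through linear algebra. A spline over `Δ'` is a spline over `Δ` exactly when
its polynomial pieces agree across every extended edge (`mem_splineSpace_iff`): a cell of `Δ` is
connected, and removing the isolated vertices of `Δ'` from small discs inside it does not disconnect
them. For a `C^μ` spline the EEE equations express precisely this agreement. In coordinates along
and perpendicular to an edge (`edgeFrame`) the restricted `r`-th normal derivative is `r!` times the
`r`-th coefficient; smoothness kills the coefficients up to order `μ`, the equations kill those from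
`μ + 1` to `d`, and there are no others. Hence the splines over `Δ` form the kernel of `M`, and
rank-nullity reduces the claim to the dimension over the quasi-cross-cut partition `Δ'`.

For that dimension a sheared height is chosen that is injective on all edges, so that each grid line
has a left and a right side (`SegmentSystem`). A spline is recorded by its jumps across the grid
lines. Along a line the jump is constant except at vertices, where it changes by an increment. The
`C^μ` condition makes jumps and increments divisible by `l ^ (μ + 1)`, the increments around a
vertex add up to zero, and the jump dies at an end inside `Ω`. Conversely, all such data come from a
spline: the local models differ by local constants, and simple connectedness permits gluing them
(`exists_glue`, `exists_of_jumps`, `exists_spline`). The splines without jumps are the global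
polynomials, which accounts for the first binomial coefficient.

The admissible data split freely (`jumpDataParts`) into a family of increments with sum zero at each
vertex and one initial jump for each cross-cut; the initial jump of a ray is forced by its end in
`Ω`. To count increments at `A`, polar-like coordinates around `A` (`blow`) turn a polynomial into a
sum of powers `S ^ k` with coefficients of degree at most `k`, and divisibility by the power of a
line of slope `c` into divisibility of each coefficient by `(X - c) ^ (μ + 1)`. For distinct slopes
the sum map on such families of coefficients is injective or surjective (`eq_zero_of_sum_eq_zero`),
so its kernel has dimension `(N (k - μ) - (k + 1))₊`, and the sum over `k` is `kNum`. -/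

/-- A locally constant function on a preconnected set is constant. -/
theorem eq_of_isPreconnected_of_locally_eq {X Y : Type*} [TopologicalSpace X] {W : Set X}
    (hW : IsPreconnected W) {g : X → Y} (hg : ∀ y ∈ W, ∀ᶠ z in 𝓝[W] y, g z = g y)
    {x y : X} (hx : x ∈ W) (hy : y ∈ W) : g x = g y := by
  let _ : TopologicalSpace Y := ⊥
  have : DiscreteTopology Y := ⟨rfl⟩
  refine hW.constant (f := g) (fun z hz => ?_) hx hy
  exact (continuousWithinAt_const (b := g z)).congr_of_eventuallyEq (hg z hz) rfl

/-- Local data on a simply connected space whose differences are locally constant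
can be glued up to local constants. -/
theorem exists_glue {X G : Type*} [TopologicalSpace X] [SimplyConnectedSpace X]
    [LocallyPathConnectedSpace X] [AddCommGroup G] (f : X → X → G)
    (hf : ∀ x, ∀ᶠ y in 𝓝 x, ∃ k, ∀ᶠ z in 𝓝 y, f x z - f y z = k) :
    ∃ F : X → G, ∀ x, ∃ k, ∀ᶠ z in 𝓝 x, F z = k + f x z := by
  let _ : TopologicalSpace G := ⊥
  have : DiscreteTopology G := ⟨rfl⟩
  let U : X → Set X := fun x => interior {y | ∃ k, ∀ᶠ z in 𝓝 y, f x z - f y z = k}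
  have hUo : ∀ x, IsOpen (U x) := fun x => isOpen_interior
  have hxU : ∀ x, x ∈ U x := fun x => mem_interior_iff_mem_nhds.2 (hf x)
  have hU : ∀ x, ∀ y ∈ U x, ∃ k, ∀ᶠ z in 𝓝 y, f x z - f y z = k :=
    fun x y hy => interior_subset (s := {y | ∃ k, ∀ᶠ z in 𝓝 y, f x z - f y z = k}) hy
  -- A bundle with discrete fibre `G` whose chart changes are translations by `f i - f j`. On the
  -- overlap of `U i` and `U j` this difference is locally constant, since both functions differ
  -- from the same `f x` by constants near `x`.
  let Z : FiberBundleCore X X G :=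
    { baseSet := U
      isOpen_baseSet := hUo
      indexAt := id
      mem_baseSet_at := hxU
      coordChange := fun i j x v => v + (f i x - f j x)
      coordChange_self := fun i x _ v => by simp
      continuousOn_coordChange := by
        rintro i j ⟨x, v⟩ ⟨⟨hi, hj⟩, -⟩
        obtain ⟨k, hk⟩ := hU i x hi
        obtain ⟨k', hk'⟩ := hU j x hj
        refine ContinuousAt.continuousWithinAt ?_
        have hc : ContinuousAt (fun p : X × G => p.2 + (k - k')) (x, v) :=
          ((continuous_of_discreteTopology (f := fun w : G => w + (k - k'))).comp
            continuous_snd).continuousAt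
        refine hc.congr ?_
        have := (continuous_fst.tendsto (x, v)).eventually (hk.and hk')
        filter_upwards [this] with p hp
        rw [← hp.1, ← hp.2]
        abel
      coordChange_comp := fun i j k x _ v => by abel }
  have cov := FiberBundle.isCoveringMap (F := G) (E := Z.Fiber)
  obtain ⟨x₀⟩ : Nonempty X := inferInstance
  -- The bundle is a covering, so the identity of the simply connected base lifts to a global
  -- section.
  obtain ⟨σ, ⟨-, hσ⟩, -⟩ := cov.existsUnique_continuousMap_lifts (ContinuousMap.id X) x₀
    (⟨x₀, (0 : G)⟩ : Bundle.TotalSpace G Z.Fiber) rfl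
  have hσ' : ∀ x, (σ x).proj = x := fun x => congrFun hσ x
  let v : X → G := fun x => (σ x).snd
  -- In the chart at `x` the section has the coordinate `v y + f y y - f x y` over `y`; as the fibre
  -- is discrete, this is locally constant.
  refine ⟨fun x => v x + f x x, fun x => ?_⟩
  have hcont : ContinuousAt (fun y => (Z.localTriv x (σ y)).2) x := by
    have h1 : ContinuousAt (Z.localTriv x) (σ x) := by
      refine (Z.localTriv x).continuousAt ?_
      rw [Z.mem_localTriv_source]
      rw [show (σ x).proj = x from hσ' x]
      exact hxU x
    exact continuousAt_snd.comp (h1.comp σ.continuous.continuousAt)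
  have hev : ∀ᶠ y in 𝓝 x, (Z.localTriv x (σ y)).2 = (Z.localTriv x (σ x)).2 :=
    hcont.eventually_mem ((isOpen_discrete {(Z.localTriv x (σ x)).2}).mem_nhds rfl)
  refine ⟨(Z.localTriv x (σ x)).2, ?_⟩
  filter_upwards [hev] with y hy
  rw [← hy, Z.localTriv_apply]
  change v y + f y y = v y + (f (σ y).proj (σ y).proj - f x (σ y).proj) + f x y
  rw [hσ' y]
  have : ∀ a b c : G, a + b = a + (b - c) + c := fun a b c => by abel
  exact this (v y) _ _

/-- The version of `exists_glue` for an open subset of a locally path connected space. -/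
theorem exists_glue_on {X G : Type*} [TopologicalSpace X] [LocallyPathConnectedSpace X]
    [AddCommGroup G] {Ω : Set X} (hΩ : IsOpen Ω) [SimplyConnectedSpace Ω] (f : X → X → G)
    (hf : ∀ x ∈ Ω, ∀ᶠ y in 𝓝 x, ∃ k, ∀ᶠ z in 𝓝 y, f x z - f y z = k) :
    ∃ F : X → G, ∀ x ∈ Ω, ∃ k, ∀ᶠ z in 𝓝 x, F z = k + f x z := by
  classical
  have := hΩ.locallyPathConnectedSpace
  obtain ⟨F, hF⟩ := exists_glue (X := Ω) (fun x y => f x y) (by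
    intro x
    have := continuous_subtype_val.continuousAt.tendsto.eventually (hf x x.2)
    filter_upwards [this] with y ⟨k, hk⟩
    exact ⟨k, continuous_subtype_val.continuousAt.tendsto.eventually hk⟩)
  refine ⟨fun x => if h : x ∈ Ω then F ⟨x, h⟩ else 0, fun x hx => ?_⟩
  obtain ⟨k, hk⟩ := hF ⟨x, hx⟩
  refine ⟨k, ?_⟩
  rw [nhds_subtype_eq_comap, eventually_comap] at hk
  filter_upwards [hk, hΩ.mem_nhds hx] with z hz hzΩ
  rw [dif_pos hzΩ]
  exact hz ⟨z, hzΩ⟩ rfl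

end PolySpline

/-! ### Segment systems, jump data and their local models -/

namespace PolySpline

/-- A sheared height coordinate on the plane. -/
def ht (κ : ℝ) (x : Plane) : ℝ := x 1 + κ * x 0

@[fun_prop]
theorem continuous_ht (κ : ℝ) : Continuous (ht κ) := by
  unfold ht
  fun_prop

theorem ext_ht {κ : ℝ} {x y : Plane} (h : ht κ x = ht κ y) (h0 : x 0 = y 0) : x = y := by
  unfold ht at h
  ext i
  fin_cases i
  · exact h0
  · simp only [h0] at h
    simpa using h

/-- A finite system of segments in `Ω`, transversal to the level lines of a height function, which
meet in a finite set `V` of points of `Ω` that also contains their endpoints in `Ω`. The segment `L`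
lies on the line `x 0 = c L * ht x + β L` between the heights `s L` and `t L`. -/
structure SegmentSystem (Ω : Set Plane) where
  ι : Type
  [fintype : Fintype ι]
  κ : ℝ
  c : ι → ℝ
  β : ι → ℝ
  s : ι → ℝ
  t : ι → ℝ
  V : Finset Plane
  s_lt_t : ∀ L, s L < t L
  mem_of_lt : ∀ L x, c L * ht κ x + β L - x 0 = 0 → s L < ht κ x → ht κ x < t L → x ∈ Ω
  V_subset : ∀ A ∈ V, A ∈ Ω
  V_of_two : ∀ x ∈ Ω, ∀ L L', L ≠ L' →
    (c L * ht κ x + β L - x 0 = 0 ∧ s L ≤ ht κ x ∧ ht κ x ≤ t L) →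
    (c L' * ht κ x + β L' - x 0 = 0 ∧ s L' ≤ ht κ x ∧ ht κ x ≤ t L') → x ∈ V ∧ c L ≠ c L'
  V_of_end : ∀ x ∈ Ω, ∀ L, c L * ht κ x + β L - x 0 = 0 → (ht κ x = s L ∨ ht κ x = t L) → x ∈ V

namespace SegmentSystem

variable {Ω : Set Plane} (Γ : SegmentSystem Ω)

attribute [instance] SegmentSystem.fintype

/-- The height function of the system. -/
def h (x : Plane) : ℝ := ht Γ.κ x

/-- The affine function vanishing on the line of `L`. -/
def lin (L : Γ.ι) (x : Plane) : ℝ := Γ.c L * Γ.h x + Γ.β L - x 0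

/-- The closed segment `L`. -/
def seg (L : Γ.ι) : Set Plane := {x | Γ.lin L x = 0 ∧ Γ.s L ≤ Γ.h x ∧ Γ.h x ≤ Γ.t L}

/-- The union of the segments. -/
def grid : Set Plane := ⋃ L, Γ.seg L

@[fun_prop]
theorem continuous_h : Continuous Γ.h := continuous_ht _

@[fun_prop]
theorem continuous_lin (L : Γ.ι) : Continuous (Γ.lin L) := by
  unfold lin
  fun_prop

theorem isClosed_seg (L : Γ.ι) : IsClosed (Γ.seg L) := by
  refine (isClosed_eq (Γ.continuous_lin L) continuous_const).inter ?_
  exact (isClosed_le continuous_const Γ.continuous_h).inter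
    (isClosed_le Γ.continuous_h continuous_const)

theorem isClosed_grid : IsClosed Γ.grid := isClosed_iUnion_of_finite Γ.isClosed_seg

theorem ext_h {x y : Plane} (hh : Γ.h x = Γ.h y) (h0 : x 0 = y 0) : x = y := ext_ht hh h0

variable {Γ} in
theorem ext_lin {L : Γ.ι} {x y : Plane} (hx : Γ.lin L x = 0) (hy : Γ.lin L y = 0)
    (hh : Γ.h x = Γ.h y) : x = y := by
  refine Γ.ext_h hh ?_
  unfold lin at hx hy
  rw [hh] at hx
  linarith

/-- `y` is so close to `x` that only what passes through `x` is visible from `y`. -/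
structure Near (x y : Plane) : Prop where
  mem : y ∈ Ω
  eq_of_mem_V : y ∈ Γ.V → y = x
  seg : ∀ L, y ∈ Γ.seg L → x ∈ Γ.seg L
  lt_t : ∀ L, Γ.h x < Γ.t L → Γ.h y < Γ.t L
  s_lt : ∀ L, Γ.s L < Γ.h x → Γ.s L < Γ.h y
  above : ∀ A : Γ.V, Γ.h A < Γ.h x → Γ.h A < Γ.h y
  below : ∀ A : Γ.V, Γ.h x < Γ.h A → Γ.h y < Γ.h A

theorem eventually_near (hΩ : IsOpen Ω) {x : Plane} (hx : x ∈ Ω) : ∀ᶠ y in 𝓝 x, Γ.Near x y := by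
  have h1 : ∀ᶠ y in 𝓝 x, y ∈ Ω := hΩ.mem_nhds hx
  have h2 : ∀ᶠ y in 𝓝 x, y ∈ Γ.V → y = x := by
    have : IsClosed ((Γ.V : Set Plane) \ {x}) := (Γ.V.finite_toSet.subset Set.sdiff_subset).isClosed
    filter_upwards [this.isOpen_compl.mem_nhds (by simp : x ∈ ((Γ.V : Set Plane) \ {x})ᶜ)] with y hy hV
    by_contra hne
    exact hy ⟨hV, hne⟩
  have h3 : ∀ᶠ y in 𝓝 x, ∀ L, y ∈ Γ.seg L → x ∈ Γ.seg L := by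
    refine eventually_all.2 fun L => ?_
    by_cases hL : x ∈ Γ.seg L
    · exact Eventually.of_forall fun _ _ => hL
    · filter_upwards [(Γ.isClosed_seg L).isOpen_compl.mem_nhds hL] with y hy hy'
      exact absurd hy' hy
  have hcont := Γ.continuous_h.continuousAt (x := x)
  have h4 : ∀ a : ℝ, ∀ᶠ y in 𝓝 x, Γ.h x < a → Γ.h y < a := fun a => by
    by_cases ha : Γ.h x < a
    · filter_upwards [hcont.eventually_lt_const ha] with y hy _ using hy
    · exact Eventually.of_forall fun _ h' => absurd h' ha
  have h5 : ∀ a : ℝ, ∀ᶠ y in 𝓝 x, a < Γ.h x → a < Γ.h y := fun a => by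
    by_cases ha : a < Γ.h x
    · filter_upwards [hcont.eventually_const_lt ha] with y hy _ using hy
    · exact Eventually.of_forall fun _ h' => absurd h' ha
  filter_upwards [h1, h2, h3, eventually_all.2 fun L => h4 (Γ.t L),
    eventually_all.2 fun L => h5 (Γ.s L), eventually_all.2 fun A : Γ.V => h5 (Γ.h A),
    eventually_all.2 fun A : Γ.V => h4 (Γ.h A)] with y a1 a2 a3 a4 a5 a6 a7
  exact ⟨a1, a2, a3, a4, a5, a6, a7⟩

variable {G : Type*} [AddCommGroup G]

/-- Jump data: an initial jump for each segment, and an increment for each segment and vertex. -/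
abbrev Data (G : Type*) : Type _ := (Γ.ι → G) × (Γ.V → Γ.ι → G)

variable {Γ}

open Classical in
/-- The increment at `x`, zero if `x` is no vertex. -/
def incr (θ : Γ.Data G) (x : Plane) (L : Γ.ι) : G := if hx : x ∈ Γ.V then θ.2 ⟨x, hx⟩ L else 0

/-- The jump across `L` at height `u`. -/
def jump (θ : Γ.Data G) (L : Γ.ι) (u : ℝ) : G :=
  θ.1 L + ∑ A : Γ.V, if Γ.h A < u then θ.2 A L else 0

/-- Jump data that come from a piecewise constant function, apart from the condition that the
increments at a vertex add up to zero. -/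
structure Compatible (θ : Γ.Data G) : Prop where
  supp : ∀ (A : Γ.V) L, (A : Plane) ∉ Γ.seg L → θ.2 A L = 0
  lo : ∀ L x, x ∈ Ω → Γ.lin L x = 0 → Γ.h x = Γ.s L → θ.1 L = 0
  hi : ∀ L x, x ∈ Ω → Γ.lin L x = 0 → Γ.h x = Γ.t L → θ.1 L + ∑ A, θ.2 A L = 0

open Classical in
/-- The contribution of `L` to the local model at `x`. -/
def term (θ : Γ.Data G) (x : Plane) (L : Γ.ι) (z : Plane) : G :=
  if x ∈ Γ.seg L then
    -- The left side of `L` is where `lin L` is positive. As `jump` counts only vertices strictly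
    -- below its height, `jump θ L (Γ.h x)` is the jump just below `x`; above the level of `x` the
    -- increment at `x` is added.
    (if 0 < Γ.lin L z then jump θ L (Γ.h x) else 0) +
      (if 0 < Γ.lin L z ∧ Γ.h x < Γ.h z then incr θ x L else 0)
  else 0

/-- The model near `x` of a piecewise constant function with the jumps `θ`. -/
def model (θ : Γ.Data G) (x z : Plane) : G := ∑ L, term θ x L z

theorem Compatible.incr_eq_zero {θ : Γ.Data G} (hθ : Compatible θ) {x : Plane} {L : Γ.ι}
    (hx : x ∉ Γ.seg L) : incr θ x L = 0 := by
  unfold incr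
  split_ifs with hV
  · exact hθ.supp ⟨x, hV⟩ L hx
  · rfl

theorem term_of_notMem {θ : Γ.Data G} {x : Plane} {L : Γ.ι} (hx : x ∉ Γ.seg L) (z : Plane) :
    term θ x L z = 0 := if_neg hx

/-- The height determines a point of `L`, so any other vertex at this height is off `L` and
contributes nothing by `supp`. -/
theorem sum_ite_eq_incr {θ : Γ.Data G} (hθ : Compatible θ) {x : Plane} {L : Γ.ι}
    (hx : x ∈ Γ.seg L) : (∑ A : Γ.V, if Γ.h A = Γ.h x then θ.2 A L else 0) = incr θ x L := by
  classical
  have key : ∀ A : Γ.V, (A : Plane) ≠ x → (if Γ.h A = Γ.h x then θ.2 A L else 0) = 0 := by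
    intro A hA
    split_ifs with hh
    · refine hθ.supp A L fun hAL => hA ?_
      exact ext_lin hAL.1 hx.1 hh
    · rfl
  unfold incr
  split_ifs with hV
  · rw [Finset.sum_eq_single (⟨x, hV⟩ : Γ.V)]
    · simp
    · intro A _ hA
      exact key A fun h' => hA (Subtype.ext h')
    · simp
  · refine Finset.sum_eq_zero fun A _ => key A ?_
    rintro rfl
    exact hV A.2

/-- No vertex height lies strictly between `Γ.h x` and `u`, so the only new contributions come from
the height of `x` itself. -/
theorem jump_above {θ : Γ.Data G} (hθ : Compatible θ) {x : Plane} {L : Γ.ι} {u : ℝ}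
    (hx : x ∈ Γ.seg L) (hu : Γ.h x < u) (hV : ∀ A : Γ.V, Γ.h x < Γ.h A → u ≤ Γ.h A) :
    jump θ L u = jump θ L (Γ.h x) + incr θ x L := by
  unfold jump
  rw [← sum_ite_eq_incr hθ hx, add_assoc, ← Finset.sum_add_distrib]
  congr 1
  refine Finset.sum_congr rfl fun A _ => ?_
  rcases lt_trichotomy (Γ.h A) (Γ.h x) with h1 | h1 | h1
  · simp [h1, h1.trans hu, h1.ne]
  · simp [h1, hu]
  · simp [h1.not_gt, h1.ne', (hV A h1).not_gt]

theorem jump_below {θ : Γ.Data G} {x : Plane} {L : Γ.ι} {u : ℝ}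
    (hu : u ≤ Γ.h x) (hV : ∀ A : Γ.V, Γ.h A < Γ.h x → Γ.h A < u) :
    jump θ L u = jump θ L (Γ.h x) := by
  unfold jump
  congr 1
  refine Finset.sum_congr rfl fun A _ => ?_
  by_cases h1 : Γ.h A < Γ.h x
  · simp [h1, hV A h1]
  · have : ¬ Γ.h A < u := fun h' => h1 (lt_of_lt_of_le h' hu)
    simp [h1, this]

/-- At a lower end inside `Ω` the initial jump is zero, and the vertices below it are not on the
segment. -/
theorem jump_lo {θ : Γ.Data G} (hθ : Compatible θ) {x : Plane} {L : Γ.ι}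
    (hxΩ : x ∈ Ω) (hx : Γ.lin L x = 0) (hs : Γ.h x = Γ.s L) : jump θ L (Γ.h x) = 0 := by
  unfold jump
  rw [hθ.lo L x hxΩ hx hs, zero_add]
  refine Finset.sum_eq_zero fun A _ => ?_
  split_ifs with h1
  · refine hθ.supp A L fun hA => ?_
    have := hA.2.1
    linarith
  · rfl

theorem jump_hi {θ : Γ.Data G} (hθ : Compatible θ) {x : Plane} {L : Γ.ι}
    (hxΩ : x ∈ Ω) (hx : Γ.lin L x = 0) (hs : Γ.h x = Γ.t L) :
    jump θ L (Γ.h x) + incr θ x L = 0 := by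
  have hxL : x ∈ Γ.seg L := ⟨hx, by rw [hs]; exact (Γ.s_lt_t L).le, hs.le⟩
  rw [← sum_ite_eq_incr hθ hxL]
  unfold jump
  rw [add_assoc, ← Finset.sum_add_distrib]
  refine Eq.trans ?_ (hθ.hi L x hxΩ hx hs)
  congr 1
  refine Finset.sum_congr rfl fun A _ => ?_
  rcases lt_trichotomy (Γ.h A) (Γ.h x) with h1 | h1 | h1
  · simp [h1, h1.ne]
  · simp [h1]
  · have : θ.2 A L = 0 := hθ.supp A L fun hA => by
      have := hA.2.2
      linarith
    simp [this]

theorem term_of_mem_of_notMem_V {θ : Γ.Data G} {y : Plane} {L : Γ.ι} (hy : y ∈ Γ.seg L)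
    (hV : y ∉ Γ.V) (z : Plane) :
    term θ y L z = if 0 < Γ.lin L z then jump θ L (Γ.h y) else 0 := by
  simp [term, hy, incr, hV]

/-- Near `y` all points are on one side of the level of `x`, so the term at `x` has a single jump
there. If `y` is still on the segment, this is the jump at `y`; if not, `x` is an end of the segment
inside `Ω` and the jump beyond it is zero by `jump_lo` or `jump_hi`. -/
theorem eventually_term_of_lin_eq_zero {θ : Γ.Data G} (hθ : Compatible θ) {x y : Plane}
    (hxΩ : x ∈ Ω) (hn : Γ.Near x y) (hne : y ≠ x) {L : Γ.ι} (hx : x ∈ Γ.seg L)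
    (hy : Γ.lin L y = 0) : ∀ᶠ z in 𝓝 y, term θ x L z = term θ y L z := by
  have hh : Γ.h y ≠ Γ.h x := fun h' => hne (ext_lin hy hx.1 h')
  have hyV : y ∉ Γ.V := fun h' => hne (hn.eq_of_mem_V h')
  have hc := Γ.continuous_h.continuousAt (x := y)
  rcases hh.lt_or_gt with hlt | hlt
  · filter_upwards [hc.eventually_lt_const hlt] with z hz
    have e1 : term θ x L z = if 0 < Γ.lin L z then jump θ L (Γ.h x) else 0 := by
      simp [term, hx, hz.not_gt]
    rw [e1]
    by_cases hyL : y ∈ Γ.seg L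
    · rw [term_of_mem_of_notMem_V hyL hyV, jump_below hlt.le hn.above]
    · rw [term_of_notMem hyL]
      have hs : Γ.h x = Γ.s L := by
        by_contra hs
        have := hn.s_lt L (lt_of_le_of_ne hx.2.1 (Ne.symm hs))
        exact hyL ⟨hy, this.le, hlt.le.trans hx.2.2⟩
      simp [jump_lo hθ hxΩ hx.1 hs]
  · filter_upwards [hc.eventually_const_lt hlt] with z hz
    have e1 : term θ x L z =
        if 0 < Γ.lin L z then jump θ L (Γ.h x) + incr θ x L else 0 := by
      by_cases h0 : 0 < Γ.lin L z <;> simp [term, hx, hz, h0]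
    rw [e1]
    by_cases hyL : y ∈ Γ.seg L
    · rw [term_of_mem_of_notMem_V hyL hyV, jump_above hθ hx hlt fun A hA => (hn.below A hA).le]
    · rw [term_of_notMem hyL]
      have hs : Γ.h x = Γ.t L := by
        by_contra hs
        have := hn.lt_t L (lt_of_le_of_ne hx.2.2 hs)
        exact hyL ⟨hy, hx.2.1.trans hlt.le, this.le⟩
      simp [jump_hi hθ hxΩ hx.1 hs]

theorem eventually_lin_pos_iff {L : Γ.ι} {y : Plane} (hy : Γ.lin L y ≠ 0) :
    ∀ᶠ z in 𝓝 y, (0 < Γ.lin L z ↔ 0 < Γ.lin L y) := by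
  have hc := (Γ.continuous_lin L).continuousAt (x := y)
  rcases hy.lt_or_gt with h0 | h0
  · filter_upwards [hc.eventually_lt_const h0] with z hz
    simp [h0.not_gt, hz.not_gt]
  · filter_upwards [hc.eventually_const_lt h0] with z hz
    simp [h0, hz]

theorem eventually_h_lt_iff {x y : Plane} (hy : Γ.h y ≠ Γ.h x) :
    ∀ᶠ z in 𝓝 y, (Γ.h x < Γ.h z ↔ Γ.h x < Γ.h y) := by
  have hc := Γ.continuous_h.continuousAt (x := y)
  rcases hy.lt_or_gt with h0 | h0
  · filter_upwards [hc.eventually_lt_const h0] with z hz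
    simp [h0.not_gt, hz.not_gt]
  · filter_upwards [hc.eventually_const_lt h0] with z hz
    simp [h0, hz]

theorem lin_of_h_eq {x y : Plane} {L : Γ.ι} (hx : x ∈ Γ.seg L) (hh : Γ.h y = Γ.h x) :
    Γ.lin L y = x 0 - y 0 := by
  have := hx.1
  unfold lin at this ⊢
  rw [hh]
  linarith

/-- Away from the horizontal half-line to the left of `x`, the models at `x` and at a nearby
point differ by a constant. -/
theorem eventually_model_sub_of_slit {θ : Γ.Data G} (hθ : Compatible θ) {x y : Plane}
    (hxΩ : x ∈ Ω) (hn : Γ.Near x y) (hs : Γ.h y ≠ Γ.h x ∨ x 0 < y 0) :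
    ∃ k, ∀ᶠ z in 𝓝 y, model θ x z - model θ y z = k := by
  have hne : y ≠ x := by rintro rfl; simp at hs
  have key : ∀ L, ∃ k, ∀ᶠ z in 𝓝 y, term θ x L z - term θ y L z = k := by
    intro L
    by_cases hx : x ∈ Γ.seg L
    · by_cases hy : Γ.lin L y = 0
      · refine ⟨0, ?_⟩
        filter_upwards [eventually_term_of_lin_eq_zero hθ hxΩ hn hne hx hy] with z hz
        rw [hz, sub_self]
      · have hyL : y ∉ Γ.seg L := fun h' => hy h'.1
        by_cases hh : Γ.h y = Γ.h x
        · refine ⟨0, ?_⟩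
          have h0 : x 0 < y 0 := hs.resolve_left (fun h' => h' hh)
          filter_upwards [eventually_lin_pos_iff hy] with z hz
          -- To the right of `x` on its level, every segment through `x` shows its negative side,
          -- where terms vanish.
          have : ¬ 0 < Γ.lin L z := by
            rw [hz, lin_of_h_eq hx hh]
            linarith
          rw [term_of_notMem hyL]
          simp [term, this]
        -- Off the line of `L` and off the level of `x`, both conditions in the term keep their
        -- truth value near `y`.
        · refine ⟨term θ x L y, ?_⟩
          filter_upwards [eventually_lin_pos_iff hy, eventually_h_lt_iff hh] with z hz hz'
          rw [term_of_notMem hyL, sub_zero]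
          simp only [term, hz, hz']
    · refine ⟨0, Eventually.of_forall fun z => ?_⟩
      rw [term_of_notMem hx, term_of_notMem fun h' => hx (hn.seg L h'), sub_zero]
  choose k hk using key
  refine ⟨∑ L, k L, ?_⟩
  filter_upwards [eventually_all.2 hk] with z hz
  unfold model
  rw [← Finset.sum_sub_distrib]
  exact Finset.sum_congr rfl fun L _ => hz L

/-- Across the horizontal half-line to the left of `x`, the model at `x` jumps by the sum of the
increments. -/
theorem eventually_model_sub_of_left {θ : Γ.Data G} (hθ : Compatible θ) {x y : Plane}
    (hn : Γ.Near x y) (hh : Γ.h y = Γ.h x) (h0 : y 0 < x 0) :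
    ∃ k, ∀ᶠ z in 𝓝 y, model θ x z - model θ y z =
      k + if Γ.h x < Γ.h z then ∑ L, incr θ x L else 0 := by
  have key : ∀ L, ∃ k, ∀ᶠ z in 𝓝 y, term θ x L z - term θ y L z =
      k + if Γ.h x < Γ.h z then incr θ x L else 0 := by
    intro L
    by_cases hx : x ∈ Γ.seg L
    · have hy : 0 < Γ.lin L y := by
        rw [lin_of_h_eq hx hh]
        linarith
      have hyL : y ∉ Γ.seg L := fun h' => hy.ne' h'.1
      refine ⟨jump θ L (Γ.h x), ?_⟩
      filter_upwards [eventually_lin_pos_iff hy.ne'] with z hz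
      rw [term_of_notMem hyL]
      simp [term, hx, hz.2 hy]
    · refine ⟨0, Eventually.of_forall fun z => ?_⟩
      rw [term_of_notMem hx, term_of_notMem fun h' => hx (hn.seg L h'), hθ.incr_eq_zero hx]
      simp
  choose k hk using key
  refine ⟨∑ L, k L, ?_⟩
  filter_upwards [eventually_all.2 hk] with z hz
  unfold model
  rw [← Finset.sum_sub_distrib, Finset.sum_congr rfl fun L _ => hz L, Finset.sum_add_distrib]
  split_ifs <;> simp

/-- The half-line to the left of `x` is the only place where the models can disagree by more than a
constant, and the discrepancy there is the sum of the increments. This is the input of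
`exists_glue_on`. -/
theorem eventually_model_sub {θ : Γ.Data G} (hθ : Compatible θ)
    (hc : ∀ A, ∑ L, θ.2 A L = 0) {x y : Plane} (hxΩ : x ∈ Ω) (hn : Γ.Near x y) :
    ∃ k, ∀ᶠ z in 𝓝 y, model θ x z - model θ y z = k := by
  by_cases hs : Γ.h y ≠ Γ.h x ∨ x 0 < y 0
  · exact eventually_model_sub_of_slit hθ hxΩ hn hs
  · push Not at hs
    rcases hs.2.lt_or_eq with h0 | h0
    · obtain ⟨k, hk⟩ := eventually_model_sub_of_left hθ hn hs.1 h0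
      refine ⟨k, hk.mono fun z hz => ?_⟩
      have : ∑ L, incr θ x L = 0 := by
        by_cases hV : x ∈ Γ.V
        · simp only [incr, hV, dite_true]
          exact hc _
        · simp [incr, hV]
      simpa [this] using hz
    · have : y = x := Γ.ext_h hs.1 h0
      subst this
      exact ⟨0, by simp⟩

/-- Every compatible family of jumps is realized by a piecewise constant function. -/
theorem exists_of_jumps (hΩ : IsOpen Ω) [SimplyConnectedSpace Ω] {θ : Γ.Data G}
    (hθ : Compatible θ) (hc : ∀ A, ∑ L, θ.2 A L = 0) :
    ∃ F : Plane → G, ∀ x ∈ Ω, ∃ k, ∀ᶠ z in 𝓝 x, F z = k + model θ x z := by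
  have : LocallyPathConnectedSpace Plane := inferInstance
  refine exists_glue_on hΩ (model θ) fun x hx => ?_
  filter_upwards [Γ.eventually_near hΩ hx] with y hy
  exact eventually_model_sub hθ hc hx hy

end SegmentSystem

end PolySpline

/-! ### Smoothness of piecewise polynomials and divisibility -/

namespace PolySpline

/-- Bivariate real polynomials. -/
abbrev Poly : Type := MvPolynomial (Fin 2) ℝ

/-- Evaluation of a bivariate polynomial at a point of the plane. -/
abbrev ev (x : Plane) : Poly →+* ℝ := MvPolynomial.eval (fun i => x i)

theorem hasFDerivAt_ev (p : Poly) (x : Plane) :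
    HasFDerivAt (fun y => ev y p)
      (∑ i, ev x (MvPolynomial.pderiv i p) • (EuclideanSpace.proj i : Plane →L[ℝ] ℝ)) x := by
  induction p using MvPolynomial.induction_on with
  | C a => simpa using hasFDerivAt_const a x
  | add p q hp hq =>
    refine ((hp.add hq).congr_fderiv ?_).congr_of_eventuallyEq ?_
    · simp only [map_add, add_smul, Finset.sum_add_distrib]
    · exact Eventually.of_forall fun y => by simp
  | mul_X p i hp =>
    have hX : HasFDerivAt (fun y : Plane => y i) (EuclideanSpace.proj i : Plane →L[ℝ] ℝ) x :=
      (EuclideanSpace.proj i : Plane →L[ℝ] ℝ).hasFDerivAt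
    refine ((hp.mul hX).congr_fderiv ?_).congr_of_eventuallyEq ?_
    · ext v
      fin_cases i <;> simp [Fin.sum_univ_two, MvPolynomial.pderiv_X] <;> ring
    · exact Eventually.of_forall fun y => by simp

theorem contDiff_ev (p : Poly) (n : WithTop ℕ∞) : ContDiff ℝ n (fun y : Plane => ev y p) := by
  induction p using MvPolynomial.induction_on with
  | C a => simpa using contDiff_const
  | add p q hp hq => simpa using hp.add hq
  | mul_X p i hp =>
    have hX : ContDiff ℝ n (fun y : Plane => y i) :=
      (EuclideanSpace.proj i : Plane →L[ℝ] ℝ).contDiff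
    simpa using hp.mul hX

theorem continuous_ev (p : Poly) : Continuous (fun y : Plane => ev y p) :=
  (contDiff_ev p 0).continuous

/-- All partial derivatives of `p` up to order `m` vanish at `x`. -/
def VanishesAt : ℕ → Poly → Plane → Prop
  | 0, p, x => ev x p = 0
  | m + 1, p, x => ev x p = 0 ∧ ∀ i, VanishesAt m (MvPolynomial.pderiv i p) x

theorem VanishesAt.eval_eq_zero {m : ℕ} {p : Poly} {x : Plane} (h : VanishesAt m p x) :
    ev x p = 0 := by
  cases m with
  | zero => exact h
  | succ m => exact h.1

theorem VanishesAt.zero (m : ℕ) (x : Plane) : VanishesAt m 0 x := by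
  induction m with
  | zero => simp [VanishesAt]
  | succ m ih => exact ⟨by simp, fun i => by simpa using ih⟩

theorem VanishesAt.add {m : ℕ} {p q : Poly} {x : Plane} (hp : VanishesAt m p x)
    (hq : VanishesAt m q x) : VanishesAt m (p + q) x := by
  induction m generalizing p q with
  | zero => simp only [VanishesAt] at hp hq ⊢; simp [hp, hq]
  | succ m ih => exact ⟨by simp [hp.1, hq.1], fun i => by simpa using ih (hp.2 i) (hq.2 i)⟩

theorem VanishesAt.sum {κ : Type*} {m : ℕ} {s : Finset κ} {p : κ → Poly} {x : Plane}
    (h : ∀ i ∈ s, VanishesAt m (p i) x) : VanishesAt m (∑ i ∈ s, p i) x := by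
  classical
  induction s using Finset.induction_on with
  | empty => simpa using VanishesAt.zero m x
  | insert a s ha ih =>
    rw [Finset.sum_insert ha]
    exact (h a (by simp)).add (ih fun i hi => h i (by simp [hi]))

/-- By the Leibniz rule a partial derivative loses at most one factor `l`. -/
theorem vanishesAt_of_pow_dvd {m : ℕ} {p l : Poly} {x : Plane} (hl : ev x l = 0)
    (h : l ^ (m + 1) ∣ p) : VanishesAt m p x := by
  induction m generalizing p with
  | zero =>
    obtain ⟨q, rfl⟩ := h
    simp [VanishesAt, hl]
  | succ m ih =>
    obtain ⟨q, rfl⟩ := h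
    refine ⟨by simp [hl], fun i => ih ?_⟩
    rw [Derivation.leibniz, Derivation.leibniz_pow]
    refine dvd_add ?_ ?_
    · exact Dvd.dvd.mul_right (pow_dvd_pow l (Nat.le_succ _)) _
    · simp only [smul_eq_mul, nsmul_eq_mul, Nat.add_sub_cancel]
      exact ⟨q * (((m + 1 + 1 : ℕ) : Poly) * MvPolynomial.pderiv i l), by ring⟩

/-- A function that is locally made up of finitely many polynomials, which at every point agree to
order `m` with the one that is valid there, is of class `C^m`. -/
theorem contDiffOn_of_pieces {Ω : Set Plane} (hΩ : IsOpen Ω) (m : ℕ) (k : Plane → Poly)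
    (hk : ∀ x ∈ Ω, ∃ P : Set Poly, P.Finite ∧ (∀ p ∈ P, VanishesAt m (p - k x) x) ∧
      ∀ᶠ y in 𝓝 x, k y ∈ P) :
    ContDiffOn ℝ m (fun y => ev y (k y)) Ω := by
  induction m generalizing k with
  | zero =>
    refine contDiffOn_zero.2 fun x hx => ContinuousAt.continuousWithinAt ?_
    obtain ⟨P, hfin, hP, hev⟩ := hk x hx
    intro U hU
    have h1 : ∀ᶠ y in 𝓝 x, ∀ p ∈ P, ev y p ∈ U := by
      refine (eventually_all_finite hfin).2 fun p hp => ?_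
      have : ev x p = ev x (k x) := by simpa [sub_eq_zero] using (hP p hp).eval_eq_zero
      exact (continuous_ev p).continuousAt.eventually_mem (by rw [this]; exact hU)
    change ∀ᶠ y in 𝓝 x, ev y (k y) ∈ U
    filter_upwards [h1, hev] with y hy hy'
    exact hy _ hy'
  | succ m ih =>
    -- All polynomials occurring near `x` share the value and the gradient of `k x` there, and since
    -- they are finitely many, the little-o estimate holds for all of them at once.
    have hd : ∀ x ∈ Ω, HasFDerivAt (fun y => ev y (k y))
        (∑ i, ev x (MvPolynomial.pderiv i (k x)) • (EuclideanSpace.proj i : Plane →L[ℝ] ℝ)) x := by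
      intro x hx
      obtain ⟨P, hfin, hP, hev⟩ := hk x hx
      refine HasFDerivAt.of_isLittleO (Asymptotics.isLittleO_iff.2 fun ε hε => ?_)
      have h1 : ∀ᶠ y in 𝓝 x, ∀ p ∈ P, ‖ev y p - ev x (k x) -
          (∑ i, ev x (MvPolynomial.pderiv i (k x)) •
            (EuclideanSpace.proj i : Plane →L[ℝ] ℝ)) (y - x)‖ ≤ ε * ‖y - x‖ := by
        refine (eventually_all_finite hfin).2 fun p hp => ?_
        have e0 : ev x p = ev x (k x) := by simpa [sub_eq_zero] using (hP p hp).eval_eq_zero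
        have e1 : ∀ i, ev x (MvPolynomial.pderiv i p) = ev x (MvPolynomial.pderiv i (k x)) := by
          intro i
          simpa [sub_eq_zero] using ((hP p hp).2 i).eval_eq_zero
        have := Asymptotics.isLittleO_iff.1 (hasFDerivAt_ev p x).isLittleO hε
        simpa only [e0, e1] using this
      filter_upwards [h1, hev] with y hy hy'
      exact hy _ hy'
    have hsmooth : ∀ i, ContDiffOn ℝ m (fun x => ev x (MvPolynomial.pderiv i (k x))) Ω := by
      intro i
      refine ih (fun x => MvPolynomial.pderiv i (k x)) fun x hx => ?_
      obtain ⟨P, hfin, hP, hev⟩ := hk x hx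
      refine ⟨MvPolynomial.pderiv i '' P, hfin.image _, ?_, ?_⟩
      · rintro _ ⟨p, hp, rfl⟩
        simpa using (hP p hp).2 i
      · filter_upwards [hev] with y hy
        exact ⟨_, hy, rfl⟩
    rw [Nat.cast_succ, contDiffOn_succ_iff_fderiv_of_isOpen hΩ]
    refine ⟨fun x hx => (hd x hx).differentiableAt.differentiableWithinAt, by simp, ?_⟩
    refine ContDiffOn.congr (f := fun x => ∑ i, ev x (MvPolynomial.pderiv i (k x)) •
      (EuclideanSpace.proj i : Plane →L[ℝ] ℝ)) ?_ fun x hx => (hd x hx).fderiv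
    exact ContDiffOn.sum fun i _ => (hsmooth i).smul contDiffOn_const

open Polynomial in
/-- A function of class `C^m` on the line that is zero to the left of the origin and a polynomial
to the right. -/
theorem X_pow_dvd_of_contDiffAt {m : ℕ} {g : ℝ → ℝ} {r : ℝ[X]} (hg : ContDiffAt ℝ m g 0)
    (hr : ∀ᶠ τ in 𝓝[>] (0 : ℝ), g τ = r.eval τ) (hl : ∀ᶠ τ in 𝓝[<] (0 : ℝ), g τ = 0) :
    X ^ (m + 1) ∣ r := by
  induction m generalizing g r with
  | zero =>
    have hc : ContinuousAt g 0 := hg.continuousAt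
    have h1 : g 0 = 0 := by
      refine tendsto_nhds_unique (hc.tendsto.mono_left (nhdsWithin_le_nhds (s := Set.Iio 0))) ?_
      exact tendsto_const_nhds.congr' (hl.mono fun _ h => h.symm)
    have h2 : g 0 = r.eval 0 := by
      refine tendsto_nhds_unique (hc.tendsto.mono_left (nhdsWithin_le_nhds (s := Set.Ioi 0))) ?_
      exact (r.continuous.continuousAt.tendsto.mono_left nhdsWithin_le_nhds).congr'
        (hr.mono fun _ h => h.symm)
    rw [zero_add, pow_one, X_dvd_iff, coeff_zero_eq_eval_zero, ← h2, h1]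
  | succ m ih =>
    have h0 : X ^ (m + 1) ∣ derivative r := by
      refine ih (g := deriv g) (hg.derivWithin (by simp)) ?_ ?_
      · have := eventually_eventually_nhdsWithin.2 hr
        filter_upwards [this, self_mem_nhdsWithin] with τ hτ hpos
        rw [IsOpen.nhdsWithin_eq isOpen_Ioi hpos] at hτ
        rw [Filter.EventuallyEq.deriv_eq hτ, Polynomial.deriv]
      · have := eventually_eventually_nhdsWithin.2 hl
        filter_upwards [this, self_mem_nhdsWithin] with τ hτ hpos
        rw [IsOpen.nhdsWithin_eq isOpen_Iio hpos] at hτ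
        rw [Filter.EventuallyEq.deriv_eq (f := fun _ => (0 : ℝ)) hτ, deriv_const]
    have h1 : X ^ 1 ∣ r := by
      have hg0 : ContDiffAt ℝ 0 g 0 := hg.of_le (by positivity)
      have hc : ContinuousAt g 0 := hg0.continuousAt
      have h1 : g 0 = 0 := by
        refine tendsto_nhds_unique (hc.tendsto.mono_left (nhdsWithin_le_nhds (s := Set.Iio 0))) ?_
        exact tendsto_const_nhds.congr' (hl.mono fun _ h => h.symm)
      have h2 : g 0 = r.eval 0 := by
        refine tendsto_nhds_unique (hc.tendsto.mono_left (nhdsWithin_le_nhds (s := Set.Ioi 0))) ?_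
        exact (r.continuous.continuousAt.tendsto.mono_left nhdsWithin_le_nhds).congr'
          (hr.mono fun _ h => h.symm)
      rw [pow_one, X_dvd_iff, coeff_zero_eq_eval_zero, ← h2, h1]
    -- The positive-degree coefficients of `r` are read off from its derivative, in which only
    -- nonzero integer factors appear; the constant one vanishes by continuity.
    rw [X_pow_dvd_iff] at h0 h1 ⊢
    intro n hn
    cases n with
    | zero => exact h1 0 (by simp)
    | succ n =>
      have := h0 n (by omega)
      rw [coeff_derivative] at this
      exact (mul_eq_zero.1 this).resolve_right (by positivity)

open Polynomial in
/-- Substitution of the point `a + X w + Y v`, as a polynomial in `Y` over `ℝ[X]`. -/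
def frame (a w v : Plane) : Poly →ₐ[ℝ] ℝ[X][X] :=
  MvPolynomial.aeval fun i => C (C (a i) + C (w i) * X) + C (C (v i)) * X

open Polynomial in
theorem evalEval_frame (a w v : Plane) (u τ : ℝ) (p : Poly) :
    (frame a w v p).evalEval u τ = ev (a + u • w + τ • v) p := by
  have : (evalEvalRingHom u τ).comp (frame a w v : Poly →+* ℝ[X][X]) =
      ev (a + u • w + τ • v) := by
    refine MvPolynomial.ringHom_ext (fun r => ?_) (fun i => ?_)
    · simp [frame]
    · simp [frame]
      ring
  exact congrArg (fun φ : Poly →+* ℝ => φ p) this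

open Polynomial in
-- The substitution is an affine change of coordinates, inverted by Cramer's rule. The image of the
-- outer variable is recorded because it is, up to a constant, the equation of the line through `a`
-- in direction `w`.
theorem exists_frame_leftInverse {w v : Plane} (a : Plane) (h : w 0 * v 1 - w 1 * v 0 ≠ 0) :
    ∃ ψ : ℝ[X][X] →+* Poly, (∀ p, ψ (frame a w v p) = p) ∧
      ψ X = MvPolynomial.C (w 0 * v 1 - w 1 * v 0)⁻¹ *
        (MvPolynomial.C (w 0) * (MvPolynomial.X 1 - MvPolynomial.C (a 1)) -
          MvPolynomial.C (w 1) * (MvPolynomial.X 0 - MvPolynomial.C (a 0))) := by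
  set D := w 0 * v 1 - w 1 * v 0
  let U : Poly := MvPolynomial.C D⁻¹ *
        (MvPolynomial.C (v 1) * (MvPolynomial.X 0 - MvPolynomial.C (a 0)) -
          MvPolynomial.C (v 0) * (MvPolynomial.X 1 - MvPolynomial.C (a 1)))
  let T : Poly := MvPolynomial.C D⁻¹ *
        (MvPolynomial.C (w 0) * (MvPolynomial.X 1 - MvPolynomial.C (a 1)) -
          MvPolynomial.C (w 1) * (MvPolynomial.X 0 - MvPolynomial.C (a 0)))
  let ψ : ℝ[X][X] →+* Poly := eval₂RingHom (eval₂RingHom MvPolynomial.C U) T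
  have hD : (MvPolynomial.C D : Poly) * MvPolynomial.C D⁻¹ = 1 := by
    rw [← map_mul, mul_inv_cancel₀ h, map_one]
  have hD' : (MvPolynomial.C D : Poly) = MvPolynomial.C (w 0) * MvPolynomial.C (v 1) -
      MvPolynomial.C (w 1) * MvPolynomial.C (v 0) := by
    simp [D]
  refine ⟨ψ, fun p => ?_, by simp [ψ, T]⟩
  have : ψ.comp (frame a w v : Poly →+* ℝ[X][X]) = RingHom.id Poly := by
    refine MvPolynomial.ringHom_ext (fun r => ?_) (fun i => ?_)
    · simp [frame, ψ]
    · have e : ψ (frame a w v (MvPolynomial.X i)) =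
          MvPolynomial.C (a i) + MvPolynomial.C (w i) * U + MvPolynomial.C (v i) * T := by
        simp [frame, ψ]
      refine e.trans ?_
      have e2 : (MvPolynomial.X i : Poly) - MvPolynomial.C (a i) =
          MvPolynomial.C D * MvPolynomial.C D⁻¹ * (MvPolynomial.X i - MvPolynomial.C (a i)) := by
        rw [hD, one_mul]
      simp only [RingHom.id_apply]
      rw [← sub_eq_zero]
      rw [hD'] at e2
      fin_cases i
      · simp only [Fin.zero_eta, Fin.isValue] at e2 ⊢
        simp only [U, T]
        linear_combination -e2
      · simp only [Fin.mk_one, Fin.isValue] at e2 ⊢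
        simp only [U, T]
        linear_combination -e2
  exact congrArg (fun φ : Poly →+* Poly => φ p) this

theorem frame_injective {w v : Plane} (a : Plane) (h : w 0 * v 1 - w 1 * v 0 ≠ 0) :
    Function.Injective (frame a w v) := by
  obtain ⟨ψ, hψ, -⟩ := exists_frame_leftInverse a h
  exact Function.LeftInverse.injective hψ

open Polynomial in
/-- If `p` on one side of a line and `q` on the other side make up a function of class `C^m`, then
`p - q` vanishes to order `m` along the line. -/
theorem X_pow_dvd_frame {m : ℕ} {f : Plane → ℝ} {p q : Poly} {a w v : Plane} {S : Set ℝ}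
    (hS : S.Infinite)
    (h : ∀ u ∈ S, ContDiffAt ℝ m f (a + u • w) ∧
      (∀ᶠ τ in 𝓝[>] (0 : ℝ), f (a + u • w + τ • v) = ev (a + u • w + τ • v) p) ∧
      ∀ᶠ τ in 𝓝[<] (0 : ℝ), f (a + u • w + τ • v) = ev (a + u • w + τ • v) q) :
    X ^ (m + 1) ∣ frame a w v (p - q) := by
  -- For fixed `u` the difference of `f` and `q` along the direction `v` falls under the
  -- one-variable lemma.
  have key : ∀ u ∈ S, X ^ (m + 1) ∣ (frame a w v (p - q)).map (evalRingHom u) := by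
    intro u hu
    obtain ⟨h1, h2, h3⟩ := h u hu
    have hγ : ContDiff ℝ m (fun τ : ℝ => a + u • w + τ • v) := by fun_prop
    have e : ∀ (r : Poly) (τ : ℝ), ((frame a w v r).map (evalRingHom u)).eval τ =
        ev (a + u • w + τ • v) r := by
      intro r τ
      rw [← evalEval_frame, ← map_evalRingHom_eval]
    refine X_pow_dvd_of_contDiffAt
      (g := fun τ => f (a + u • w + τ • v) - ev (a + u • w + τ • v) q) ?_ ?_ ?_
    · refine ContDiffAt.sub ?_ ?_
      · refine ContDiffAt.comp (0 : ℝ) ?_ hγ.contDiffAt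
        simpa using h1
      · exact ((contDiff_ev q m).comp hγ).contDiffAt
    · filter_upwards [h2] with τ hτ
      rw [e, hτ, map_sub]
    · filter_upwards [h3] with τ hτ
      rw [hτ, sub_self]
  rw [X_pow_dvd_iff]
  intro n hn
  -- A transversal coefficient of order at most `m` is a polynomial in `u` with infinitely many
  -- zeros.
  refine eq_zero_of_infinite_isRoot _ (hS.mono fun u hu => ?_)
  have := X_pow_dvd_iff.1 (key u hu) n hn
  simpa [coeff_map] using this

end PolySpline

/-! ### Sums of univariate polynomials with prescribed multiple roots -/

namespace PolySpline

section Univariate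

open Polynomial

/-- If `r` were nonzero, differentiation would lower the multiplicity of the root `b` by one, and
the factor `X - a` does not make up for it. -/
theorem eq_zero_of_smul_eq_mul_derivative {r : ℝ[X]} {a b : ℝ} (hab : a ≠ b) {D : ℕ}
    (h : (D : ℝ[X]) * r = (X - C a) * derivative r) (hb : r.eval b = 0) : r = 0 := by
  by_contra hr
  have hXa : (X - C a : ℝ[X]) ≠ 0 := X_sub_C_ne_zero a
  by_cases hd : derivative r = 0
  · have := derivative_eq_zero.1 hd
    rw [eq_C_of_natDegree_eq_zero this] at hb hr
    simp at hb
    simp [hb] at hr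
  · have hD : (D : ℝ[X]) ≠ 0 := by
      intro h0
      rw [h0, zero_mul] at h
      exact mul_ne_zero hXa hd h.symm
    have h1 := congrArg (rootMultiplicity b) h
    rw [rootMultiplicity_mul (mul_ne_zero hD hr), rootMultiplicity_mul (mul_ne_zero hXa hd),
      derivative_rootMultiplicity_of_root hb, rootMultiplicity_X_sub_C, if_neg hab.symm,
      ← C_eq_natCast, rootMultiplicity_C, zero_add, zero_add] at h1
    have := (rootMultiplicity_pos hr).2 hb
    omega

/-- The polynomials of degree less than `n` that are divisible by `(X - c) ^ e`. -/
def dvdLT (n : ℕ) (c : ℝ) (e : ℕ) : Submodule ℝ ℝ[X] where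
  carrier := {r | r ∈ degreeLT ℝ n ∧ (X - C c) ^ e ∣ r}
  zero_mem' := ⟨zero_mem _, dvd_zero _⟩
  add_mem' := fun ha hb => ⟨add_mem ha.1 hb.1, dvd_add ha.2 hb.2⟩
  smul_mem' := fun a _ hb => ⟨Submodule.smul_mem _ a hb.1, by
    rw [smul_eq_C_mul]; exact hb.2.mul_left _⟩

theorem mem_dvdLT {n : ℕ} {c : ℝ} {e : ℕ} {r : ℝ[X]} :
    r ∈ dvdLT n c e ↔ r ∈ degreeLT ℝ n ∧ (X - C c) ^ e ∣ r := Iff.rfl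

theorem dvdLT_le_degreeLT (n : ℕ) (c : ℝ) (e : ℕ) : dvdLT n c e ≤ degreeLT ℝ n := fun _ h => h.1

instance (n : ℕ) (c : ℝ) (e : ℕ) : FiniteDimensional ℝ (dvdLT n c e) :=
  Submodule.finiteDimensional_of_le (dvdLT_le_degreeLT n c e)

theorem finrank_degreeLT (n : ℕ) : Module.finrank ℝ (degreeLT ℝ n) = n := by
  rw [(degreeLTEquiv ℝ n).finrank_eq]
  simp

theorem pow_mul_mem_degreeLT {n e : ℕ} {c : ℝ} {r : ℝ[X]} :
    (X - C c) ^ e * r ∈ degreeLT ℝ n ↔ r ∈ degreeLT ℝ (n - e) := by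
  by_cases hr : r = 0
  · simp [hr]
  have hm : ((X - C c) ^ e).Monic := (monic_X_sub_C c).pow e
  have h2 : (X - C c) ^ e * r ≠ 0 := mul_ne_zero hm.ne_zero hr
  rw [mem_degreeLT, mem_degreeLT, ← natDegree_lt_iff_degree_lt h2, ← natDegree_lt_iff_degree_lt hr,
    hm.natDegree_mul' hr, natDegree_pow, natDegree_X_sub_C]
  omega

/-- Multiplication by the monic power identifies the space with the polynomials of degree less than
`n - e`; for `e > n` both sides are zero in truncated subtraction. -/
theorem finrank_dvdLT (n : ℕ) (c : ℝ) (e : ℕ) : Module.finrank ℝ (dvdLT n c e) = n - e := by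
  let ψ : degreeLT ℝ (n - e) →ₗ[ℝ] ℝ[X] :=
    (LinearMap.mulLeft ℝ ((X - C c) ^ e)).comp (degreeLT ℝ (n - e)).subtype
  let φ : degreeLT ℝ (n - e) →ₗ[ℝ] dvdLT n c e :=
    ψ.codRestrict _ fun r => mem_dvdLT.2 ⟨pow_mul_mem_degreeLT.2 r.2, Dvd.intro _ rfl⟩
  have hv : ∀ r, (φ r : ℝ[X]) = (X - C c) ^ e * (r : ℝ[X]) := fun r => by
    simp only [φ, ψ, LinearMap.codRestrict_apply, LinearMap.comp_apply, LinearMap.mulLeft_apply,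
      Submodule.subtype_apply]
  have hφ : Function.Bijective φ := by
    refine ⟨fun r r' h => ?_, ?_⟩
    · have h' : (X - C c) ^ e * (r : ℝ[X]) = (X - C c) ^ e * (r' : ℝ[X]) := by
        rw [← hv, ← hv, h]
      exact Subtype.ext (mul_left_cancel₀ ((monic_X_sub_C c).pow e).ne_zero h')
    · rintro ⟨_, hr, q, rfl⟩
      exact ⟨⟨q, pow_mul_mem_degreeLT.1 hr⟩, Subtype.ext (hv _)⟩
  rw [← (LinearEquiv.ofBijective φ hφ).finrank_eq, finrank_degreeLT]

/-- Powers of different linear forms have no unexpected relations. -/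
theorem eq_zero_of_sum_eq_zero {ι : Type*} [Fintype ι] {c : ι → ℝ} (hc : Function.Injective c)
    {D : ℕ} {n : ι → ℕ} (hn : ∑ i, n i ≤ D) {r : ι → ℝ[X]}
    (hr : ∀ i, r i ∈ dvdLT D (c i) (D - n i)) (hsum : ∑ i, r i = 0) (i : ι) : r i = 0 := by
  classical
  induction D generalizing n r i with
  | zero =>
    have := (hr i).1
    rw [mem_degreeLT] at this
    exact degree_eq_bot.1 (by simpa using this)
  | succ D ih =>
    -- If all `n i` are zero, the required divisors have degree `D + 1`, beyond the degree bound.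
    by_cases h0 : ∀ i, n i = 0
    · have h1 := hr i
      rw [h0 i] at h1
      have : dvdLT (D + 1) (c i) (D + 1 - 0) = ⊥ := by
        apply Submodule.finrank_eq_zero.1
        rw [finrank_dvdLT]
        simp
      rw [this] at h1
      exact (Submodule.mem_bot ℝ).1 h1
    push Not at h0
    obtain ⟨j, hj⟩ := h0
    have hother : ∀ i, i ≠ j → n i ≤ D := by
      intro i hi
      have : n i + n j ≤ ∑ i, n i := by
        rw [← Finset.sum_pair hi]
        exact Finset.sum_le_sum_of_subset (Finset.subset_univ _)
      omega
    -- The operator `D - (X - c j) d/dX` cancels the term of degree `D`. It costs one order of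
    -- vanishing at the other `c i`, but none at `c j`. Hence the images satisfy the hypotheses for
    -- `D` with `n j` lowered by one, and the induction shows that they are all zero.
    let T : ℝ[X] →ₗ[ℝ] ℝ[X] :=
      (D : ℝ) • LinearMap.id - (LinearMap.mulLeft ℝ (X - C (c j))).comp derivative
    have hT : ∀ p, T p = (D : ℝ[X]) * p - (X - C (c j)) * derivative p := by
      intro p
      simp [T, smul_eq_C_mul]
    have hdeg : ∀ p ∈ degreeLT ℝ (D + 1), T p ∈ degreeLT ℝ D := by
      intro p hp
      rw [mem_degreeLT, degree_lt_iff_coeff_zero] at hp ⊢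
      intro m hm
      have hp1 : p.coeff (m + 1) = 0 := hp (m + 1) (by omega)
      rw [hT, sub_mul, ← C_eq_natCast]
      simp only [coeff_sub, coeff_C_mul, coeff_derivative, hp1]
      cases m with
      | zero =>
        have : D = 0 := by omega
        subst this
        simp
      | succ m =>
        rw [coeff_X_mul, coeff_derivative]
        rcases Nat.eq_or_lt_of_le hm with h | h
        · rw [h]; push_cast; ring
        · rw [hp (m + 1) (by omega)]; simp
    have hdvd : ∀ i e, (X - C (c i)) ^ (e + 1) ∣ r i → (X - C (c i)) ^ e ∣ T (r i) := by
      rintro i e ⟨q, hq⟩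
      rw [hT, hq]
      refine dvd_sub (Dvd.dvd.mul_left (Dvd.dvd.mul_right (pow_dvd_pow _ e.le_succ) _) _)
        (Dvd.dvd.mul_left ?_ _)
      rw [derivative_mul, derivative_X_sub_C_pow, Nat.add_sub_cancel]
      exact dvd_add ⟨C ((e + 1 : ℕ) : ℝ) * q, by ring⟩
        (Dvd.dvd.mul_right (pow_dvd_pow _ e.le_succ) _)
    have hzero : ∀ i, T (r i) = 0 := by
      intro i
      refine ih (n := fun i => if i = j then n j - 1 else n i) (r := fun i => T (r i)) ?_ ?_ ?_ i
      · have h1 : ∑ i, n i = n j + ∑ i ∈ Finset.univ.erase j, n i :=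
          (Finset.add_sum_erase _ _ (Finset.mem_univ j)).symm
        have h2 : ∑ i, (if i = j then n j - 1 else n i) =
            (n j - 1) + ∑ i ∈ Finset.univ.erase j, n i := by
          rw [← Finset.add_sum_erase _ _ (Finset.mem_univ j)]
          simp only [if_true]
          congr 1
          refine Finset.sum_congr rfl fun i hi => ?_
          rw [if_neg (Finset.ne_of_mem_erase hi)]
        rw [h2]
        omega
      · intro i
        refine ⟨hdeg _ (hr i).1, ?_⟩
        by_cases hij : i = j
        · subst hij
          simp only [if_true]
          obtain ⟨q, hq⟩ := (hr i).2
          have he : D - (n i - 1) = D + 1 - n i := by omega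
          rw [he, hT]
          generalize D + 1 - n i = e at hq ⊢
          rw [hq, derivative_mul, derivative_X_sub_C_pow]
          refine dvd_sub (Dvd.dvd.mul_left (dvd_mul_right _ _) _) ?_
          cases e with
          | zero => simp
          | succ e =>
            rw [Nat.add_sub_cancel]
            exact ⟨C ((e + 1 : ℕ) : ℝ) * q + (X - C (c i)) * derivative q, by ring⟩
        · simp only [if_neg hij]
          have he := hother i hij
          have h2 := (hr i).2
          rw [show D + 1 - n i = (D - n i) + 1 by omega] at h2
          exact hdvd i _ h2
      · rw [← map_sum, hsum, map_zero]
    -- For `i ≠ j` the bound `n i ≤ D` leaves at least a simple zero of `r i` at `c i`, which is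
    -- incompatible with `T (r i) = 0` unless `r i = 0`. Then `r j` is the whole sum.
    have hne : ∀ i, i ≠ j → r i = 0 := by
      intro i hi
      refine eq_zero_of_smul_eq_mul_derivative (a := c j) (b := c i) (D := D)
        (fun h => hi (hc h.symm)) ?_ ?_
      · rw [← sub_eq_zero, ← hT]
        exact hzero i
      · have h2 := (hr i).2
        have he := hother i hi
        rw [show D + 1 - n i = (D - n i) + 1 by omega, pow_succ] at h2
        exact dvd_iff_isRoot.1 ((dvd_mul_left _ _).trans h2)
    by_cases hij : i = j
    · subst hij
      rw [Finset.sum_eq_single i (fun b _ hb => hne b hb) (by simp)] at hsum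
      exact hsum
    · exact hne i hij

/-- Each index in turn takes as much of what remains of `D` as it can. -/
theorem exists_le_sum_eq {ι : Type*} (s : Finset ι) (n : ι → ℕ) {D : ℕ} (h : D ≤ ∑ i ∈ s, n i) :
    ∃ n' : ι → ℕ, (∀ i, n' i ≤ n i) ∧ ∑ i ∈ s, n' i = D := by
  classical
  induction s using Finset.induction_on generalizing D with
  | empty => exact ⟨fun _ => 0, fun _ => Nat.zero_le _, by simp at h; simp [h]⟩
  | insert a s ha ih =>
    rw [Finset.sum_insert ha] at h
    obtain ⟨n', h1, h2⟩ := ih (D := D - min D (n a)) (by omega)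
    refine ⟨Function.update n' a (min D (n a)), fun i => ?_, ?_⟩
    · by_cases hi : i = a
      · subst hi; simp
      · simpa [hi] using h1 i
    · rw [Finset.sum_insert ha, Function.update_self, Finset.sum_congr rfl (g := n')]
      · change _ + ∑ i ∈ s, n' i = D
        omega
      · intro i hi
        rw [Function.update_of_ne]
        rintro rfl
        exact ha hi

/-- The sum of families of polynomials of degree less than `D` divisible by `(X - c i) ^ e i`. -/
def sumDvdLT {ι : Type*} [Fintype ι] (c : ι → ℝ) (D : ℕ) (e : ι → ℕ) :
    ((i : ι) → dvdLT D (c i) (e i)) →ₗ[ℝ] degreeLT ℝ D :=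
  (∑ i, (dvdLT D (c i) (e i)).subtype.comp (LinearMap.proj i)).codRestrict _ fun r => by
    rw [LinearMap.sum_apply]
    exact sum_mem fun i _ => (r i).2.1

theorem coe_sumDvdLT {ι : Type*} [Fintype ι] (c : ι → ℝ) (D : ℕ) (e : ι → ℕ)
    (r : (i : ι) → dvdLT D (c i) (e i)) : (sumDvdLT c D e r : ℝ[X]) = ∑ i, (r i : ℝ[X]) := by
  simp [sumDvdLT]

theorem ker_sumDvdLT {ι : Type*} [Fintype ι] {c : ι → ℝ} (hc : Function.Injective c) {D : ℕ}
    {n e : ι → ℕ} (hn : ∑ i, n i ≤ D) (he : ∀ i, D - n i ≤ e i) :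
    LinearMap.ker (sumDvdLT c D e) = ⊥ := by
  refine LinearMap.ker_eq_bot'.2 fun r hr => ?_
  have h := congrArg Subtype.val hr
  rw [coe_sumDvdLT] at h
  ext1 i
  exact Subtype.ext (eq_zero_of_sum_eq_zero hc hn
    (fun i => ⟨(r i).2.1, (pow_dvd_pow _ (he i)).trans (r i).2.2⟩) h i)

/-- The sum map has maximal rank: it is injective if the summands have total dimension at most `D`,
and surjective otherwise. Truncated subtraction covers both cases. -/
theorem finrank_ker_sumDvdLT {ι : Type*} [Fintype ι] {c : ι → ℝ} (hc : Function.Injective c)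
    (D e : ℕ) : Module.finrank ℝ (LinearMap.ker (sumDvdLT c D fun _ => e)) =
      Fintype.card ι * (D - e) - D := by
  wlog he : e ≤ D generalizing e
  · have h0 : Module.finrank ℝ ((i : ι) → dvdLT D (c i) e) = 0 := by
      rw [Module.finrank_pi_fintype]
      exact Finset.sum_eq_zero fun i _ => by rw [finrank_dvdLT]; omega
    have := Submodule.finrank_le (LinearMap.ker (sumDvdLT c D fun _ => e))
    have h1 : D - e = 0 := by omega
    rw [h1, Nat.mul_zero, Nat.zero_sub]
    omega
  rcases le_total (Fintype.card ι * (D - e)) D with h | h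
  · have hk := ker_sumDvdLT hc (n := fun _ => D - e) (e := fun _ => e) (D := D)
      (by simpa using h) fun _ => by omega
    rw [hk, finrank_bot]
    omega
  -- Shrinking the summands to total dimension exactly `D` gives an injective map between spaces of
  -- equal dimension, hence a surjective one; the full summands then span as well.
  · obtain ⟨n', h1, h2⟩ := exists_le_sum_eq (Finset.univ : Finset ι) (fun _ => D - e) (D := D)
      (by simpa using h)
    have hinj := LinearMap.ker_eq_bot.1 (ker_sumDvdLT hc h2.le fun _ => le_rfl)
    have hdim : Module.finrank ℝ ((i : ι) → dvdLT D (c i) (D - n' i)) =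
        Module.finrank ℝ (degreeLT ℝ D) := by
      rw [Module.finrank_pi_fintype, finrank_degreeLT, ← h2]
      refine Finset.sum_congr rfl fun i _ => ?_
      have : n' i ≤ ∑ i, n' i := Finset.single_le_sum (fun _ _ => Nat.zero_le _) (Finset.mem_univ i)
      rw [finrank_dvdLT]
      omega
    have hsurj := (LinearMap.injective_iff_surjective_of_finrank_eq_finrank hdim).1 hinj
    have hsurj' : Function.Surjective (sumDvdLT c D fun _ => e) := by
      intro p
      obtain ⟨r, rfl⟩ := hsurj p
      refine ⟨fun i => ⟨r i, (r i).2.1, (pow_dvd_pow _ ?_).trans (r i).2.2⟩, ?_⟩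
      · have := h1 i
        omega
      · refine Subtype.ext ?_
        rw [coe_sumDvdLT, coe_sumDvdLT]
    have := LinearMap.finrank_range_add_finrank_ker (sumDvdLT c D fun _ => e)
    rw [LinearMap.range_eq_top.2 hsurj', finrank_top, finrank_degreeLT,
      Module.finrank_pi_fintype] at this
    simp only [finrank_dvdLT, Finset.sum_const, Finset.card_univ, smul_eq_mul] at this
    omega

end Univariate

end PolySpline

/-! ### Polar-like coordinates around a point -/

namespace PolySpline

section Graded

open Polynomial

/-- The polynomials in `S` over `ℝ[X]` of degree at most `d` whose coefficient of `S ^ k` has degree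
at most `k`. -/
def graded (d : ℕ) : Submodule ℝ ℝ[X][X] where
  carrier := {f | ∀ k, (f.coeff k).natDegree ≤ k ∧ (d < k → f.coeff k = 0)}
  zero_mem' := fun k => by simp
  add_mem' := fun ha hb k => ⟨by
    rw [coeff_add]
    exact (natDegree_add_le _ _).trans (max_le (ha k).1 (hb k).1), fun hk => by
    rw [coeff_add, (ha k).2 hk, (hb k).2 hk, add_zero]⟩
  smul_mem' := fun a f hf k => ⟨by
    rw [coeff_smul]
    exact (natDegree_smul_le _ _).trans (hf k).1, fun hk => by
    rw [coeff_smul, (hf k).2 hk, smul_zero]⟩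

theorem graded_mono {d e : ℕ} (h : d ≤ e) : graded d ≤ graded e :=
  fun _ hf k => ⟨(hf k).1, fun hk => (hf k).2 (h.trans_lt hk)⟩

theorem mul_mem_graded {d e : ℕ} {f g : ℝ[X][X]} (hf : f ∈ graded d) (hg : g ∈ graded e) :
    f * g ∈ graded (d + e) := by
  intro k
  rw [coeff_mul]
  refine ⟨natDegree_sum_le_of_forall_le _ _ fun x hx => ?_, fun hk => ?_⟩
  · rw [Finset.HasAntidiagonal.mem_antidiagonal] at hx
    refine natDegree_mul_le.trans ?_
    rw [← hx]
    exact add_le_add (hf x.1).1 (hg x.2).1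
  · refine Finset.sum_eq_zero fun x hx => ?_
    rw [Finset.HasAntidiagonal.mem_antidiagonal] at hx
    rcases lt_or_ge d x.1 with h | h
    · rw [(hf x.1).2 h, zero_mul]
    · rw [(hg x.2).2 (by omega), mul_zero]

theorem C_C_mem_graded (a : ℝ) : (C (C a) : ℝ[X][X]) ∈ graded 0 := by
  intro k
  rw [coeff_C]
  split_ifs with h
  · simp [h]
  · simp

theorem pow_mem_graded {d : ℕ} {f : ℝ[X][X]} (hf : f ∈ graded d) (n : ℕ) :
    f ^ n ∈ graded (n * d) := by
  induction n with
  | zero => simpa using C_C_mem_graded 1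
  | succ n ih =>
    rw [pow_succ, Nat.succ_mul]
    exact mul_mem_graded ih hf

/-- The point at position `X` on the level `S` above `A`, in sheared coordinates. -/
def blowPt (κ : ℝ) (A : Plane) : Fin 2 → ℝ[X][X] :=
  ![C (C (A 0)) + C X * X, C (C (A 1)) + C (1 - C κ * X) * X]

/-- Substitution of polar-like coordinates around `A`. -/
def blow (κ : ℝ) (A : Plane) : Poly →ₐ[ℝ] ℝ[X][X] := MvPolynomial.aeval (blowPt κ A)

theorem blowPt_mem (κ : ℝ) (A : Plane) (i : Fin 2) : blowPt κ A i ∈ graded 1 := by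
  have key : ∀ (a : ℝ) (q : ℝ[X]), q.natDegree ≤ 1 → C (C a) + C q * X ∈ graded 1 := by
    intro a q hq
    refine add_mem (graded_mono zero_le_one (C_C_mem_graded a)) fun k => ?_
    rw [coeff_C_mul, coeff_X]
    split_ifs with h
    · subst h
      simpa using hq
    · simp
  fin_cases i
  · exact key _ _ natDegree_X_le
  · refine key _ _ ((natDegree_sub_le _ _).trans (max_le (by simp) ?_))
    exact (natDegree_C_mul_le _ _).trans natDegree_X_le

/-- Each coordinate becomes a constant plus `S` times a polynomial of degree at most one in `X`, so
no power of `X` arises without an equal power of `S`. -/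
theorem blow_mem {κ : ℝ} {A : Plane} {d : ℕ} {p : Poly} (hp : p.totalDegree ≤ d) :
    blow κ A p ∈ graded d := by
  rw [p.as_sum, map_sum]
  refine sum_mem fun m hm => ?_
  rw [blow, MvPolynomial.aeval_monomial, Finsupp.prod_fintype _ _ (by simp), Fin.prod_univ_two]
  have h1 := MvPolynomial.le_totalDegree hm
  rw [Finsupp.sum_fintype _ _ (by simp), Fin.sum_univ_two] at h1
  refine graded_mono (h1.trans hp) ?_
  have := mul_mem_graded (C_C_mem_graded (p.coeff m))
    (mul_mem_graded (pow_mem_graded (blowPt_mem κ A 0) (m 0))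
      (pow_mem_graded (blowPt_mem κ A 1) (m 1)))
  simpa using this

theorem evalEval_blow (κ : ℝ) (A : Plane) (x s : ℝ) (p : Poly) :
    (blow κ A p).evalEval x s =
      MvPolynomial.eval ![A 0 + s * x, A 1 + s * (1 - κ * x)] p := by
  have : (evalEvalRingHom x s).comp (blow κ A : Poly →+* ℝ[X][X]) =
      MvPolynomial.eval ![A 0 + s * x, A 1 + s * (1 - κ * x)] := by
    refine MvPolynomial.ringHom_ext (fun r => ?_) (fun i => ?_)
    · simp [blow]
    · fin_cases i <;> simp [blow, blowPt] <;> ring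
  exact congrArg (fun φ : Poly →+* ℝ => φ p) this

/-- The coordinates reach every point off the level of `A`. A polynomial in the kernel, multiplied
by the equation `l` of that level, therefore vanishes everywhere. -/
theorem blow_injective (κ : ℝ) (A : Plane) : Function.Injective (blow κ A) := by
  rw [injective_iff_map_eq_zero]
  intro p hp
  let l : Poly := MvPolynomial.X 1 + MvPolynomial.C κ * MvPolynomial.X 0 - MvPolynomial.C (ht κ A)
  have h1 : p * l = 0 := by
    refine MvPolynomial.funext fun y => ?_
    rw [map_mul, map_zero]
    by_cases hs : y 1 + κ * y 0 - ht κ A = 0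
    · have : MvPolynomial.eval y l = 0 := by simpa [l] using hs
      rw [this, mul_zero]
    · have := evalEval_blow κ A ((y 0 - A 0) / (y 1 + κ * y 0 - ht κ A))
        (y 1 + κ * y 0 - ht κ A) p
      have hy : ![A 0 + (y 1 + κ * y 0 - ht κ A) * ((y 0 - A 0) / (y 1 + κ * y 0 - ht κ A)),
          A 1 + (y 1 + κ * y 0 - ht κ A) *
            (1 - κ * ((y 0 - A 0) / (y 1 + κ * y 0 - ht κ A)))] = y := by
        ext i
        fin_cases i
        · simp only [Fin.zero_eta, Fin.isValue, Matrix.cons_val_zero]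
          field_simp
          ring
        · simp only [Fin.mk_one, Fin.isValue, Matrix.cons_val_one, Matrix.cons_val_fin_one]
          field_simp
          unfold ht
          ring
      rw [hy, hp] at this
      rw [← this]
      simp
  refine (mul_eq_zero.1 h1).resolve_right fun h0 => ?_
  -- The point one unit above `A` is off its level: `l` takes the value 1 there.
  have := congrArg (MvPolynomial.eval ![A 0, A 1 + 1]) h0
  simp [l, ht] at this

/-- A monomial `X ^ j * S ^ k` with `j ≤ k` is the image of `ξ ^ j * η ^ (k - j)`, where `ξ` is the
horizontal displacement from `A` and `η` the height above `A`. -/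
theorem exists_blow_eq (κ : ℝ) (A : Plane) {d : ℕ} {f : ℝ[X][X]} (hf : f ∈ graded d) :
    ∃ p : Poly, p.totalDegree ≤ d ∧ blow κ A p = f := by
  let ξ : Poly := MvPolynomial.X 0 - MvPolynomial.C (A 0)
  let η : Poly := MvPolynomial.X 1 - MvPolynomial.C (A 1) + MvPolynomial.C κ * ξ
  have hξ : blow κ A ξ = C X * X := by simp [blow, blowPt, ξ]
  have hη : blow κ A η = X := by
    simp only [η, map_add, hξ, map_mul, map_sub]
    simp [blow, blowPt]
    ring
  have hξd : ξ.totalDegree ≤ 1 :=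
    (MvPolynomial.totalDegree_sub_C_le _ _).trans (MvPolynomial.totalDegree_X _).le
  have hηd : η.totalDegree ≤ 1 := by
    refine (MvPolynomial.totalDegree_add _ _).trans (max_le ?_ ?_)
    · exact (MvPolynomial.totalDegree_sub_C_le _ _).trans (MvPolynomial.totalDegree_X _).le
    · refine (MvPolynomial.totalDegree_mul _ _).trans ?_
      rw [MvPolynomial.totalDegree_C, zero_add]
      exact hξd
  refine ⟨∑ k ∈ Finset.range (d + 1), ∑ j ∈ Finset.range (k + 1),
    MvPolynomial.C ((f.coeff k).coeff j) * (ξ ^ j * η ^ (k - j)), ?_, ?_⟩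
  · rw [← MvPolynomial.mem_restrictTotalDegree]
    refine sum_mem fun k hk => sum_mem fun j hj => ?_
    rw [Finset.mem_range] at hk hj
    rw [MvPolynomial.mem_restrictTotalDegree]
    refine (MvPolynomial.totalDegree_mul _ _).trans ?_
    rw [MvPolynomial.totalDegree_C, zero_add]
    refine (MvPolynomial.totalDegree_mul _ _).trans ?_
    have h1 := (MvPolynomial.totalDegree_pow ξ j).trans (Nat.mul_le_mul_left j hξd)
    have h2 := (MvPolynomial.totalDegree_pow η (k - j)).trans (Nat.mul_le_mul_left (k - j) hηd)
    omega
  · have hfd : f.natDegree < d + 1 := by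
      by_contra h
      push Not at h
      have h1 := (hf f.natDegree).2 (by omega)
      have h2 : f = 0 := leadingCoeff_eq_zero.1 h1
      simp [h2] at h
    conv_rhs => rw [f.as_sum_range_C_mul_X_pow' hfd]
    rw [map_sum]
    refine Finset.sum_congr rfl fun k hk => ?_
    have hk' := (hf k).1
    conv_rhs => rw [(f.coeff k).as_sum_range_C_mul_X_pow' (Nat.lt_succ_of_le hk')]
    rw [map_sum, map_sum, Finset.sum_mul]
    refine Finset.sum_congr rfl fun j hj => ?_
    rw [Finset.mem_range] at hj
    simp only [map_mul, map_pow, hξ, hη]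
    have e1 : blow κ A (MvPolynomial.C ((f.coeff k).coeff j)) = C (C ((f.coeff k).coeff j)) := by
      simp [blow]
    rw [e1, mul_pow, mul_assoc (C X ^ j), ← pow_add, Nat.add_sub_cancel' (by omega)]
    simp [mul_assoc]

/-- The polynomial of the line `x 0 = c * ht κ x + β`. -/
def linPoly (κ c β : ℝ) : Poly :=
  MvPolynomial.C c * (MvPolynomial.X 1 + MvPolynomial.C κ * MvPolynomial.X 0) +
    MvPolynomial.C β - MvPolynomial.X 0

theorem ev_linPoly (κ c β : ℝ) (x : Plane) : ev x (linPoly κ c β) = c * ht κ x + β - x 0 := by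
  simp [linPoly, ht]

/-- A line through `A` splits into the factor `S`, common to all of them, and a factor that only
sees the slope. -/
theorem blow_linPoly {κ c β : ℝ} {A : Plane} (hA : c * ht κ A + β - A 0 = 0) :
    blow κ A (linPoly κ c β) = C (C c - X) * X := by
  have : (C (C β) : ℝ[X][X]) = C (C (A 0)) - C (C c) * (C (C (A 1)) + C (C κ) * C (C (A 0))) := by
    rw [show β = A 0 - c * (A 1 + κ * A 0) by unfold ht at hA; linarith]
    simp
  simp [linPoly, blow, blowPt, this]
  ring

/-- Only the slope factor is a real condition. The factor `S ^ e` comes for free, because a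
coefficient of `S ^ k` that has degree at most `k` and is divisible by `(X - c) ^ e` vanishes for `k
< e`. -/
theorem linPoly_pow_dvd_iff {κ c β : ℝ} {A : Plane} (hA : c * ht κ A + β - A 0 = 0) {d e : ℕ}
    {p : Poly} (hp : p.totalDegree ≤ d) :
    linPoly κ c β ^ e ∣ p ↔ ∀ k, (X - C c) ^ e ∣ (blow κ A p).coeff k := by
  have hneg : ∀ q : ℝ[X], (X - C c) ^ e ∣ q ↔ (C c - X) ^ e ∣ q := by
    intro q
    rw [← neg_sub (C c) X, neg_pow]
    have : IsUnit ((-1 : ℝ[X]) ^ e) := (isUnit_one.neg).pow e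
    exact this.mul_left_dvd
  have hpow : blow κ A (linPoly κ c β ^ e) = C ((C c - X) ^ e) * X ^ e := by
    rw [map_pow, blow_linPoly hA, mul_pow, map_pow]
  simp only [hneg]
  constructor
  · rintro ⟨q, rfl⟩ k
    rw [map_mul, hpow, mul_assoc, coeff_C_mul]
    exact dvd_mul_right _ _
  · intro h
    choose r hr using h
    have hb := blow_mem (κ := κ) (A := A) hp
    have hm : ((X - C c) ^ e : ℝ[X]).Monic := (monic_X_sub_C c).pow e
    have hdeg : ∀ k, r k ≠ 0 → e + (r k).natDegree ≤ k := by
      intro k hk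
      have h1 := (hb k).1
      rw [hr k, ← neg_sub X (C c), neg_pow, mul_assoc] at h1
      have : (-1 : ℝ[X]) ^ e = C ((-1) ^ e) := by simp
      rw [this, natDegree_C_mul (by simp), hm.natDegree_mul' hk, natDegree_pow,
        natDegree_X_sub_C, mul_one] at h1
      exact h1
    -- Division by `S ^ e` shifts the index by `e`; the bound `hdeg` is what makes the shifted
    -- family graded again.
    let f : ℝ[X][X] := ∑ k ∈ Finset.range (d + 1), C (r (k + e)) * X ^ k
    have hfc : ∀ k, f.coeff k = if k < d + 1 then r (k + e) else 0 := by
      intro k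
      simp only [f, finsetSum_coeff, coeff_C_mul, coeff_X_pow, mul_ite, mul_one, mul_zero,
        Finset.sum_ite_eq, Finset.mem_range]
    have hf : f ∈ graded d := by
      intro k
      rw [hfc]
      refine ⟨?_, fun hk => if_neg (by omega)⟩
      split_ifs with hk
      · by_cases h0 : r (k + e) = 0
        · simp [h0]
        · have := hdeg _ h0
          omega
      · simp
    obtain ⟨q, -, hq⟩ := exists_blow_eq κ A hf
    refine ⟨q, blow_injective κ A ?_⟩
    rw [map_mul, hpow, hq, mul_assoc, mul_comm (X ^ e)]
    ext1 k
    rw [coeff_C_mul, coeff_mul_X_pow']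
    split_ifs with hk
    · rw [hfc, hr k]
      congr 1
      rw [Nat.sub_add_cancel hk]
      split_ifs with hkd
      · rfl
      · have h0 := (hb k).2 (by omega)
        rw [hr k] at h0
        refine (mul_eq_zero.1 h0).resolve_left (pow_ne_zero _ ?_)
        rw [← neg_sub]
        exact neg_ne_zero.2 (X_sub_C_ne_zero c)
    · rw [hr k, mul_zero]
      by_cases h0 : r k = 0
      · rw [h0, mul_zero]
      · have := hdeg k h0
        omega

end Graded

end PolySpline

/-! ### Dimensions of jump and increment spaces -/

namespace PolySpline

/-- The bivariate polynomials of total degree at most `d`. -/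
abbrev Pol (d : ℕ) : Type := MvPolynomial.restrictTotalDegree (Fin 2) ℝ d

theorem Pol.totalDegree_le {d : ℕ} (p : Pol d) : (p : Poly).totalDegree ≤ d :=
  (MvPolynomial.mem_restrictTotalDegree _ _ _).1 p.2

section Dimensions

open Polynomial

theorem mem_degreeLT_succ_iff {k : ℕ} {r : ℝ[X]} : r ∈ degreeLT ℝ (k + 1) ↔ r.natDegree ≤ k := by
  by_cases hr : r = 0
  · simp [hr]
  · rw [mem_degreeLT, ← natDegree_lt_iff_degree_lt hr, Nat.lt_succ_iff]

/-- The coefficients of a polynomial in polar-like coordinates around `A`. -/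
def blowCoeff (κ : ℝ) (A : Plane) (d : ℕ) :
    Pol d →ₗ[ℝ] ((k : Fin (d + 1)) → degreeLT ℝ (k + 1)) where
  toFun p k := ⟨(blow κ A p).coeff k,
    mem_degreeLT_succ_iff.2 (blow_mem p.totalDegree_le k).1⟩
  map_add' p q := by ext1 k; exact Subtype.ext (by simp)
  map_smul' a p := by ext1 k; exact Subtype.ext (by simp)

theorem blowCoeff_coe {κ : ℝ} {A : Plane} {d : ℕ} (p : Pol d) (k : Fin (d + 1)) :
    (blowCoeff κ A d p k : ℝ[X]) = (blow κ A p).coeff k := rfl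

theorem coeff_blow_of_lt {κ : ℝ} {A : Plane} {d k : ℕ} (p : Pol d) (hk : d < k) :
    (blow κ A p).coeff k = 0 := (blow_mem p.totalDegree_le k).2 hk

theorem blowCoeff_bijective (κ : ℝ) (A : Plane) (d : ℕ) :
    Function.Bijective (blowCoeff κ A d) := by
  constructor
  · intro p q h
    refine Subtype.ext (blow_injective κ A ?_)
    ext1 k
    by_cases hk : k < d + 1
    · have := congrArg Subtype.val (congrFun h ⟨k, hk⟩)
      exact this
    · rw [coeff_blow_of_lt p (by omega), coeff_blow_of_lt q (by omega)]
  · intro r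
    let f : ℝ[X][X] := ∑ k : Fin (d + 1), C (r k : ℝ[X]) * X ^ (k : ℕ)
    have hfc : ∀ k : Fin (d + 1), f.coeff k = r k := by
      intro k
      simp only [f, finsetSum_coeff, coeff_C_mul, coeff_X_pow, mul_ite, mul_one, mul_zero,
        Fin.val_inj, Finset.sum_ite_eq, Finset.mem_univ, if_true]
    have hfc' : ∀ k, d < k → f.coeff k = 0 := by
      intro k hk
      simp only [f, finsetSum_coeff, coeff_C_mul, coeff_X_pow]
      refine Finset.sum_eq_zero fun i _ => ?_
      rw [if_neg (by omega), mul_zero]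
    have hf : f ∈ graded d := by
      intro k
      refine ⟨?_, hfc' k⟩
      by_cases hk : k < d + 1
      · rw [hfc ⟨k, hk⟩]
        exact mem_degreeLT_succ_iff.1 (r ⟨k, hk⟩).2
      · rw [hfc' k (by omega)]
        simp
    obtain ⟨p, hp, hpf⟩ := exists_blow_eq κ A hf
    refine ⟨⟨p, (MvPolynomial.mem_restrictTotalDegree _ _ _).2 hp⟩, ?_⟩
    ext1 k
    refine Subtype.ext ?_
    rw [blowCoeff_coe, ← hfc k, ← hpf]

theorem sum_succ_sub_succ {d μ : ℕ} (h : μ ≤ d) :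
    ∑ k ∈ Finset.range (d + 1), (k + 1 - (μ + 1)) = (d - μ + 1).choose 2 := by
  obtain ⟨n, rfl⟩ := Nat.exists_eq_add_of_le h
  rw [Nat.add_sub_cancel_left]
  induction n with
  | zero =>
    rw [zero_add, Nat.choose_eq_zero_of_lt one_lt_two]
    refine Finset.sum_eq_zero fun i hi => ?_
    rw [Finset.mem_range] at hi
    omega
  | succ n ih =>
    rw [← add_assoc, Finset.sum_range_succ, ih (by omega),
      show μ + n + 1 + 1 - (μ + 1) = n + 1 by omega, Nat.choose_succ_succ' (n + 1) 1,
      Nat.choose_one_right]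
    ring

theorem sub_cast_eq_max (a b : ℕ) : ((a - b : ℕ) : ℤ) = max 0 ((a : ℤ) - b) := by
  omega

/-- The terms with `k ≤ μ` vanish, the remaining ones match under `j = d + 1 - k`, and truncated
subtraction plays the role of the positive part. -/
theorem sum_kNum {d μ : ℕ} (h : μ ≤ d) (N : ℕ) :
    ((∑ k ∈ Finset.range (d + 1), (N * (k + 1 - (μ + 1)) - (k + 1)) : ℕ) : ℤ) = kNum d μ N := by
  obtain ⟨n, rfl⟩ := Nat.exists_eq_add_of_le h
  have h0 : ∑ k ∈ Finset.range (μ + 1), (N * (k + 1 - (μ + 1)) - (k + 1)) = 0 := by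
    refine Finset.sum_eq_zero fun k hk => ?_
    rw [Finset.mem_range] at hk
    rw [show k + 1 - (μ + 1) = 0 by omega]
    omega
  rw [show μ + n + 1 = (μ + 1) + n by ring, Finset.sum_range_add, h0, zero_add,
    ← Finset.sum_range_reflect, kNum, Nat.add_sub_cancel_left, Nat.cast_sum,
    show Finset.Icc 1 n = Finset.Ico 1 (n + 1) from rfl, Finset.sum_Ico_eq_sum_range,
    Nat.add_sub_cancel]
  refine Finset.sum_congr rfl fun i hi => ?_
  rw [Finset.mem_range] at hi
  rw [show μ + 1 + (n - 1 - i) + 1 - (μ + 1) = n - i by omega, sub_cast_eq_max]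
  congr 1
  rw [show μ + 1 + (n - 1 - i) + 1 = μ + (n - i) + 1 by omega]
  push_cast
  rw [Nat.cast_sub hi.le]
  ring

theorem finrank_pol (d : ℕ) : Module.finrank ℝ (Pol d) = (d + 2).choose 2 := by
  rw [(LinearEquiv.ofBijective _ (blowCoeff_bijective 0 0 d)).finrank_eq, Module.finrank_pi_fintype]
  simp only [finrank_degreeLT]
  rw [Fin.sum_univ_eq_sum_range (fun k => k + 1)]
  have := sum_succ_sub_succ (Nat.zero_le (d + 1))
  rw [Finset.sum_range_succ'] at this
  simpa using this

/-- The polynomials of total degree at most `d` that are divisible by `l ^ (μ + 1)`. -/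
def smoothJumps (d μ : ℕ) (l : Poly) : Submodule ℝ (Pol d) where
  carrier := {p | l ^ (μ + 1) ∣ (p : Poly)}
  zero_mem' := dvd_zero _
  add_mem' := fun ha hb => dvd_add ha hb
  smul_mem' := fun a p hp => by
    change _ ∣ ((a • p : Pol d) : Poly)
    rw [Submodule.coe_smul, MvPolynomial.smul_eq_C_mul]
    exact Dvd.dvd.mul_left hp _

theorem mem_smoothJumps {d μ : ℕ} {l : Poly} {p : Pol d} :
    p ∈ smoothJumps d μ l ↔ l ^ (μ + 1) ∣ (p : Poly) := Iff.rfl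

theorem mem_smoothJumps_iff {κ c β : ℝ} {A : Plane} (hA : c * ht κ A + β - A 0 = 0) {d μ : ℕ}
    {p : Pol d} : p ∈ smoothJumps d μ (linPoly κ c β) ↔
      ∀ k : Fin (d + 1), (blowCoeff κ A d p k : ℝ[X]) ∈ dvdLT (k + 1) c (μ + 1) := by
  rw [mem_smoothJumps, linPoly_pow_dvd_iff hA p.totalDegree_le]
  constructor
  · exact fun h k => ⟨(blowCoeff κ A d p k).2, h k⟩
  · intro h k
    by_cases hk : k < d + 1
    · exact (h ⟨k, hk⟩).2
    · rw [coeff_blow_of_lt p (by omega)]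
      exact dvd_zero _

theorem finrank_smoothJumps {d μ : ℕ} (h : μ ≤ d) (κ c β : ℝ) :
    Module.finrank ℝ (smoothJumps d μ (linPoly κ c β)) = (d - μ + 1).choose 2 := by
  -- Any point of the line serves as centre; this is the one at height zero.
  let A : Plane := !₂[β, -κ * β]
  have hA : c * ht κ A + β - A 0 = 0 := by
    simp [ht, A]
  let φ : smoothJumps d μ (linPoly κ c β) →ₗ[ℝ]
      ((k : Fin (d + 1)) → dvdLT (k + 1) c (μ + 1)) :=
    { toFun := fun p k => ⟨blowCoeff κ A d p k, (mem_smoothJumps_iff hA).1 p.2 k⟩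
      map_add' := fun p q => by ext1 k; exact Subtype.ext (by simp)
      map_smul' := fun a p => by ext1 k; exact Subtype.ext (by simp) }
  have hφ : Function.Bijective φ := by
    constructor
    · intro p q hpq
      refine Subtype.ext ((blowCoeff_bijective κ A d).1 ?_)
      ext1 k
      have h' := congrArg (fun r => ((r k : dvdLT _ _ _) : ℝ[X])) hpq
      exact Subtype.ext h'
    · intro r
      obtain ⟨p, hp⟩ := (blowCoeff_bijective κ A d).2 fun k => ⟨r k, (r k).2.1⟩
      have hp' : ∀ k, (blowCoeff κ A d p k : ℝ[X]) = r k := fun k => by rw [hp]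
      refine ⟨⟨p, (mem_smoothJumps_iff hA).2 fun k => by rw [hp' k]; exact (r k).2⟩, ?_⟩
      ext1 k
      exact Subtype.ext (hp' k)
  rw [(LinearEquiv.ofBijective φ hφ).finrank_eq, Module.finrank_pi_fintype]
  simp only [finrank_dvdLT]
  rw [Fin.sum_univ_eq_sum_range (fun k => k + 1 - (μ + 1)), sum_succ_sub_succ h]

theorem free_ker {V W : Type*} [AddCommGroup V] [Module ℝ V] [AddCommGroup W] [Module ℝ W]
    (f : V →ₗ[ℝ] W) : Module.Free ℝ (LinearMap.ker f) := inferInstance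

/-- Families of polynomials, the one with index `i` divisible by `l i ^ (μ + 1)`, with sum zero. -/
def conformal {ι : Type*} [Fintype ι] (d μ : ℕ) (l : ι → Poly) : Submodule ℝ (ι → Pol d) where
  carrier := {δ | (∀ i, δ i ∈ smoothJumps d μ (l i)) ∧ ∑ i, δ i = 0}
  zero_mem' := ⟨fun i => zero_mem _, by simp⟩
  add_mem' := fun ha hb => ⟨fun i => add_mem (ha.1 i) (hb.1 i), by
    simp [Finset.sum_add_distrib, ha.2, hb.2]⟩
  smul_mem' := fun a p hp => ⟨fun i => Submodule.smul_mem _ a (hp.1 i), by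
    simp [← Finset.smul_sum, hp.2]⟩

/-- In the coordinates around the common point `A` the conditions decouple by the power of `S`. The
power `S ^ k` contributes the kernel of the sum map for degree less than `k + 1` and divisors of
degree `μ + 1`. -/
theorem finrank_conformal {ι : Type*} [Fintype ι] {d μ : ℕ} (h : μ ≤ d) {κ : ℝ} {c β : ι → ℝ}
    (hc : Function.Injective c) {A : Plane} (hA : ∀ i, c i * ht κ A + β i - A 0 = 0) :
    (Module.finrank ℝ (conformal d μ fun i => linPoly κ (c i) (β i)) : ℤ) =
      kNum d μ (Fintype.card ι) := by
  have hfree : ∀ k : Fin (d + 1),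
      Module.Free ℝ (LinearMap.ker (sumDvdLT c (k + 1) fun _ => μ + 1)) :=
    fun k => free_ker _
  let φ : conformal d μ (fun i => linPoly κ (c i) (β i)) →ₗ[ℝ] ((k : Fin (d + 1)) →
      LinearMap.ker (sumDvdLT c (k + 1) fun _ => μ + 1)) :=
    { toFun := fun δ k => ⟨fun i => ⟨blowCoeff κ A d (δ.1 i) k,
          (mem_smoothJumps_iff (hA i)).1 (δ.2.1 i) k⟩, by
        rw [LinearMap.mem_ker]
        refine Subtype.ext ?_
        rw [coe_sumDvdLT]
        have := congrArg (fun p => (blowCoeff κ A d p k : ℝ[X])) δ.2.2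
        simpa using this⟩
      map_add' := fun p q => by
        ext1 k; refine Subtype.ext ?_; ext1 i; exact Subtype.ext (by simp)
      map_smul' := fun a p => by
        ext1 k; refine Subtype.ext ?_; ext1 i; exact Subtype.ext (by simp) }
  have hφ : Function.Bijective φ := by
    constructor
    · intro p q hpq
      refine Subtype.ext (funext fun i => (blowCoeff_bijective κ A d).1 ?_)
      ext1 k
      have h' := congrArg (fun r => (((r k).1 i).1 : ℝ[X])) hpq
      exact Subtype.ext h'
    · intro r
      have := fun i => (blowCoeff_bijective κ A d).2 fun k => ⟨(r k).1 i, ((r k).1 i).2.1⟩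
      choose p hp using this
      have hp' : ∀ i k, (blowCoeff κ A d (p i) k : ℝ[X]) = (r k).1 i := fun i k => by rw [hp]
      refine ⟨⟨p, fun i => (mem_smoothJumps_iff (hA i)).2 fun k => by
        rw [hp' i k]; exact ((r k).1 i).2, (blowCoeff_bijective κ A d).1 ?_⟩, ?_⟩
      · rw [map_zero]
        ext1 k
        refine Subtype.ext ?_
        have h2 := congrArg Subtype.val (LinearMap.mem_ker.1 (r k).2)
        rw [coe_sumDvdLT] at h2
        rw [map_sum, Finset.sum_apply, Submodule.coe_sum]
        simp only [hp']
        exact h2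
      · ext1 k
        refine Subtype.ext ?_
        ext1 i
        exact Subtype.ext (hp' i k)
  rw [(LinearEquiv.ofBijective φ hφ).finrank_eq, Module.finrank_pi_fintype]
  simp only [finrank_ker_sumDvdLT hc]
  rw [Fin.sum_univ_eq_sum_range (fun k => Fintype.card ι * (k + 1 - (μ + 1)) - (k + 1)), sum_kNum h]

end Dimensions

end PolySpline

/-! ### From admissible jumps to splines -/

namespace PolySpline

theorem exists_const_of_isPreconnected {X Y : Type*} [TopologicalSpace X] [Nonempty Y] {W : Set X}
    (hW : IsPreconnected W) {g : X → Y} (hg : ∀ y ∈ W, ∀ᶠ z in 𝓝[W] y, g z = g y) :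
    ∃ k, ∀ z ∈ W, g z = k := by
  rcases W.eq_empty_or_nonempty with rfl | ⟨x, hx⟩
  · exact ⟨Classical.arbitrary Y, by simp⟩
  · exact ⟨g x, fun z hz => eq_of_isPreconnected_of_locally_eq hW hg hz hx⟩

/-- A function that is locally constant off a nowhere dense set, with the same value all around
each point, is constant. -/
theorem exists_const_off {X Y : Type*} [TopologicalSpace X] [Nonempty Y] {W N : Set X}
    (hW : IsPreconnected W) {g : X → Y}
    (hN : ∀ y ∈ W, ∃ᶠ z in 𝓝 y, z ∉ N)
    (hg : ∀ y ∈ W, ∃ k, ∀ᶠ z in 𝓝 y, z ∉ N → g z = k) :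
    ∃ k, ∀ z ∈ W, z ∉ N → g z = k := by
  choose! k hk using hg
  -- The local values `k` of neighbouring points are compared at a point off `N`, where both equal
  -- `g`.
  obtain ⟨c, hc⟩ := exists_const_of_isPreconnected hW (g := k) (by
    intro y hy
    rw [eventually_nhdsWithin_iff]
    filter_upwards [eventually_eventually_nhds.2 (hk y hy)] with z hz hzW
    obtain ⟨w, hw, h1, h2⟩ := ((hN z hzW).and_eventually (hz.and (hk z hzW))).exists
    rw [← h1 hw, ← h2 hw])
  exact ⟨c, fun z hz hzN => by rw [(hk z hz).self_of_nhds hzN, hc z hz]⟩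

/-- On the line joining `y` to an arbitrary point, the two restrictions agree for infinitely many
parameters. -/
theorem poly_eq_of_eventually {p q : Poly} {y : Plane} (h : ∀ᶠ z in 𝓝 y, ev z p = ev z q) :
    p = q := by
  refine MvPolynomial.funext fun w => ?_
  let γ : Fin 2 → Polynomial ℝ := fun i =>
    Polynomial.C (y i) + Polynomial.C (w i - y i) * Polynomial.X
  have hγ : ∀ (r : Poly) (τ : ℝ), (MvPolynomial.aeval γ r).eval τ =
      MvPolynomial.eval (fun i => y i + (w i - y i) * τ) r := by
    intro r τ
    have : ((Polynomial.evalRingHom τ).comp (MvPolynomial.aeval γ : Poly →ₐ[ℝ] _).toRingHom) =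
        MvPolynomial.eval (fun i => y i + (w i - y i) * τ) :=
      MvPolynomial.ringHom_ext (fun r => by simp) (fun i => by simp [γ])
    exact congrArg (fun φ : Poly →+* ℝ => φ r) this
  have hc : Continuous fun τ : ℝ => (y + τ • (WithLp.toLp 2 w - y) : Plane) := by fun_prop
  have h0 : ∀ᶠ τ in 𝓝 (0 : ℝ), ev (y + τ • (WithLp.toLp 2 w - y)) p =
      ev (y + τ • (WithLp.toLp 2 w - y)) q :=
    (hc.continuousAt.tendsto (x := (0 : ℝ))).eventually (by simpa using h)
  have h1 : MvPolynomial.aeval γ p = MvPolynomial.aeval γ q := by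
    refine Polynomial.eq_of_infinite_eval_eq _ _ ?_
    have hinf : {τ | ev (y + τ • (WithLp.toLp 2 w - y)) p =
        ev (y + τ • (WithLp.toLp 2 w - y)) q}.Infinite := infinite_of_mem_nhds 0 h0
    refine hinf.mono fun τ hτ => ?_
    have e : (fun i => (y + τ • (WithLp.toLp 2 w - y) : Plane) i) =
        fun i => y i + (w i - y i) * τ := by
      ext i
      simp
      ring
    have hτ' : ev (y + τ • (WithLp.toLp 2 w - y)) p = ev (y + τ • (WithLp.toLp 2 w - y)) q := hτ
    rw [ev, e] at hτ'
    change (MvPolynomial.aeval γ p).eval τ = (MvPolynomial.aeval γ q).eval τ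
    rw [hγ, hγ]
    exact hτ'
  have := congrArg (Polynomial.eval 1) h1
  rw [hγ, hγ] at this
  simpa using this

theorem poly_eq_of_frequently {p q : Poly} {O : Set Plane} (hO : IsOpen O) {y : Plane}
    (hy : ∃ᶠ z in 𝓝 y, z ∈ O) (h : ∀ᶠ z in 𝓝 y, z ∈ O → ev z p = ev z q) : p = q := by
  obtain ⟨z, hz, hz'⟩ := (hy.and_eventually (eventually_eventually_nhds.2 h)).exists
  refine poly_eq_of_eventually (y := z) ?_
  filter_upwards [hz', hO.mem_nhds hz] with w hw hw'
  exact hw hw'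

namespace SegmentSystem

variable {Ω : Set Plane} (Γ : SegmentSystem Ω)

/-- The direction of the level lines of the height. -/
def horiz : Plane := !₂[1, -Γ.κ]

theorem h_add_horiz (y : Plane) (τ : ℝ) : Γ.h (y + τ • Γ.horiz) = Γ.h y := by
  simp [h, ht, horiz]
  ring

theorem lin_add_horiz (L : Γ.ι) (y : Plane) (τ : ℝ) :
    Γ.lin L (y + τ • Γ.horiz) = Γ.lin L y - τ := by
  unfold lin
  rw [h_add_horiz]
  simp [horiz]
  ring

/-- A level line is transversal to every segment, so it meets each one at most once. -/
theorem eventually_horiz_notMem (y : Plane) :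
    ∀ᶠ τ in 𝓝[≠] (0 : ℝ), y + τ • Γ.horiz ∉ Γ.grid := by
  have h1 : ∀ᶠ τ in 𝓝[≠] (0 : ℝ), ∀ L, Γ.lin L y - τ ≠ 0 := by
    refine eventually_all.2 fun L => ?_
    by_cases h0 : Γ.lin L y = 0
    · filter_upwards [self_mem_nhdsWithin] with τ hτ
      simpa [h0] using hτ
    · refine eventually_nhdsWithin_of_eventually_nhds ?_
      have : ContinuousAt (fun τ : ℝ => Γ.lin L y - τ) 0 := by fun_prop
      exact this.eventually_ne (by simpa using h0)
  filter_upwards [h1] with τ hτ hmem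
  obtain ⟨L, hL⟩ := Set.mem_iUnion.1 hmem
  have := hL.1
  rw [lin_add_horiz] at this
  exact hτ L this

theorem tendsto_horiz (y : Plane) (s : Set ℝ) :
    Tendsto (fun τ : ℝ => y + τ • Γ.horiz) (𝓝[s] 0) (𝓝 y) := by
  have : Continuous fun τ : ℝ => y + τ • Γ.horiz := by fun_prop
  have h := this.continuousAt.tendsto (x := (0 : ℝ))
  simp only [zero_smul, add_zero] at h
  exact h.mono_left nhdsWithin_le_nhds

/-- Together with `frequently_left` this supplies test points off the grid, on a known side of all
lines through `y` at once. -/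
theorem frequently_right (y : Plane) :
    ∃ᶠ z in 𝓝 y, z ∉ Γ.grid ∧ ∀ L, Γ.lin L y = 0 → Γ.lin L z < 0 := by
  refine (Γ.tendsto_horiz y (Set.Ioi 0)).frequently (Eventually.frequently ?_)
  have := (Γ.eventually_horiz_notMem y).filter_mono
    (nhdsWithin_mono (0 : ℝ) (fun τ (hτ : 0 < τ) => hτ.ne'))
  filter_upwards [this, self_mem_nhdsWithin] with τ hτ hpos
  refine ⟨hτ, fun L hL => ?_⟩
  rw [lin_add_horiz, hL]
  simpa using hpos

theorem frequently_left (y : Plane) :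
    ∃ᶠ z in 𝓝 y, z ∉ Γ.grid ∧ ∀ L, Γ.lin L y = 0 → 0 < Γ.lin L z := by
  refine (Γ.tendsto_horiz y (Set.Iio 0)).frequently (Eventually.frequently ?_)
  have := (Γ.eventually_horiz_notMem y).filter_mono
    (nhdsWithin_mono (0 : ℝ) (fun τ (hτ : τ < 0) => hτ.ne))
  filter_upwards [this, self_mem_nhdsWithin] with τ hτ hpos
  refine ⟨hτ, fun L hL => ?_⟩
  rw [lin_add_horiz, hL]
  simpa using hpos

theorem frequently_notMem_grid (y : Plane) : ∃ᶠ z in 𝓝 y, z ∉ Γ.grid :=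
  (Γ.frequently_left y).mono fun _ h => h.1

/-- The point of the line of `L` at height `u`. -/
def pt (L : Γ.ι) (u : ℝ) : Plane := !₂[Γ.c L * u + Γ.β L, u - Γ.κ * (Γ.c L * u + Γ.β L)]

@[simp] theorem h_pt (L : Γ.ι) (u : ℝ) : Γ.h (Γ.pt L u) = u := by
  simp [h, ht, pt]

@[simp] theorem lin_pt (L : Γ.ι) (u : ℝ) : Γ.lin L (Γ.pt L u) = 0 := by
  unfold lin
  rw [h_pt]
  simp [pt]

theorem pt_h {L : Γ.ι} {x : Plane} (hx : Γ.lin L x = 0) : Γ.pt L (Γ.h x) = x :=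
  ext_lin (L := L) (by simp) hx (by simp)

theorem pt_mem_seg {L : Γ.ι} {u : ℝ} (h1 : Γ.s L ≤ u) (h2 : u ≤ Γ.t L) : Γ.pt L u ∈ Γ.seg L :=
  ⟨by simp, by simpa using h1, by simpa using h2⟩

theorem pt_mem {L : Γ.ι} {u : ℝ} (h1 : Γ.s L < u) (h2 : u < Γ.t L) : Γ.pt L u ∈ Ω :=
  Γ.mem_of_lt L _ (Γ.lin_pt L u) (by simpa [h] using h1.trans_eq (Γ.h_pt L u).symm)
    (by simpa [h] using (Γ.h_pt L u).trans_lt h2)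

theorem continuous_pt (L : Γ.ι) : Continuous (Γ.pt L) := by
  unfold pt
  fun_prop

theorem eq_of_mem_seg {L L' : Γ.ι} {y : Plane} (hy : y ∈ Ω) (hV : y ∉ Γ.V) (h : y ∈ Γ.seg L)
    (h' : y ∈ Γ.seg L') : L' = L := by
  by_contra hne
  exact hV (Γ.V_of_two y hy L' L hne h' h).1

theorem lt_of_mem_seg {L : Γ.ι} {y : Plane} (hy : y ∈ Ω) (hV : y ∉ Γ.V) (h : y ∈ Γ.seg L) :
    Γ.s L < Γ.h y ∧ Γ.h y < Γ.t L :=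
  ⟨lt_of_le_of_ne h.2.1 fun e => hV (Γ.V_of_end y hy L h.1 (Or.inl e.symm)),
    lt_of_le_of_ne h.2.2 fun e => hV (Γ.V_of_end y hy L h.1 (Or.inr e))⟩

variable {Γ}

variable {G : Type*} [AddCommGroup G]

theorem model_of_notMem_grid {θ : Γ.Data G} {x : Plane} (hx : x ∉ Γ.grid) (z : Plane) :
    model θ x z = 0 :=
  Finset.sum_eq_zero fun L _ => term_of_notMem (fun h => hx (Set.mem_iUnion.2 ⟨L, h⟩)) z

theorem model_of_notMem_V {θ : Γ.Data G} {y : Plane} {L : Γ.ι} (hyΩ : y ∈ Ω) (hV : y ∉ Γ.V)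
    (hy : y ∈ Γ.seg L) (z : Plane) :
    model θ y z = if 0 < Γ.lin L z then jump θ L (Γ.h y) else 0 := by
  rw [← term_of_mem_of_notMem_V hy hV]
  unfold model
  refine Finset.sum_eq_single L (fun L' _ hne => term_of_notMem (fun h' => hne ?_) z) (by simp)
  exact Γ.eq_of_mem_seg hyΩ hV hy h'

/-- Models are normalized to vanish just to the right of their centre. The constant in `F z = k +
model θ y z` is thus the value of `F` there. -/
theorem model_of_lin_neg {θ : Γ.Data G} {y z : Plane}
    (h : ∀ L, Γ.lin L y = 0 → Γ.lin L z < 0) : model θ y z = 0 := by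
  refine Finset.sum_eq_zero fun L _ => ?_
  unfold term
  split_ifs with h1 h2 h3
  · exact absurd h2 (h L h1.1).not_gt
  · exact absurd h2 (h L h1.1).not_gt
  · rename_i h4; exact absurd h4.1 (h L h1.1).not_gt
  · simp
  · rfl

section Linear

theorem jump_add (θ θ' : Γ.Data G) (L : Γ.ι) (u : ℝ) :
    jump (θ + θ') L u = jump θ L u + jump θ' L u := by
  simp only [jump, Prod.fst_add, Prod.snd_add, Pi.add_apply, ite_add_zero, Finset.sum_add_distrib]
  abel

theorem jump_smul [Module ℝ G] (a : ℝ) (θ : Γ.Data G) (L : Γ.ι) (u : ℝ) :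
    jump (a • θ) L u = a • jump θ L u := by
  simp only [jump, Prod.smul_fst, Prod.smul_snd, Pi.smul_apply, smul_add, Finset.smul_sum,
    smul_ite, smul_zero]

theorem incr_add (θ θ' : Γ.Data G) (x : Plane) (L : Γ.ι) :
    incr (θ + θ') x L = incr θ x L + incr θ' x L := by
  unfold incr
  split_ifs <;> simp

theorem incr_smul [Module ℝ G] (a : ℝ) (θ : Γ.Data G) (x : Plane) (L : Γ.ι) :
    incr (a • θ) x L = a • incr θ x L := by
  unfold incr
  split_ifs <;> simp

theorem model_add (θ θ' : Γ.Data G) (x z : Plane) :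
    model (θ + θ') x z = model θ x z + model θ' x z := by
  unfold model
  rw [← Finset.sum_add_distrib]
  refine Finset.sum_congr rfl fun L _ => ?_
  unfold term
  rw [jump_add, incr_add]
  split_ifs <;> abel

theorem model_smul [Module ℝ G] (a : ℝ) (θ : Γ.Data G) (x z : Plane) :
    model (a • θ) x z = a • model θ x z := by
  unfold model
  rw [Finset.smul_sum]
  refine Finset.sum_congr rfl fun L _ => ?_
  unfold term
  rw [jump_smul, incr_smul]
  split_ifs <;> simp

end Linear

theorem exists_gap_above (V : Finset Plane) (g : Plane → ℝ) {a b : ℝ} (hab : a < b) :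
    ∃ u, a < u ∧ u < b ∧ ∀ A ∈ V, a < g A → u < g A := by
  have h : ∀ᶠ u in 𝓝[>] a, ∀ A ∈ V, a < g A → u < g A := by
    refine (Filter.eventually_all_finset V).2 fun A _ => ?_
    by_cases hA : a < g A
    · exact (eventually_nhdsWithin_of_eventually_nhds (eventually_lt_nhds hA)).mono fun _ h _ => h
    · exact Eventually.of_forall fun _ h => absurd h hA
  have hself : ∀ᶠ u in 𝓝[>] a, a < u := self_mem_nhdsWithin
  obtain ⟨u, hu, h1, h2⟩ := (h.and (hself.and
    (eventually_nhdsWithin_of_eventually_nhds (eventually_lt_nhds hab)))).exists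
  exact ⟨u, h1, h2, hu⟩

theorem exists_gap_below (V : Finset Plane) (g : Plane → ℝ) {a b : ℝ} (hab : b < a) :
    ∃ u, b < u ∧ u < a ∧ ∀ A ∈ V, g A < a → g A < u := by
  obtain ⟨u, h1, h2, h3⟩ := exists_gap_above V (fun A => -g A) (a := -a) (b := -b) (by linarith)
  refine ⟨-u, by linarith, by linarith, fun A hA h => ?_⟩
  have := h3 A hA (by linarith)
  linarith

/-- Compatible data are determined by their jumps at the points that are no vertices. -/
theorem eq_zero_of_jump_eq_zero {θ : Γ.Data G} (hθ : Compatible θ)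
    (hj : ∀ L u, Γ.s L < u → u < Γ.t L → Γ.pt L u ∉ Γ.V → jump θ L u = 0) : θ = 0 := by
  have h2 : ∀ A L, θ.2 A L = 0 := by
    intro A L
    by_cases hA : (A : Plane) ∈ Γ.seg L
    swap
    · exact hθ.supp A L hA
    have hAΩ := Γ.V_subset A A.2
    -- The jump at `A` is the one slightly below, where no vertex intervenes; likewise the jump plus
    -- the increment is the one slightly above. Beyond an end inside `Ω`, compatibility takes over.
    have e1 : jump θ L (Γ.h A) = 0 := by
      rcases hA.2.1.eq_or_lt with hs | hs
      · exact jump_lo hθ hAΩ hA.1 hs.symm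
      · obtain ⟨u, h1, h2, h3⟩ := exists_gap_below Γ.V Γ.h hs
        rw [← jump_below h2.le fun B hB => h3 B B.2 hB]
        refine hj L u h1 (h2.trans_le hA.2.2) fun hV => ?_
        have := h3 _ hV (by simpa using h2)
        simp at this
    have e2 : jump θ L (Γ.h A) + incr θ A L = 0 := by
      rcases hA.2.2.eq_or_lt with hs | hs
      · exact jump_hi hθ hAΩ hA.1 hs
      · obtain ⟨u, h1, h2, h3⟩ := exists_gap_above Γ.V Γ.h hs
        rw [← jump_above hθ hA h1 fun B hB => (h3 B B.2 hB).le]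
        refine hj L u (hA.2.1.trans_lt h1) h2 fun hV => ?_
        have := h3 _ hV (by simpa using h1)
        simp at this
    rw [e1, zero_add] at e2
    simpa [incr] using e2
  have h1 : ∀ L, θ.1 L = 0 := by
    intro L
    obtain ⟨u, h1, h3, h4⟩ := exists_gap_above Γ.V Γ.h (Γ.s_lt_t L)
    have := hj L u h1 h3 fun hV => by
      have := h4 _ hV (by simpa using h1)
      simp at this
    simpa [jump, h2] using this
  ext : 1
  · exact funext h1
  · exact funext fun A => funext fun L => h2 A L

/-- The polynomial of the line of `L`. -/
def poly (Γ : SegmentSystem Ω) (L : Γ.ι) : Poly := linPoly Γ.κ (Γ.c L) (Γ.β L)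

theorem ev_poly (L : Γ.ι) (x : Plane) : ev x (Γ.poly L) = Γ.lin L x := ev_linPoly _ _ _ _

variable {d μ : ℕ}

/-- The jump data of the `C^μ` splines of degree `d`. -/
def jumpData (Γ : SegmentSystem Ω) (d μ : ℕ) : Submodule ℝ (Γ.Data (Pol d)) where
  carrier := {θ | Compatible θ ∧ (∀ A, ∑ L, θ.2 A L = 0) ∧
    (∀ L, θ.1 L ∈ smoothJumps d μ (Γ.poly L)) ∧ ∀ A L, θ.2 A L ∈ smoothJumps d μ (Γ.poly L)}
  zero_mem' := ⟨⟨by simp, by simp, by simp⟩, by simp, fun L => zero_mem _, fun A L => zero_mem _⟩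
  add_mem' := by
    rintro θ θ' ⟨h1, h2, h3, h4⟩ ⟨h1', h2', h3', h4'⟩
    refine ⟨⟨fun A L h => ?_, fun L x hx hl hh => ?_, fun L x hx hl hh => ?_⟩, fun A => ?_,
      fun L => add_mem (h3 L) (h3' L), fun A L => add_mem (h4 A L) (h4' A L)⟩
    · simp [h1.supp A L h, h1'.supp A L h]
    · simp [h1.lo L x hx hl hh, h1'.lo L x hx hl hh]
    · have e := h1.hi L x hx hl hh
      have e' := h1'.hi L x hx hl hh
      simp only [Prod.fst_add, Prod.snd_add, Pi.add_apply, Finset.sum_add_distrib]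
      rw [add_add_add_comm, e, e', add_zero]
    · simp [Finset.sum_add_distrib, h2, h2']
  smul_mem' := by
    rintro a θ ⟨h1, h2, h3, h4⟩
    refine ⟨⟨fun A L h => ?_, fun L x hx hl hh => ?_, fun L x hx hl hh => ?_⟩, fun A => ?_,
      fun L => Submodule.smul_mem _ a (h3 L), fun A L => Submodule.smul_mem _ a (h4 A L)⟩
    · simp [h1.supp A L h]
    · simp [h1.lo L x hx hl hh]
    · have e := h1.hi L x hx hl hh
      simp only [Prod.smul_fst, Prod.smul_snd, Pi.smul_apply, ← Finset.smul_sum]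
      rw [← smul_add, e, smul_zero]
    · simp [← Finset.smul_sum, h2]

/-- The function `s` has the jumps `θ`. -/
def HasJumps (s : Ω → ℝ) (θ : Γ.Data (Pol d)) : Prop :=
  ∀ x ∈ Ω, ∃ p : Pol d, ∀ᶠ z in 𝓝 x, ∀ hz : z ∈ Ω, z ∉ Γ.grid →
    s ⟨z, hz⟩ = ev z ((p + model θ x z : Pol d) : Poly)

/-- The function `s` is piecewise polynomial of degree at most `d` off the grid. -/
def IsPiecewise (Γ : SegmentSystem Ω) (d : ℕ) (s : Ω → ℝ) : Prop :=
  ∃ F : Plane → Pol d, (∀ z ∈ Ω, z ∉ Γ.grid → ∀ᶠ w in 𝓝 z, F w = F z) ∧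
    ∀ z (hz : z ∈ Ω), z ∉ Γ.grid → s ⟨z, hz⟩ = ev z (F z : Poly)

/-- At a point of `L` that is no vertex, the right side shows that the local polynomial is zero, and
the left side then shows that the jump is zero. -/
theorem eq_zero_of_hasJumps (hΩ : IsOpen Ω) {θ : Γ.Data (Pol d)} (hθ : Compatible θ)
    (h : HasJumps (0 : Ω → ℝ) θ) : θ = 0 := by
  refine eq_zero_of_jump_eq_zero hθ fun L u hs ht hV => ?_
  set y := Γ.pt L u
  have hyΩ : y ∈ Ω := Γ.pt_mem hs ht
  have hyL : y ∈ Γ.seg L := Γ.pt_mem_seg hs.le ht.le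
  obtain ⟨p, hp⟩ := h y hyΩ
  have hm := fun z => model_of_notMem_V (θ := θ) hyΩ hV hyL z
  have hyh : Γ.h y = u := Γ.h_pt L u
  have hg := Γ.isClosed_grid.isOpen_compl
  have hc := Γ.continuous_lin L
  have e1 : (p : Poly) = 0 := by
    refine poly_eq_of_frequently (y := y) (O := Γ.gridᶜ ∩ {z | Γ.lin L z < 0})
      (hg.inter (isOpen_lt hc continuous_const))
      ((Γ.frequently_right y).mono fun z hz => ⟨hz.1, hz.2 L hyL.1⟩) ?_
    filter_upwards [hp, hΩ.mem_nhds hyΩ] with z hz hzΩ hzO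
    have := hz hzΩ hzO.1
    have h0 : ¬ 0 < Γ.lin L z := (show Γ.lin L z < 0 from hzO.2).not_gt
    rw [hm, if_neg h0, add_zero] at this
    rw [map_zero]
    exact this.symm
  have e2 : ((p + jump θ L u : Pol d) : Poly) = 0 := by
    refine poly_eq_of_frequently (y := y) (O := Γ.gridᶜ ∩ {z | 0 < Γ.lin L z})
      (hg.inter (isOpen_lt continuous_const hc))
      ((Γ.frequently_left y).mono fun z hz => ⟨hz.1, hz.2 L hyL.1⟩) ?_
    filter_upwards [hp, hΩ.mem_nhds hyΩ] with z hz hzΩ hzO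
    have := hz hzΩ hzO.1
    have h0 : 0 < Γ.lin L z := hzO.2
    rw [hm, if_pos h0, hyh] at this
    rw [map_zero]
    exact this.symm
  refine Subtype.ext ?_
  rw [Submodule.coe_add, e1, zero_add] at e2
  exact e2

/-- Without jumps the local polynomials are locally constant on the connected set `Ω`; on the grid
the values follow by continuity. -/
theorem exists_poly_of_hasJumps_zero (hΩ : IsOpen Ω) (hconn : IsPreconnected Ω) {s : Ω → ℝ}
    (hs : SmoothOn μ s Ω) (h : HasJumps s (0 : Γ.Data (Pol d))) :
    ∃ p : Pol d, ∀ x : Ω, s x = ev x (p : Poly) := by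
  have hm : ∀ x z, model (0 : Γ.Data (Pol d)) x z = 0 := fun x z => by
    have := model_smul (0 : ℝ) (0 : Γ.Data (Pol d)) x z
    simpa using this
  simp only [HasJumps, hm, add_zero] at h
  choose! p hp using h
  have hg := Γ.isClosed_grid.isOpen_compl
  obtain ⟨k, hk⟩ := exists_const_of_isPreconnected hconn (g := p) (by
    intro x hx
    rw [eventually_nhdsWithin_iff]
    filter_upwards [eventually_eventually_nhds.2 (hp x hx)] with y hy hyΩ
    refine Subtype.ext (poly_eq_of_frequently hg (Γ.frequently_notMem_grid y) ?_)
    filter_upwards [hy, hp y hyΩ, hΩ.mem_nhds hyΩ] with z h1 h2 h3 h4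
    rw [← h1 h3 h4, ← h2 h3 h4])
  refine ⟨k, fun x => ?_⟩
  obtain ⟨f, hf, hsf⟩ := hs
  have h0 : ContinuousAt f x :=
    (hf.continuousOn.continuousAt (hΩ.mem_nhds x.2))
  rw [hsf x x.2]
  refine tendsto_nhds_unique_of_frequently_eq h0.tendsto (continuous_ev k).continuousAt.tendsto ?_
  refine ((Γ.frequently_notMem_grid x).and_eventually ((hp x x.2).and (hΩ.mem_nhds x.2))).mono ?_
  rintro z ⟨h1, h2, h3⟩
  have h3' : z ∈ Ω := h3
  rw [← hsf ⟨z, h3'⟩ h3', h2 h3' h1, hk x x.2]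

theorem jump_mem {θ : Γ.Data (Pol d)} (hθ : θ ∈ jumpData Γ d μ) (L : Γ.ι) (u : ℝ) :
    jump θ L u ∈ smoothJumps d μ (Γ.poly L) := by
  refine add_mem (hθ.2.2.1 L) (sum_mem fun A _ => ?_)
  split_ifs
  · exact hθ.2.2.2 A L
  · exact zero_mem _

theorem incr_mem {θ : Γ.Data (Pol d)} (hθ : θ ∈ jumpData Γ d μ) (x : Plane) (L : Γ.ι) :
    incr θ x L ∈ smoothJumps d μ (Γ.poly L) := by
  unfold incr
  split_ifs
  · exact hθ.2.2.2 _ L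
  · exact zero_mem _

theorem vanishesAt_model {θ : Γ.Data (Pol d)} (hθ : θ ∈ jumpData Γ d μ) (x z : Plane) :
    VanishesAt μ ((model θ x z : Pol d) : Poly) x := by
  unfold model
  rw [Submodule.coe_sum]
  refine VanishesAt.sum fun L _ => ?_
  by_cases hx : x ∈ Γ.seg L
  · refine vanishesAt_of_pow_dvd (l := Γ.poly L) (by rw [ev_poly]; exact hx.1) ?_
    rw [← mem_smoothJumps]
    unfold term
    rw [if_pos hx]
    refine add_mem ?_ ?_ <;> split_ifs
    · exact jump_mem hθ L _
    · exact zero_mem _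
    · exact incr_mem hθ x L
    · exact zero_mem _
  · rw [term_of_notMem hx]
    exact VanishesAt.zero μ x

/-- The value depends only on which of finitely many inequalities hold at `z`. -/
theorem finite_range_model (θ : Γ.Data G) (x : Plane) : (Set.range (model θ x)).Finite := by
  classical
  refine (Set.finite_range fun ab : (Γ.ι → Prop) × (Γ.ι → Prop) => ∑ L, if x ∈ Γ.seg L then
    (if ab.1 L then jump θ L (Γ.h x) else 0) + (if ab.2 L then incr θ x L else 0) else 0).subset ?_
  rintro _ ⟨z, rfl⟩
  refine ⟨⟨fun L => 0 < Γ.lin L z, fun L => 0 < Γ.lin L z ∧ Γ.h x < Γ.h z⟩, ?_⟩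
  refine Finset.sum_congr rfl fun L _ => ?_
  unfold term
  congr

/-- All admissible jump data come from splines. -/
theorem exists_spline (hΩ : IsOpen Ω) [SimplyConnectedSpace Ω] {θ : Γ.Data (Pol d)}
    (hθ : θ ∈ jumpData Γ d μ) :
    ∃ s : Ω → ℝ, SmoothOn μ s Ω ∧ IsPiecewise Γ d s ∧ HasJumps s θ := by
  obtain ⟨F, hF⟩ := exists_of_jumps hΩ hθ.1 hθ.2.1
  -- The spline is built from `k` instead of `F`: at every point, also on the grid, `k` is the
  -- polynomial valid just to the right.
  choose! k hk using hF
  have hFk : ∀ z ∈ Ω, z ∉ Γ.grid → F z = k z := by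
    intro z hz hzg
    have := (hk z hz).self_of_nhds
    rwa [model_of_notMem_grid hzg, add_zero] at this
  refine ⟨fun x => ev x (k x : Poly), ⟨fun y => ev y (k y : Poly), ?_, fun _ _ => rfl⟩,
    ⟨F, ?_, ?_⟩, ?_⟩
  · refine contDiffOn_of_pieces hΩ μ (fun y => (k y : Poly)) fun x hx =>
      ⟨Set.range fun z => ((k x + model θ x z : Pol d) : Poly), ?_, ?_, ?_⟩
    · have := (finite_range_model θ x).image fun m : Pol d => ((k x + m : Pol d) : Poly)
      rwa [← Set.range_comp] at this
    · rintro _ ⟨z, rfl⟩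
      change VanishesAt μ (((k x + model θ x z : Pol d) : Poly) - (k x : Poly)) x
      rw [Submodule.coe_add, add_sub_cancel_left]
      exact vanishesAt_model hθ x z
    · filter_upwards [eventually_eventually_nhds.2 (hk x hx), hΩ.mem_nhds hx] with y hy hyΩ
      -- At a point `z` just to the right of `y` the value of `F` is `k y` by the model at `y`, and
      -- one of the finitely many `k x + model θ x z` by the model at `x`.
      obtain ⟨z, ⟨-, hz⟩, h1, h2⟩ :=
        ((Γ.frequently_right y).and_eventually (hy.and (hk y hyΩ))).exists
      rw [model_of_lin_neg hz, add_zero, h1] at h2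
      exact ⟨z, congrArg Subtype.val h2⟩
  · intro z hz hzg
    filter_upwards [hk z hz] with w hw
    rw [hw, model_of_notMem_grid hzg, add_zero, hFk z hz hzg]
  · intro z hz hzg
    rw [hFk z hz hzg]
  · intro x hx
    refine ⟨k x, ?_⟩
    filter_upwards [hk x hx] with z hz hzΩ hzg
    rw [← hz, hFk z hzΩ hzg]

end SegmentSystem

end PolySpline

/-! ### From splines to admissible jumps -/

namespace PolySpline

/-- A function on an interval that is locally constant off a finite set is a sum of jumps. -/
theorem exists_jumps {G : Type*} [AddCommGroup G] (T : Finset ℝ) {s t : ℝ} {g : ℝ → G}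
    (hg : ∀ u, s < u → u < t → u ∉ T → ∀ᶠ v in 𝓝 u, g v = g u) :
    ∃ (q : G) (δ : ℝ → G), ∀ u, s < u → u < t → u ∉ T →
      g u = q + ∑ τ ∈ T, if τ < u then δ τ else 0 := by
  induction T using Finset.induction_on_max generalizing t with
  | empty =>
    obtain ⟨k, hk⟩ := exists_const_of_isPreconnected (isPreconnected_Ioo (a := s) (b := t))
      (g := g) fun u hu => eventually_nhdsWithin_of_eventually_nhds (hg u hu.1 hu.2 (by simp))
    exact ⟨k, 0, fun u h1 h2 _ => by simpa using hk u ⟨h1, h2⟩⟩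
  | insert a T hmax ih =>
    have haT : a ∉ T := fun h => (hmax a h).false
    by_cases hat : t ≤ a
    · obtain ⟨q, δ, h⟩ := ih (t := t) fun u h1 h2 h3 => hg u h1 h2 (by
        rw [Finset.mem_insert, not_or]
        exact ⟨(h2.trans_le hat).ne, h3⟩)
      refine ⟨q, δ, fun u h1 h2 h3 => ?_⟩
      rw [Finset.mem_insert, not_or] at h3
      rw [Finset.sum_insert haT, if_neg (h2.trans_le hat).not_gt, zero_add]
      exact h u h1 h2 h3.2
    push Not at hat
    obtain ⟨q, δ, h⟩ := ih (t := a) fun u h1 h2 h3 => hg u h1 (h2.trans hat) (by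
        rw [Finset.mem_insert, not_or]
        exact ⟨h2.ne, h3⟩)
    obtain ⟨k, hk⟩ := exists_const_of_isPreconnected (isPreconnected_Ioo (a := max s a) (b := t))
      (g := g) fun u hu => eventually_nhdsWithin_of_eventually_nhds
        (hg u ((le_max_left _ _).trans_lt hu.1) hu.2 (by
          have hu1 := (le_max_right _ _).trans_lt hu.1
          rw [Finset.mem_insert, not_or]
          exact ⟨hu1.ne', fun h' => (hmax u h').not_gt hu1⟩))
    -- At the largest breakpoint `a` the jump is the constant `k` beyond it minus the value
    -- accumulated before.
    refine ⟨q, Function.update δ a (k - (q + ∑ τ ∈ T, δ τ)), fun u h1 h2 h3 => ?_⟩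
    rw [Finset.mem_insert, not_or] at h3
    have hsum : ∑ τ ∈ T, (if τ < u then Function.update δ a (k - (q + ∑ τ ∈ T, δ τ)) τ else 0) =
        ∑ τ ∈ T, if τ < u then δ τ else 0 := by
      refine Finset.sum_congr rfl fun τ hτ => ?_
      rw [Function.update_of_ne (hmax τ hτ).ne]
    rw [Finset.sum_insert haT, Function.update_self, hsum]
    rcases lt_or_gt_of_ne h3.1 with hua | hua
    · rw [if_neg hua.not_gt, zero_add]
      exact h u h1 hua h3.2
    · rw [if_pos hua, hk u ⟨max_lt h1 hua, h2⟩]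
      have : ∑ τ ∈ T, (if τ < u then δ τ else 0) = ∑ τ ∈ T, δ τ :=
        Finset.sum_congr rfl fun τ hτ => if_pos ((hmax τ hτ).trans hua)
      rw [this]
      abel

namespace SegmentSystem

variable {Ω : Set Plane} {Γ : SegmentSystem Ω} {d μ : ℕ}

/-- Near `x` and off the grid, `F` is a constant plus `m`. -/
def AgreesNear {G : Type*} [AddCommGroup G] (Γ : SegmentSystem Ω) (F m : Plane → G) (x : Plane) :
    Prop :=
  ∃ p, ∀ᶠ z in 𝓝 x, z ∉ Γ.grid → F z = p + m z

theorem convex_lin_pos (L : Γ.ι) : Convex ℝ {z | 0 < Γ.lin L z} ∧ Convex ℝ {z | Γ.lin L z < 0} := by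
  have key : ∀ (x y : Plane) (a b : ℝ), a + b = 1 →
      Γ.lin L (a • x + b • y) = a * Γ.lin L x + b * Γ.lin L y := by
    intro x y a b hab
    have : b = 1 - a := by linarith
    subst this
    simp [lin, h, ht]
    ring
  constructor
  · intro x hx y hy a b ha hb hab
    change (0 : ℝ) < Γ.lin L _
    rw [key x y a b hab]
    change 0 < Γ.lin L x at hx
    change 0 < Γ.lin L y at hy
    rcases ha.eq_or_lt with rfl | ha'
    · have : b = 1 := by linarith
      subst this
      simpa using hy
    · have := mul_pos ha' hx
      have := mul_nonneg hb hy.le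
      linarith
  · intro x hx y hy a b ha hb hab
    change Γ.lin L _ < (0 : ℝ)
    rw [key x y a b hab]
    change Γ.lin L x < 0 at hx
    change Γ.lin L y < 0 at hy
    rcases ha.eq_or_lt with rfl | ha'
    · have : b = 1 := by linarith
      subst this
      simpa using hy
    · have := mul_neg_of_pos_of_neg ha' hx
      have := mul_nonpos_of_nonneg_of_nonpos hb hy.le
      linarith

/-- Around a point of `L` that is no vertex, a piecewise constant function has two values. -/
theorem exists_two_values {Y : Type*} [Nonempty Y] (hΩ : IsOpen Ω) {F : Plane → Y}
    (hF : ∀ z ∈ Ω, z ∉ Γ.grid → ∀ᶠ w in 𝓝 z, F w = F z) {y : Plane} (hy : y ∈ Ω) (hV : y ∉ Γ.V)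
    {L : Γ.ι} (hL : y ∈ Γ.seg L) :
    ∃ r > 0, Metric.ball y r ⊆ Ω ∧ (∀ z ∈ Metric.ball y r, z ∈ Γ.grid ↔ Γ.lin L z = 0) ∧
      ∃ p q : Y, (∀ z ∈ Metric.ball y r, Γ.lin L z < 0 → F z = p) ∧
      ∀ z ∈ Metric.ball y r, 0 < Γ.lin L z → F z = q := by
  obtain ⟨r, hr, hball⟩ := Metric.eventually_nhds_iff_ball.1 (Γ.eventually_near hΩ hy)
  have hgrid : ∀ z ∈ Metric.ball y r, z ∈ Γ.grid ↔ Γ.lin L z = 0 := by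
    refine fun z hz => ⟨fun hzg => ?_, fun h0 => Set.mem_iUnion.2 ⟨L, h0, ?_, ?_⟩⟩
    rotate_left
    · exact ((hball z hz).s_lt L (Γ.lt_of_mem_seg hy hV hL).1).le
    · exact ((hball z hz).lt_t L (Γ.lt_of_mem_seg hy hV hL).2).le
    obtain ⟨L', hL'⟩ := Set.mem_iUnion.1 hzg
    rw [← Γ.eq_of_mem_seg hy hV hL ((hball z hz).seg L' hL')]
    exact hL'.1
  refine ⟨r, hr, fun z hz => (hball z hz).mem, hgrid, ?_⟩
  have hconv := convex_ball y r
  obtain ⟨p, hp⟩ := exists_const_of_isPreconnected (g := F)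
    (hconv.inter (convex_lin_pos L).2).isPreconnected fun z hz =>
      eventually_nhdsWithin_of_eventually_nhds (hF z (hball z hz.1).mem fun hzg =>
        (show Γ.lin L z < 0 from hz.2).ne ((hgrid z hz.1).1 hzg))
  obtain ⟨q, hq⟩ := exists_const_of_isPreconnected (g := F)
    (hconv.inter (convex_lin_pos L).1).isPreconnected fun z hz =>
      eventually_nhdsWithin_of_eventually_nhds (hF z (hball z hz.1).mem fun hzg =>
        (show 0 < Γ.lin L z from hz.2).ne' ((hgrid z hz.1).1 hzg))
  exact ⟨p, q, fun z hz h0 => hp z ⟨hz, h0⟩, fun z hz h0 => hq z ⟨hz, h0⟩⟩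

/-- The jump of a `C^μ` spline across a segment. -/
theorem exists_smooth_jump (hΩ : IsOpen Ω) {F : Plane → Pol d}
    (hF : ∀ z ∈ Ω, z ∉ Γ.grid → ∀ᶠ w in 𝓝 z, F w = F z) {f : Plane → ℝ}
    (hf : ContDiffOn ℝ μ f Ω) (hFf : ∀ z ∈ Ω, z ∉ Γ.grid → f z = ev z (F z : Poly))
    {y : Plane} (hy : y ∈ Ω) (hV : y ∉ Γ.V) {L : Γ.ι} (hL : y ∈ Γ.seg L) :
    ∃ j ∈ smoothJumps d μ (Γ.poly L),
      AgreesNear Γ F (fun z => if 0 < Γ.lin L z then j else 0) y := by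
  obtain ⟨r, hr, hball, hgrid, p, q, hp, hq⟩ := exists_two_values hΩ hF hy hV hL
  refine ⟨q - p, ?_, p, ?_⟩
  -- The frame parametrizes the line of `L` by height and uses the level direction transversally.
  -- Its determinant is `-1`, so the transversal variable corresponds to `-Γ.poly L`.
  · let a : Plane := !₂[Γ.β L, -Γ.κ * Γ.β L]
    let w : Plane := !₂[Γ.c L, 1 - Γ.κ * Γ.c L]
    have hpt : ∀ u, a + u • w = Γ.pt L u := by
      intro u
      ext i
      fin_cases i
      · simp [a, w, pt]
        ring
      · simp [a, w, pt]
        ring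
    have hD : w 0 * Γ.horiz 1 - w 1 * Γ.horiz 0 = -1 := by
      simp [w, horiz]
      ring
    let S : Set ℝ := {u | Γ.pt L u ∈ Metric.ball y r}
    have hS : S.Infinite := by
      refine infinite_of_mem_nhds (Γ.h y) ?_
      refine (Γ.continuous_pt L).continuousAt.preimage_mem_nhds ?_
      rw [Γ.pt_h hL.1]
      exact Metric.ball_mem_nhds y hr
    have hdvd := X_pow_dvd_frame (m := μ) (f := f) (p := p) (q := q) (a := a) (w := w)
      (v := Γ.horiz) hS (by
        intro u hu
        rw [hpt]
        have hnhds := Metric.isOpen_ball.mem_nhds (show Γ.pt L u ∈ Metric.ball y r from hu)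
        refine ⟨hf.contDiffAt (hΩ.mem_nhds (hball hu)), ?_, ?_⟩
        · filter_upwards [(Γ.tendsto_horiz (Γ.pt L u) (Set.Ioi 0)).eventually_mem hnhds,
            self_mem_nhdsWithin] with τ hτ hpos
          have h0 : Γ.lin L (Γ.pt L u + τ • Γ.horiz) < 0 := by
            rw [lin_add_horiz, lin_pt]
            simpa using hpos
          rw [hFf _ (hball hτ) fun hg => h0.ne ((hgrid _ hτ).1 hg), hp _ hτ h0]
        · filter_upwards [(Γ.tendsto_horiz (Γ.pt L u) (Set.Iio 0)).eventually_mem hnhds,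
            self_mem_nhdsWithin] with τ hτ hpos
          have h0 : 0 < Γ.lin L (Γ.pt L u + τ • Γ.horiz) := by
            rw [lin_add_horiz, lin_pt]
            simpa using hpos
          rw [hFf _ (hball hτ) fun hg => h0.ne' ((hgrid _ hτ).1 hg), hq _ hτ h0])
    obtain ⟨ψ, hψ, hψX⟩ := exists_frame_leftInverse (w := w) (v := Γ.horiz) a (by rw [hD]; simp)
    have hψX' : ψ Polynomial.X = -Γ.poly L := by
      rw [hψX, hD]
      simp [a, w, poly, linPoly]
      ring
    have h2 := map_dvd ψ hdvd
    rw [hψ, map_pow, hψX', neg_pow] at h2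
    have hu : IsUnit ((-1 : Poly) ^ (μ + 1)) := isUnit_one.neg.pow _
    rw [mem_smoothJumps, Submodule.coe_sub, ← neg_sub, dvd_neg]
    exact hu.mul_left_dvd.1 h2
  · filter_upwards [Metric.ball_mem_nhds y hr] with z hz hzg
    rcases lt_trichotomy (Γ.lin L z) 0 with h0 | h0 | h0
    · rw [if_neg h0.not_gt, add_zero, hp z hz h0]
    · exact absurd ((hgrid z hz).2 h0) hzg
    · rw [if_pos h0, hq z hz h0]
      abel

/-- The jumps across one segment, as a sum of increments at the vertices in its interior. -/
theorem exists_segment_data (hΩ : IsOpen Ω) {F : Plane → Pol d}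
    (hF : ∀ z ∈ Ω, z ∉ Γ.grid → ∀ᶠ w in 𝓝 z, F w = F z) {f : Plane → ℝ}
    (hf : ContDiffOn ℝ μ f Ω) (hFf : ∀ z ∈ Ω, z ∉ Γ.grid → f z = ev z (F z : Poly)) (L : Γ.ι) :
    ∃ (q : Pol d) (δ : Γ.V → Pol d), q ∈ smoothJumps d μ (Γ.poly L) ∧
      (∀ A, δ A ∈ smoothJumps d μ (Γ.poly L)) ∧
      (∀ A : Γ.V, ¬((A : Plane) ∈ Γ.seg L ∧ Γ.s L < Γ.h A ∧ Γ.h A < Γ.t L) → δ A = 0) ∧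
      ∀ u, Γ.s L < u → u < Γ.t L → Γ.pt L u ∉ Γ.V →
        AgreesNear Γ F (fun z => if 0 < Γ.lin L z then q + ∑ A : Γ.V, (if Γ.h A < u then δ A else 0)
          else 0) (Γ.pt L u) := by
  classical
  have hex : ∀ u, ∃ j : smoothJumps d μ (Γ.poly L), Γ.s L < u → u < Γ.t L → Γ.pt L u ∉ Γ.V →
      AgreesNear Γ F (fun z => if 0 < Γ.lin L z then (j : Pol d) else 0) (Γ.pt L u) := by
    intro u
    by_cases hu : Γ.s L < u ∧ u < Γ.t L ∧ Γ.pt L u ∉ Γ.V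
    · obtain ⟨j, hj, h⟩ := exists_smooth_jump hΩ hF hf hFf (Γ.pt_mem hu.1 hu.2.1) hu.2.2
        (Γ.pt_mem_seg hu.1.le hu.2.1.le)
      exact ⟨⟨j, hj⟩, fun _ _ _ => h⟩
    · exact ⟨0, fun h1 h2 h3 => absurd ⟨h1, h2, h3⟩ hu⟩
  choose g hg using hex
  let V' : Finset Plane := Γ.V.filter fun A => A ∈ Γ.seg L ∧ Γ.s L < Γ.h A ∧ Γ.h A < Γ.t L
  have hV' : ∀ u, Γ.s L < u → u < Γ.t L → u ∉ V'.image Γ.h → Γ.pt L u ∉ Γ.V := by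
    intro u h1 h2 h3 h4
    refine h3 (Finset.mem_image.2 ⟨Γ.pt L u, Finset.mem_filter.2 ⟨h4, Γ.pt_mem_seg h1.le h2.le, ?_⟩,
      Γ.h_pt L u⟩)
    simpa using ⟨h1, h2⟩
  -- As a function of the height, the jump is locally constant away from the heights of the vertices
  -- inside `L`.
  obtain ⟨q, δ, hqδ⟩ := exists_jumps (V'.image Γ.h) (s := Γ.s L) (t := Γ.t L) (g := g) (by
    intro u h1 h2 h3
    have hV := hV' u h1 h2 h3
    obtain ⟨p, hp⟩ := hg u h1 h2 hV
    have hVc : IsOpen ((Γ.V : Set Plane)ᶜ) := Γ.V.finite_toSet.isClosed.isOpen_compl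
    have hct := (Γ.continuous_pt L).continuousAt (x := u)
    filter_upwards [hct.eventually (eventually_eventually_nhds.2 hp),
      hct.eventually_mem (hVc.mem_nhds hV), eventually_gt_nhds h1, eventually_lt_nhds h2]
      with v hv hvV hv1 hv2
    obtain ⟨p', hp'⟩ := hg v hv1 hv2 hvV
    dsimp only at hp'
    -- The description centred at height `u` also holds around height `v`. Comparison to the right
    -- of `L` identifies the base polynomials, comparison to the left then the jumps.
    have e1 : p' = p := by
      obtain ⟨z, hz, h4, h5⟩ := ((Γ.frequently_right (Γ.pt L v)).and_eventually (hv.and hp')).exists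
      have h0 := (hz.2 L (by simp)).not_gt
      have h4 := h4 hz.1
      rw [h5 hz.1, if_neg h0, if_neg h0, add_zero, add_zero] at h4
      exact h4
    obtain ⟨z, hz, h4, h5⟩ := ((Γ.frequently_left (Γ.pt L v)).and_eventually (hv.and hp')).exists
    have h0 := hz.2 L (by simp)
    have h4 := h4 hz.1
    rw [h5 hz.1, if_pos h0, if_pos h0, e1] at h4
    exact Subtype.ext (add_left_cancel h4))
  refine ⟨q, fun A => if (A : Plane) ∈ Γ.seg L ∧ Γ.s L < Γ.h A ∧ Γ.h A < Γ.t L then δ (Γ.h A)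
    else 0, q.2, fun A => ?_, fun A hA => if_neg hA, fun u h1 h2 h3 => ?_⟩
  · dsimp only
    split_ifs
    · exact (δ _).2
    · exact zero_mem _
  · have hu : u ∉ V'.image Γ.h := by
      intro h
      obtain ⟨A, hA, hAu⟩ := Finset.mem_image.1 h
      rw [Finset.mem_filter] at hA
      refine h3 ?_
      rw [← hAu, Γ.pt_h hA.2.1.1]
      exact hA.1
    have hinj : Set.InjOn Γ.h (V' : Set Plane) := by
      intro A hA B hB hAB
      have hA := (Finset.mem_filter.1 (Finset.mem_coe.1 hA)).2.1
      have hB := (Finset.mem_filter.1 (Finset.mem_coe.1 hB)).2.1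
      exact ext_lin hA.1 hB.1 hAB
    have hsum := hqδ u h1 h2 hu
    rw [Finset.sum_image hinj, Finset.sum_filter] at hsum
    have e : (g u : Pol d) = q + ∑ A : Γ.V, (if Γ.h A < u then
        (if (A : Plane) ∈ Γ.seg L ∧ Γ.s L < Γ.h A ∧ Γ.h A < Γ.t L then (δ (Γ.h A) : Pol d) else 0)
          else 0) := by
      rw [hsum, ← Finset.sum_coe_sort, Submodule.coe_add, Submodule.coe_sum]
      congr 1
      refine Finset.sum_congr rfl fun A _ => ?_
      split_ifs <;> rfl
    rw [← e]
    exact hg u h1 h2 h3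

/-- The direction in which the height increases at fixed abscissa. -/
def up : Plane := !₂[0, 1]

theorem h_add_up (y : Plane) (τ : ℝ) : Γ.h (y + τ • up) = Γ.h y + τ := by
  simp [h, ht, up]
  ring

theorem tendsto_add_smul (y w : Plane) (s : Set ℝ) :
    Tendsto (fun τ : ℝ => y + τ • w) (𝓝[s] 0) (𝓝 y) := by
  have : Continuous fun τ : ℝ => y + τ • w := by fun_prop
  have h := this.continuousAt.tendsto (x := (0 : ℝ))
  simp only [zero_smul, add_zero] at h
  exact h.mono_left nhdsWithin_le_nhds

theorem frequently_above {y : Plane} : ∃ᶠ z in 𝓝 y, Γ.h y < Γ.h z := by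
  refine (tendsto_add_smul y up (Set.Ioi 0)).frequently (Eventually.frequently ?_)
  filter_upwards [self_mem_nhdsWithin] with τ hτ
  rw [h_add_up]
  simpa using hτ

theorem frequently_below {y : Plane} : ∃ᶠ z in 𝓝 y, Γ.h z < Γ.h y := by
  refine (tendsto_add_smul y up (Set.Iio 0)).frequently (Eventually.frequently ?_)
  filter_upwards [self_mem_nhdsWithin] with τ hτ
  rw [h_add_up]
  simpa using hτ

/-- A disc without the horizontal radius to the left is connected. -/
theorem isPreconnected_slit (x : Plane) {r : ℝ} (hr : 0 < r) :
    IsPreconnected {z ∈ Metric.ball x r | Γ.h z ≠ Γ.h x ∨ x 0 < z 0} := by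
  have hconv := convex_ball x r
  have hlin : ∀ (y z : Plane) (a b : ℝ), Γ.h (a • y + b • z) = a * Γ.h y + b * Γ.h z := by
    intro y z a b
    simp [h, ht]
    ring
  have hlinear : IsLinearMap ℝ Γ.h :=
    ⟨fun y z => by simpa using hlin y z 1 1, fun a y => by simpa using hlin y 0 a 0⟩
  have hlinear0 : IsLinearMap ℝ (fun z : Plane => z 0) :=
    ⟨fun y z => by simp, fun a y => by simp⟩
  -- The slit disc is the union of its upper, lower and right halves. These are convex, and the
  -- right half meets both others.
  have c1 := (hconv.inter (convex_halfSpace_gt hlinear (Γ.h x))).isPreconnected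
  have c2 := (hconv.inter (convex_halfSpace_lt hlinear (Γ.h x))).isPreconnected
  have c3 := (hconv.inter (convex_halfSpace_gt hlinear0 (x 0))).isPreconnected
  have hpos : ∀ᶠ τ in 𝓝[>] (0 : ℝ), 0 < τ := self_mem_nhdsWithin
  have hb : ∀ w : Plane, ∀ᶠ τ in 𝓝[>] (0 : ℝ), x + τ • w ∈ Metric.ball x r := fun w =>
    (tendsto_add_smul x w (Set.Ioi 0)).eventually_mem (Metric.ball_mem_nhds x hr)
  obtain ⟨τ, hτ, hb1, hb2⟩ :=
    (hpos.and ((hb (Γ.horiz + up)).and (hb (Γ.horiz - up)))).exists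
  have hr1 : x 0 < (x + τ • (Γ.horiz + up)) 0 := by simp [horiz, up, hτ]
  have hr2 : x 0 < (x + τ • (Γ.horiz - up)) 0 := by simp [horiz, up, hτ]
  have hu1 : Γ.h x < Γ.h (x + τ • (Γ.horiz + up)) := by
    rw [smul_add, ← add_assoc, h_add_up, h_add_horiz]
    linarith
  have hu2 : Γ.h (x + τ • (Γ.horiz - up)) < Γ.h x := by
    rw [smul_sub, ← add_sub_assoc, sub_eq_add_neg, ← neg_smul, h_add_up, h_add_horiz]
    linarith
  have h31 := IsPreconnected.union _ (Set.mem_inter hb1 hr1) (Set.mem_inter hb1 hu1) c3 c1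
  have h312 := IsPreconnected.union _ (Set.mem_union_left _ (Set.mem_inter hb2 hr2)) (Set.mem_inter hb2 hu2) h31 c2
  convert! h312 using 1
  ext z
  simp only [Set.mem_ofPred_eq, Set.mem_union, Set.mem_inter_iff, ne_iff_lt_or_gt]
  tauto

/-- At a vertex the increments add up to zero, and the model is correct. -/
theorem agreesNear_vertex {G : Type*} [AddCommGroup G] (hΩ : IsOpen Ω) {F : Plane → G}
    (hF : ∀ z ∈ Ω, z ∉ Γ.grid → ∀ᶠ w in 𝓝 z, F w = F z) {θ : Γ.Data G} (hθ : Compatible θ)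
    (hreg : ∀ y ∈ Ω, y ∉ Γ.V → AgreesNear Γ F (model θ y) y) {x : Plane} (hx : x ∈ Ω) :
    ∑ L, incr θ x L = 0 ∧ AgreesNear Γ F (model θ x) x := by
  obtain ⟨r, hr, hball⟩ := Metric.eventually_nhds_iff_ball.1 (Γ.eventually_near hΩ hx)
  have hW := Γ.isPreconnected_slit x hr
  -- On the slit disc the model at `x` is compatible with the correct models at nearby points, so
  -- `F` minus this model is constant.
  obtain ⟨k, hk⟩ := exists_const_off (N := Γ.grid) (g := fun z => F z - model θ x z) hW
    (fun y _ => Γ.frequently_notMem_grid y) (by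
      rintro y ⟨hy, hs⟩
      have hn := hball y hy
      have hne : y ≠ x := by rintro rfl; simp at hs
      obtain ⟨p, hp⟩ := hreg y hn.mem fun hV => hne (hn.eq_of_mem_V hV)
      obtain ⟨k', hk'⟩ := eventually_model_sub_of_slit hθ hx hn hs
      refine ⟨p - k', ?_⟩
      filter_upwards [hp, hk'] with z h1 h2 h3
      rw [h1 h3, ← h2]
      abel)
  have hleft : ∀ y ∈ Metric.ball x r, Γ.h y = Γ.h x → y 0 < x 0 →
      ∃ k', ∀ᶠ z in 𝓝 y, z ∉ Γ.grid →
        F z - model θ x z = k' - if Γ.h x < Γ.h z then ∑ L, incr θ x L else 0 := by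
    intro y hy hh h0
    have hn := hball y hy
    have hne : y ≠ x := by rintro rfl; simp at h0
    obtain ⟨p, hp⟩ := hreg y hn.mem fun hV => hne (hn.eq_of_mem_V hV)
    obtain ⟨k', hk'⟩ := eventually_model_sub_of_left hθ hn hh h0
    refine ⟨p - k', ?_⟩
    filter_upwards [hp, hk'] with z h1 h2 h3
    rw [h1 h3, sub_eq_iff_eq_add.1 h2]
    abel
  have hWmem : ∀ z ∈ Metric.ball x r, Γ.h z ≠ Γ.h x → z ∉ Γ.grid → F z - model θ x z = k :=
    fun z hz hh hg => hk z ⟨hz, Or.inl hh⟩ hg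
  -- Just to the left of `x` the same constant `k` is seen above and below the level of `x`, while
  -- the two values differ by the sum of the increments.
  have hD : ∑ L, incr θ x L = 0 := by
    have hneg : ∀ᶠ τ in 𝓝[<] (0 : ℝ), τ < 0 := self_mem_nhdsWithin
    obtain ⟨τ, hτ, hb⟩ := (hneg.and ((Γ.tendsto_horiz x (Set.Iio 0)).eventually_mem
      (Metric.ball_mem_nhds x hr))).exists
    set y := x + τ • Γ.horiz with hy
    have hh : Γ.h y = Γ.h x := Γ.h_add_horiz x τ
    have h0 : y 0 < x 0 := by simp [hy, horiz, hτ]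
    have hyg : y ∉ Γ.grid := by
      intro hg
      obtain ⟨L, hL⟩ := Set.mem_iUnion.1 hg
      have h2 := lin_of_h_eq ((hball y hb).seg L hL) hh
      rw [hL.1] at h2
      linarith
    obtain ⟨k', hk'⟩ := hleft y hb hh h0
    have hev0 : ∀ᶠ z in 𝓝 y, z ∈ Metric.ball x r ∧ z ∉ Γ.grid :=
      inter_mem (Metric.isOpen_ball.mem_nhds hb) (Γ.isClosed_grid.isOpen_compl.mem_nhds hyg)
    have hev := hk'.and hev0
    obtain ⟨z, hz, hz1, hz2, hz3⟩ := ((frequently_above (Γ := Γ) (y := y)).and_eventually hev).exists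
    obtain ⟨w, hw, hw1, hw2, hw3⟩ := ((frequently_below (Γ := Γ) (y := y)).and_eventually hev).exists
    rw [hh] at hz hw
    have e1 := hz1 hz3
    have e2 := hw1 hw3
    rw [hWmem z hz2 hz.ne' hz3, if_pos hz] at e1
    rw [hWmem w hw2 hw.ne hw3, if_neg hw.not_gt, sub_zero] at e2
    rw [e2] at e1
    exact sub_eq_self.1 e1.symm
  refine ⟨hD, k, ?_⟩
  filter_upwards [Metric.ball_mem_nhds x hr] with z hz hzg
  suffices h : F z - model θ x z = k by rw [← h]; abel
  by_cases hzW : Γ.h z ≠ Γ.h x ∨ x 0 < z 0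
  · exact hk z ⟨hz, hzW⟩ hzg
  push Not at hzW
  -- On the slit itself, and at `x` when it is off the grid, the difference is locally constant as
  -- well; a nearby point above the level identifies the constant as `k`.
  have hloc : ∃ k', ∀ᶠ w in 𝓝 z, w ∉ Γ.grid → F w - model θ x w = k' := by
    rcases hzW.2.lt_or_eq with h0 | h0
    · obtain ⟨k', hk'⟩ := hleft z hz hzW.1 h0
      exact ⟨k', by simpa [hD] using hk'⟩
    · have : z = x := Γ.ext_h hzW.1 h0
      subst this
      refine ⟨F z, ?_⟩
      filter_upwards [hF z hx hzg] with w hw _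
      rw [hw, model_of_notMem_grid hzg, sub_zero]
  obtain ⟨k', hk'⟩ := hloc
  rw [hk'.self_of_nhds hzg]
  have hev0 : ∀ᶠ w in 𝓝 z, w ∈ Metric.ball x r ∧ w ∉ Γ.grid :=
    inter_mem (Metric.isOpen_ball.mem_nhds hz) (Γ.isClosed_grid.isOpen_compl.mem_nhds hzg)
  have hev := hk'.and hev0
  obtain ⟨w, hw, hw1, hw2, hw3⟩ := ((frequently_above (Γ := Γ) (y := z)).and_eventually hev).exists
  rw [hzW.1] at hw
  rw [← hw1 hw3, hWmem w hw2 hw.ne' hw3]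

/-- Every `C^μ` spline has admissible jump data. -/
theorem exists_jumpData (hΩ : IsOpen Ω) {s : Ω → ℝ} (hs : SmoothOn μ s Ω)
    (hp : IsPiecewise Γ d s) : ∃ θ ∈ jumpData Γ d μ, HasJumps s θ := by
  classical
  obtain ⟨f, hf, hsf⟩ := hs
  obtain ⟨F, hF, hsF⟩ := hp
  have hFf : ∀ z ∈ Ω, z ∉ Γ.grid → f z = ev z (F z : Poly) := fun z hz hzg => by
    rw [← hsF z hz hzg, hsf ⟨z, hz⟩ hz]
  choose q δ hq hδ hδ0 hqδ using exists_segment_data hΩ hF hf hFf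
  -- If `L` starts inside `Ω`, its first jump `q L` is recorded as the increment at the starting
  -- vertex instead; if it ends inside `Ω`, the increment there cancels the accumulated jump.
  let θ : Γ.Data (Pol d) :=
    (fun L => if Γ.pt L (Γ.s L) ∈ Ω then 0 else q L,
      fun A L => δ L A + (if (A : Plane) = Γ.pt L (Γ.s L) then q L else 0) +
        (if (A : Plane) = Γ.pt L (Γ.t L) then -(q L + ∑ B, δ L B) else 0))
  have hite : ∀ (x : Plane) (a : Pol d), (∑ A : Γ.V, if (A : Plane) = x then a else 0) =
      if x ∈ Γ.V then a else 0 := by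
    intro x a
    rw [Finset.sum_coe_sort Γ.V fun A => if A = x then a else 0, Finset.sum_ite_eq']
  have hbot : ∀ L, Γ.pt L (Γ.s L) ∈ Γ.V ↔ Γ.pt L (Γ.s L) ∈ Ω := fun L =>
    ⟨Γ.V_subset _, fun h => Γ.V_of_end _ h L (Γ.lin_pt L _) (Or.inl (Γ.h_pt L _))⟩
  have htop : ∀ L, Γ.pt L (Γ.t L) ∈ Ω → Γ.pt L (Γ.t L) ∈ Γ.V := fun L h =>
    Γ.V_of_end _ h L (Γ.lin_pt L _) (Or.inr (Γ.h_pt L _))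
  have hpteq : ∀ L x u, Γ.lin L x = 0 → Γ.h x = u → Γ.pt L u = x := by
    rintro L x _ hx rfl
    exact Γ.pt_h hx
  have hst := fun L => (Γ.s_lt_t L).le
  have hθ : Compatible θ := by
    refine ⟨fun A L hA => ?_, fun L x hx hl hh => ?_, fun L x hx hl hh => ?_⟩
    · have h1 : (A : Plane) ≠ Γ.pt L (Γ.s L) := fun h => hA (h ▸ Γ.pt_mem_seg le_rfl (hst L))
      have h2 : (A : Plane) ≠ Γ.pt L (Γ.t L) := fun h => hA (h ▸ Γ.pt_mem_seg (hst L) le_rfl)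
      simp only [θ, if_neg h1, if_neg h2, add_zero]
      exact hδ0 L A fun h => hA h.1
    · simp only [θ]
      rw [if_pos]
      rwa [hpteq L x _ hl hh]
    · have hxV := htop L (by rwa [hpteq L x _ hl hh])
      simp only [θ, Finset.sum_add_distrib, hite, if_pos hxV, hbot]
      split_ifs <;> abel
  -- In the interior of `L` the starting vertex is already counted and the final one not yet, so
  -- moving `q L` changes nothing.
  have hjump : ∀ L u, Γ.s L < u → u < Γ.t L →
      jump θ L u = q L + ∑ A : Γ.V, (if Γ.h A < u then δ L A else 0) := by
    intro L u h1 h2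
    have e1 : ∀ A : Γ.V, (if Γ.h A < u then θ.2 A L else 0) =
        (if Γ.h A < u then δ L A else 0) +
          if (A : Plane) = Γ.pt L (Γ.s L) then q L else 0 := by
      intro A
      by_cases hA1 : (A : Plane) = Γ.pt L (Γ.s L)
      · have hne : (A : Plane) ≠ Γ.pt L (Γ.t L) := by
          intro h
          have := congrArg Γ.h (hA1.symm.trans h)
          rw [h_pt, h_pt] at this
          exact (Γ.s_lt_t L).ne this
        have : Γ.h A < u := by rw [hA1, h_pt]; exact h1
        simp only [θ, if_pos this, if_pos hA1, if_neg hne, add_zero]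
      · by_cases hA2 : (A : Plane) = Γ.pt L (Γ.t L)
        · have : ¬ Γ.h A < u := by rw [hA2, h_pt]; exact h2.not_gt
          simp only [if_neg this, if_neg hA1, add_zero]
        · simp only [θ, if_neg hA1, if_neg hA2, add_zero]
    unfold jump
    rw [Finset.sum_congr rfl fun A _ => e1 A, Finset.sum_add_distrib, hite]
    simp only [θ, hbot]
    split_ifs <;> abel
  have hreg : ∀ y ∈ Ω, y ∉ Γ.V → AgreesNear Γ F (model θ y) y := by
    intro y hy hV
    by_cases hyg : y ∈ Γ.grid
    · obtain ⟨L, hL⟩ := Set.mem_iUnion.1 hyg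
      obtain ⟨h1, h2⟩ := Γ.lt_of_mem_seg hy hV hL
      have := hqδ L (Γ.h y) h1 h2 (by rwa [Γ.pt_h hL.1])
      rw [← hjump L _ h1 h2, Γ.pt_h hL.1] at this
      have e : model θ y = fun z => if 0 < Γ.lin L z then jump θ L (Γ.h y) else 0 :=
        funext fun z => model_of_notMem_V hy hV hL z
      rwa [e]
    · refine ⟨F y, ?_⟩
      filter_upwards [hF y hy hyg] with z hz _
      rw [hz, model_of_notMem_grid hyg, add_zero]
  have hall := fun x (hx : x ∈ Ω) => agreesNear_vertex hΩ hF hθ hreg hx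
  refine ⟨θ, ⟨hθ, fun A => ?_, fun L => ?_, fun A L => ?_⟩, fun x hx => ?_⟩
  · have := (hall A (Γ.V_subset A A.2)).1
    simpa [incr] using this
  · simp only [θ]
    split_ifs
    · exact zero_mem _
    · exact hq L
  · refine add_mem (add_mem (hδ L A) ?_) ?_ <;> split_ifs
    · exact hq L
    · exact zero_mem _
    · exact neg_mem (add_mem (hq L) (sum_mem fun B _ => hδ L B))
    · exact zero_mem _
  · obtain ⟨p, hp⟩ := (hall x hx).2
    refine ⟨p, ?_⟩
    filter_upwards [hp] with z hz hzΩ hzg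
    rw [hsF z hzΩ hzg, hz hzg]

end SegmentSystem

end PolySpline

/-! ### The dimension of the space of jump data -/

namespace PolySpline

namespace SegmentSystem

variable {Ω : Set Plane} {Γ : SegmentSystem Ω} {d μ : ℕ}

/-- The segments without an endpoint in `Ω`. -/
def IsCross (Γ : SegmentSystem Ω) (L : Γ.ι) : Prop := Γ.pt L (Γ.s L) ∉ Ω ∧ Γ.pt L (Γ.t L) ∉ Ω

open Classical in
/-- The independent parts of admissible jump data: the increments at the vertices and the initial
jumps of the cross-cuts. -/
def jumpDataParts (Γ : SegmentSystem Ω) (d μ : ℕ) : jumpData Γ d μ →ₗ[ℝ]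
    ((A : Γ.V) → conformal d μ fun L : {L : Γ.ι // (A : Plane) ∈ Γ.seg L} => Γ.poly L) ×
      ((L : {L : Γ.ι // IsCross Γ L}) → smoothJumps d μ (Γ.poly L)) where
  toFun θ := (fun A => ⟨fun L => θ.1.2 A L, fun L => θ.2.2.2.2 A L, by
      rw [← θ.2.2.1 A]
      refine Fintype.sum_of_injective _ Subtype.val_injective _ _ (fun L hL => ?_) fun L => rfl
      exact θ.2.1.supp A L fun h => hL ⟨⟨L, h⟩, rfl⟩⟩,
    fun L => ⟨θ.1.1 L, θ.2.2.2.1 L⟩)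
  map_add' _ _ := rfl
  map_smul' _ _ := rfl

/-- When all increments vanish, an end inside `Ω` forces the initial jump to be zero; for segments
without such an end it is one of the recorded parts. -/
theorem jumpDataParts_injective :
    Function.Injective (jumpDataParts Γ d μ) := by
  rw [injective_iff_map_eq_zero]
  intro θ h
  have h1 : ∀ A L, θ.1.2 A L = 0 := by
    intro A L
    by_cases hA : (A : Plane) ∈ Γ.seg L
    · have := congrFun (congrArg Subtype.val (congrFun (congrArg Prod.fst h) A)) ⟨L, hA⟩
      exact this
    · exact θ.2.1.supp A L hA
  refine Subtype.ext (Prod.ext (funext fun L => ?_) (funext fun A => funext fun L => h1 A L))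
  by_cases hs : Γ.pt L (Γ.s L) ∈ Ω
  · exact θ.2.1.lo L _ hs (Γ.lin_pt L _) (Γ.h_pt L _)
  · by_cases ht : Γ.pt L (Γ.t L) ∈ Ω
    · have := θ.2.1.hi L _ ht (Γ.lin_pt L _) (Γ.h_pt L _)
      simp only [h1, Finset.sum_const_zero, add_zero] at this
      exact this
    · exact congrArg Subtype.val (congrFun (congrArg Prod.snd h) ⟨L, hs, ht⟩)

/-- The initial jump of a ray can be adjusted to meet the condition at its one end inside `Ω`. A
segment with two such ends would impose a relation between its increments, which `hend` excludes. -/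
theorem jumpDataParts_surjective
    (hend : ∀ L, ¬(Γ.pt L (Γ.s L) ∈ Ω ∧ Γ.pt L (Γ.t L) ∈ Ω)) :
    Function.Surjective (jumpDataParts Γ d μ) := by
  classical
  rintro ⟨δ, q⟩
  let D : Γ.V → Γ.ι → Pol d := fun A L =>
    if h : (A : Plane) ∈ Γ.seg L then (δ A).1 ⟨L, h⟩ else 0
  have hD : ∀ A L, D A L ∈ smoothJumps d μ (Γ.poly L) := by
    intro A L
    by_cases h : (A : Plane) ∈ Γ.seg L
    · simp only [D, dif_pos h]
      exact (δ A).2.1 ⟨L, h⟩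
    · simp only [D, dif_neg h]
      exact zero_mem _
  -- A ray starting inside `Ω` begins with jump zero; a ray ending inside `Ω` begins with minus the
  -- total of its increments.
  let Q : Γ.ι → Pol d := fun L =>
    if h : IsCross Γ L then (q ⟨L, h⟩ : Pol d) else
      if Γ.pt L (Γ.s L) ∈ Ω then 0 else -∑ A, D A L
  have hpteq : ∀ L x u, Γ.lin L x = 0 → Γ.h x = u → Γ.pt L u = x := by
    rintro L x _ hx rfl
    exact Γ.pt_h hx
  have hθ : (Q, D) ∈ jumpData Γ d μ := by
    refine ⟨⟨fun A L hA => dif_neg hA, fun L x hx hl hh => ?_, fun L x hx hl hh => ?_⟩,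
      fun A => ?_, fun L => ?_, hD⟩
    · have h : Γ.pt L (Γ.s L) ∈ Ω := by rwa [hpteq L x _ hl hh]
      simp only [Q]
      rw [dif_neg fun hc => hc.1 h, if_pos h]
    · have h : Γ.pt L (Γ.t L) ∈ Ω := by rwa [hpteq L x _ hl hh]
      simp only [Q]
      rw [dif_neg fun hc => hc.2 h, if_neg fun h' => hend L ⟨h', h⟩, neg_add_cancel]
    · rw [← (δ A).2.2]
      refine (Fintype.sum_of_injective _ Subtype.val_injective _ _ (fun L hL => ?_) fun L => ?_).symm
      · exact dif_neg fun h => hL ⟨⟨L, h⟩, rfl⟩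
      · simp only [D, dif_pos L.2]
    · simp only [Q]
      split_ifs with h1 h2
      · exact (q ⟨L, h1⟩).2
      · exact zero_mem _
      · exact neg_mem (sum_mem fun A _ => hD A L)
  refine ⟨⟨_, hθ⟩, Prod.ext (funext fun A => Subtype.ext (funext fun L => ?_))
    (funext fun L => Subtype.ext ?_)⟩
  · exact dif_pos L.2
  · exact dif_pos L.2

theorem free_submodule {V : Type*} [AddCommGroup V] [Module ℝ V] (S : Submodule ℝ V) :
    Module.Free ℝ S := inferInstance

/-- Each cross-cut contributes a free initial jump, and each vertex a family of increments with sum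
zero. Segments through a common vertex have distinct slopes by `V_of_two`, as the count requires. -/
theorem finrank_jumpData (h : μ ≤ d)
    (hend : ∀ L, ¬(Γ.pt L (Γ.s L) ∈ Ω ∧ Γ.pt L (Γ.t L) ∈ Ω)) :
    (Module.finrank ℝ (jumpData Γ d μ) : ℤ) =
      (Nat.card {L : Γ.ι // IsCross Γ L} : ℤ) * ((d - μ + 1).choose 2 : ℤ) +
        ∑ A ∈ Γ.V, kNum d μ (Nat.card {L : Γ.ι // A ∈ Γ.seg L}) := by
  classical
  have h1 : ∀ A : Γ.V, Module.Free ℝ (conformal d μ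
    fun L : {L : Γ.ι // (A : Plane) ∈ Γ.seg L} => Γ.poly L) := fun A => free_submodule _
  have h2 : ∀ L : {L : Γ.ι // IsCross Γ L}, Module.Free ℝ (smoothJumps d μ (Γ.poly L)) :=
    fun L => free_submodule _
  rw [(LinearEquiv.ofBijective (jumpDataParts Γ d μ)
    ⟨jumpDataParts_injective, jumpDataParts_surjective hend⟩).finrank_eq,
    Module.finrank_prod, Module.finrank_pi_fintype, Module.finrank_pi_fintype]
  push_cast
  rw [add_comm, ← Finset.sum_coe_sort Γ.V]
  congr 1
  · have : ∀ L : {L : Γ.ι // IsCross Γ L}, Module.finrank ℝ (smoothJumps d μ (Γ.poly L)) =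
        (d - μ + 1).choose 2 := fun L => finrank_smoothJumps h _ _ _
    simp [this, Nat.card_eq_fintype_card]
  · refine Finset.sum_congr rfl fun A _ => ?_
    rw [Nat.card_eq_fintype_card]
    refine finrank_conformal h (c := fun L : {L : Γ.ι // (A : Plane) ∈ Γ.seg L} => Γ.c L)
      (β := fun L => Γ.β L) (A := A) (fun L L' hc => ?_) fun L => L.2.1
    by_contra hne
    exact (Γ.V_of_two A (Γ.V_subset A A.2) L L' (fun h => hne (Subtype.ext h)) L.2 L'.2).2 hc

theorem HasJumps.add {s s' : Ω → ℝ} {θ θ' : Γ.Data (Pol d)} (h : HasJumps s θ)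
    (h' : HasJumps s' θ') : HasJumps (s + s') (θ + θ') := by
  intro x hx
  obtain ⟨p, hp⟩ := h x hx
  obtain ⟨p', hp'⟩ := h' x hx
  refine ⟨p + p', ?_⟩
  filter_upwards [hp, hp'] with z h1 h2 hz hzg
  rw [Pi.add_apply, h1 hz hzg, h2 hz hzg, model_add, ← map_add, ← Submodule.coe_add,
    add_add_add_comm]

theorem HasJumps.smul {s : Ω → ℝ} {θ : Γ.Data (Pol d)} (a : ℝ) (h : HasJumps s θ) :
    HasJumps (a • s) (a • θ) := by
  intro x hx
  obtain ⟨p, hp⟩ := h x hx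
  refine ⟨a • p, ?_⟩
  filter_upwards [hp] with z h1 hz hzg
  rw [Pi.smul_apply, h1 hz hzg, model_smul, ← smul_add, Submodule.coe_smul, MvPolynomial.smul_eval,
    smul_eq_mul]

theorem HasJumps.unique (hΩ : IsOpen Ω) {s : Ω → ℝ} {θ θ' : Γ.Data (Pol d)}
    (hθ : θ ∈ jumpData Γ d μ) (hθ' : θ' ∈ jumpData Γ d μ) (h : HasJumps s θ)
    (h' : HasJumps s θ') : θ = θ' := by
  have h0 := h.add (h'.smul (-1))
  rw [show s + (-1 : ℝ) • s = 0 by module, show θ + (-1 : ℝ) • θ' = θ - θ' by module] at h0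
  exact sub_eq_zero.1 (eq_zero_of_hasJumps hΩ (sub_mem hθ hθ').1 h0)

theorem hasJumps_poly (p : Pol d) :
    HasJumps (fun x : Ω => ev x (p : Poly)) (0 : Γ.Data (Pol d)) := by
  intro x _
  refine ⟨p, Eventually.of_forall fun z hz _ => ?_⟩
  have : model (0 : Γ.Data (Pol d)) x z = 0 := by
    have := model_smul (0 : ℝ) (0 : Γ.Data (Pol d)) x z
    simpa using this
  rw [this, add_zero]

/-- The dimension of the spline space over a system of segments. -/
theorem finrank_eq_add_finrank_jumpData (hΩ : IsOpen Ω) [SimplyConnectedSpace Ω]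
    {S : Submodule ℝ (Ω → ℝ)} [FiniteDimensional ℝ S]
    (hS : ∀ s, s ∈ S ↔ SmoothOn μ s Ω ∧ IsPiecewise Γ d s) :
    Module.finrank ℝ S = (d + 2).choose 2 + Module.finrank ℝ (jumpData Γ d μ) := by
  have hconn : IsPreconnected Ω := isPreconnected_iff_preconnectedSpace.2 inferInstance
  choose J hJ hJs using fun s : S => exists_jumpData hΩ ((hS s).1 s.2).1 ((hS s).1 s.2).2
  -- The chosen jump data depend linearly on the spline because they are unique.
  let j : S →ₗ[ℝ] jumpData Γ d μ :=
    { toFun := fun s => ⟨J s, hJ s⟩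
      map_add' := fun s s' => Subtype.ext <|
        (hJs (s + s')).unique hΩ (hJ _) (add_mem (hJ s) (hJ s')) ((hJs s).add (hJs s'))
      map_smul' := fun a s => Subtype.ext <|
        (hJs (a • s)).unique hΩ (hJ _) (Submodule.smul_mem _ a (hJ s)) ((hJs s).smul a) }
  have hj : Function.Surjective j := fun θ => by
    obtain ⟨s, h1, h2, h3⟩ := exists_spline hΩ θ.2
    exact ⟨⟨s, (hS s).2 ⟨h1, h2⟩⟩, Subtype.ext ((hJs _).unique hΩ (hJ _) θ.2 h3)⟩
  have hpS : ∀ p : Pol d, (fun x : Ω => ev x (p : Poly)) ∈ S := fun p => (hS _).2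
    ⟨⟨fun x => ev x (p : Poly), (contDiff_ev _ _).contDiffOn, fun _ _ => rfl⟩,
      fun _ => p, fun _ _ _ => Eventually.of_forall fun _ => rfl, fun _ _ _ => rfl⟩
  -- The kernel of the jump map consists of the global polynomials.
  let k : Pol d →ₗ[ℝ] LinearMap.ker j :=
    { toFun := fun p => ⟨⟨fun x => ev x (p : Poly), hpS p⟩, Subtype.ext <|
        (hJs _).unique hΩ (hJ _) (zero_mem _) (hasJumps_poly p)⟩
      map_add' := fun p q => Subtype.ext (Subtype.ext (funext fun x => map_add (ev x) _ _))
      map_smul' := fun a p => Subtype.ext (Subtype.ext (funext fun x => MvPolynomial.smul_eval _ _ _)) }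
  have hk : Function.Bijective k := by
    constructor
    · intro p q hpq
      have hpq' : ∀ x : Ω, ev x (p : Poly) = ev x (q : Poly) := fun x =>
        congrFun (congrArg (fun r : LinearMap.ker j => (r.1 : Ω → ℝ)) hpq) x
      obtain ⟨x⟩ : Nonempty Ω := inferInstance
      refine Subtype.ext (poly_eq_of_frequently hΩ (y := x) ?_ ?_)
      · exact Eventually.frequently (hΩ.mem_nhds x.2)
      · exact Eventually.of_forall fun z hz => hpq' ⟨z, hz⟩
    · rintro ⟨s, hs⟩
      have h0 : J s = 0 := congrArg Subtype.val hs
      obtain ⟨p, hp⟩ := exists_poly_of_hasJumps_zero hΩ hconn ((hS s).1 s.2).1 (h0 ▸ hJs s)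
      exact ⟨p, Subtype.ext (Subtype.ext (funext fun x => (hp x).symm))⟩
  have h := LinearMap.finrank_range_add_finrank_ker (V₂ := jumpData Γ d μ) j
  rw [← h, LinearMap.range_eq_top.2 hj, finrank_top,
    ← (LinearEquiv.ofBijective k hk).finrank_eq, finrank_pol, add_comm]

end SegmentSystem

end PolySpline

namespace PolySpline

/-! ### Segments transversal to a height function -/

/-- The closed segment between the heights `s` and `t` on the line `x 0 = c * ht κ x + β`. -/
def sg (κ c β s t : ℝ) : Set Plane :=
  {x | c * ht κ x + β - x 0 = 0 ∧ s ≤ ht κ x ∧ ht κ x ≤ t}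

/-- The open segment between the heights `s` and `t` on the line `x 0 = c * ht κ x + β`. -/
def sgo (κ c β s t : ℝ) : Set Plane :=
  {x | c * ht κ x + β - x 0 = 0 ∧ s < ht κ x ∧ ht κ x < t}

/-- The point at height `u` of the line `x 0 = c * ht κ x + β`. -/
def pnt (κ c β u : ℝ) : Plane := !₂[c * u + β, u - κ * (c * u + β)]

variable {κ c β c' β' s t s' t' : ℝ} {a b x : Plane}

@[simp] theorem ht_pnt (κ c β u : ℝ) : ht κ (pnt κ c β u) = u := by
  simp [ht, pnt]

@[simp] theorem aff_pnt (κ c β u : ℝ) :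
    c * ht κ (pnt κ c β u) + β - (pnt κ c β u) 0 = 0 := by
  rw [ht_pnt]
  simp [pnt]

theorem pnt_ht (h : c * ht κ x + β - x 0 = 0) : pnt κ c β (ht κ x) = x := by
  refine ext_ht (κ := κ) (by simp) ?_
  simp only [pnt, PiLp.toLp_apply, Matrix.cons_val_zero]
  linarith

theorem ht_combo (κ p q : ℝ) (a b : Plane) : ht κ (p • a + q • b) = p * ht κ a + q * ht κ b := by
  simp [ht]
  ring

theorem aff_combo {p q : ℝ} (hpq : p + q = 1) (κ c β : ℝ) (a b : Plane) :
    c * ht κ (p • a + q • b) + β - (p • a + q • b) 0 =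
      p * (c * ht κ a + β - a 0) + q * (c * ht κ b + β - b 0) := by
  rw [ht_combo]
  simp only [PiLp.add_apply, PiLp.smul_apply, smul_eq_mul]
  linear_combination (-β) * hpq

theorem exists_aff (h : ht κ a ≠ ht κ b) :
    ∃ c β, c * ht κ a + β - a 0 = 0 ∧ c * ht κ b + β - b 0 = 0 := by
  have h' : ht κ b - ht κ a ≠ 0 := sub_ne_zero.2 h.symm
  refine ⟨(b 0 - a 0) / (ht κ b - ht κ a), a 0 - (b 0 - a 0) / (ht κ b - ht κ a) * ht κ a,
    by ring, ?_⟩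
  field_simp
  ring

theorem aff_unique (h : ht κ a ≠ ht κ b) (ha : c * ht κ a + β - a 0 = 0)
    (hb : c * ht κ b + β - b 0 = 0) (ha' : c' * ht κ a + β' - a 0 = 0)
    (hb' : c' * ht κ b + β' - b 0 = 0) : c = c' ∧ β = β' := by
  have h1 : (c - c') * (ht κ a - ht κ b) = 0 := by linear_combination ha - hb - ha' + hb'
  have h2 : c = c' := by
    rcases mul_eq_zero.1 h1 with h3 | h3
    · linarith
    · exact absurd (sub_eq_zero.1 h3) h
  subst h2
  exact ⟨rfl, by linarith⟩

theorem combo_eq (ha : c * ht κ a + β - a 0 = 0) (hb : c * ht κ b + β - b 0 = 0)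
    (hab : ht κ a < ht κ b) (hx : c * ht κ x + β - x 0 = 0) :
    ((ht κ b - ht κ x) / (ht κ b - ht κ a)) • a + ((ht κ x - ht κ a) / (ht κ b - ht κ a)) • b = x := by
  have h' : ht κ b - ht κ a ≠ 0 := (sub_pos.2 hab).ne'
  have h1 : (ht κ b - ht κ x) / (ht κ b - ht κ a) + (ht κ x - ht κ a) / (ht κ b - ht κ a) = 1 := by
    field_simp
    ring
  have h2 : ht κ (((ht κ b - ht κ x) / (ht κ b - ht κ a)) • a +
      ((ht κ x - ht κ a) / (ht κ b - ht κ a)) • b) = ht κ x := by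
    rw [ht_combo]
    field_simp
    ring
  refine ext_ht h2 ?_
  have h3 := aff_combo h1 κ c β a b
  rw [ha, hb, h2] at h3
  linarith

theorem segment_eq_sg (ha : c * ht κ a + β - a 0 = 0) (hb : c * ht κ b + β - b 0 = 0)
    (hab : ht κ a < ht κ b) : segment ℝ a b = sg κ c β (ht κ a) (ht κ b) := by
  have h' := sub_pos.2 hab
  ext x
  constructor
  · rintro ⟨p, q, hp, hq, hpq, rfl⟩
    obtain rfl : p = 1 - q := by linarith
    refine ⟨by rw [aff_combo hpq, ha, hb]; ring, ?_, ?_⟩ <;> rw [ht_combo] <;> nlinarith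
  · rintro ⟨h1, h2, h3⟩
    refine ⟨_, _, ?_, ?_, ?_, combo_eq ha hb hab h1⟩
    · exact div_nonneg (by linarith) h'.le
    · exact div_nonneg (by linarith) h'.le
    · field_simp
      ring

theorem openSegment_eq_sgo (ha : c * ht κ a + β - a 0 = 0) (hb : c * ht κ b + β - b 0 = 0)
    (hab : ht κ a < ht κ b) : openSegment ℝ a b = sgo κ c β (ht κ a) (ht κ b) := by
  have h' := sub_pos.2 hab
  ext x
  constructor
  · rintro ⟨p, q, hp, hq, hpq, rfl⟩
    obtain rfl : p = 1 - q := by linarith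
    refine ⟨by rw [aff_combo hpq, ha, hb]; ring, ?_, ?_⟩ <;> rw [ht_combo] <;> nlinarith
  · rintro ⟨h1, h2, h3⟩
    refine ⟨_, _, ?_, ?_, ?_, combo_eq ha hb hab h1⟩
    · exact div_pos (by linarith) h'
    · exact div_pos (by linarith) h'
    · field_simp
      ring

theorem segment_pnt (h : s < t) : segment ℝ (pnt κ c β s) (pnt κ c β t) = sg κ c β s t := by
  rw [segment_eq_sg (κ := κ) (aff_pnt κ c β s) (aff_pnt κ c β t) (by simpa using h), ht_pnt, ht_pnt]

theorem openSegment_pnt (h : s < t) :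
    openSegment ℝ (pnt κ c β s) (pnt κ c β t) = sgo κ c β s t := by
  rw [openSegment_eq_sgo (κ := κ) (aff_pnt κ c β s) (aff_pnt κ c β t) (by simpa using h),
    ht_pnt, ht_pnt]

theorem pnt_mem_sg {u : ℝ} (h1 : s ≤ u) (h2 : u ≤ t) : pnt κ c β u ∈ sg κ c β s t :=
  ⟨aff_pnt κ c β u, by simpa using h1, by simpa using h2⟩

theorem pnt_mem_sgo {u : ℝ} (h1 : s < u) (h2 : u < t) : pnt κ c β u ∈ sgo κ c β s t :=
  ⟨aff_pnt κ c β u, by simpa using h1, by simpa using h2⟩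

theorem sg_subset_sg (h : s < t) (hsub : sg κ c β s t ⊆ sg κ c' β' s' t') :
    c = c' ∧ β = β' ∧ s' ≤ s ∧ t ≤ t' := by
  have h1 := hsub (pnt_mem_sg le_rfl h.le)
  have h2 := hsub (pnt_mem_sg h.le le_rfl)
  obtain ⟨rfl, rfl⟩ := aff_unique (κ := κ) (a := pnt κ c β s) (b := pnt κ c β t)
    (by simpa using h.ne) (aff_pnt κ c β s) (aff_pnt κ c β t) h1.1 h2.1
  exact ⟨rfl, rfl, by simpa using h1.2.1, by simpa using h2.2.2⟩

/-- The endpoints of a segment are determined by it. -/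
theorem pnt_eq_or (h : segment ℝ a b = sg κ c β s t) (hst : s < t) :
    (pnt κ c β s = a ∨ pnt κ c β s = b) ∧ (pnt κ c β t = a ∨ pnt κ c β t = b) := by
  have ha : a ∈ sg κ c β s t := h ▸ left_mem_segment ℝ a b
  have hb : b ∈ sg κ c β s t := h ▸ right_mem_segment ℝ a b
  have hne : ht κ a ≠ ht κ b := by
    intro h0
    have hab : a = b := by rw [← pnt_ht ha.1, ← pnt_ht hb.1, h0]
    subst hab
    have h1 : pnt κ c β s ∈ segment ℝ a a := h ▸ pnt_mem_sg le_rfl hst.le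
    have h2 : pnt κ c β t ∈ segment ℝ a a := h ▸ pnt_mem_sg hst.le le_rfl
    rw [segment_same, Set.mem_singleton_iff] at h1 h2
    have := congrArg (ht κ) (h1.trans h2.symm)
    rw [ht_pnt, ht_pnt] at this
    exact hst.ne this
  rcases hne.lt_or_gt with h0 | h0
  · rw [segment_eq_sg ha.1 hb.1 h0] at h
    obtain ⟨-, -, h1, h2⟩ := sg_subset_sg hst h.ge
    rw [← le_antisymm h1 ha.2.1, ← le_antisymm hb.2.2 h2, pnt_ht ha.1, pnt_ht hb.1]
    exact ⟨Or.inl rfl, Or.inr rfl⟩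
  · rw [segment_symm, segment_eq_sg hb.1 ha.1 h0] at h
    obtain ⟨-, -, h1, h2⟩ := sg_subset_sg hst h.ge
    rw [← le_antisymm h1 hb.2.1, ← le_antisymm ha.2.2 h2, pnt_ht ha.1, pnt_ht hb.1]
    exact ⟨Or.inr rfl, Or.inl rfl⟩

theorem sg_subset_closure (h : s < t) : sg κ c β s t ⊆ closure (sgo κ c β s t) := by
  rw [← segment_pnt h, ← openSegment_pnt h]
  exact segment_subset_closure_openSegment

/-- Each nondegenerate edge rules out at most one shear parameter. -/
theorem exists_ht_ne (E : Finset (Plane × Plane)) (hE : ∀ e ∈ E, e.1 ≠ e.2) :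
    ∃ κ, ∀ e ∈ E, ht κ e.1 ≠ ht κ e.2 := by
  have hfin : (⋃ e ∈ E, {κ | ht κ e.1 = ht κ e.2}).Finite := by
    refine E.finite_toSet.biUnion fun e he => Set.Subsingleton.finite fun κ h κ' h' => ?_
    by_contra hne
    refine hE e he (ext_ht h ?_)
    have h1 : ht κ e.1 = ht κ e.2 := h
    have h2 : ht κ' e.1 = ht κ' e.2 := h'
    unfold ht at h1 h2
    have : (κ - κ') * (e.1 0 - e.2 0) = 0 := by linear_combination h1 - h2
    rcases mul_eq_zero.1 this with h3 | h3
    · exact absurd (sub_eq_zero.1 h3) hne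
    · exact sub_eq_zero.1 h3
  obtain ⟨κ, hκ⟩ := hfin.exists_notMem
  refine ⟨κ, fun e he h => hκ ?_⟩
  simp only [Set.mem_iUnion]
  exact ⟨e, he, h⟩

end PolySpline

/-! ### The grid lines of a partition form a segment system -/

namespace PolySpline

variable {κ c β c' β' s t s' t' : ℝ} {a b x : Plane}

namespace PolygonalPartition

variable {Ω : Set Plane} {Δ : PolygonalPartition Ω}

theorem isClosed_grid (Δ : PolygonalPartition Ω) : IsClosed Δ.grid :=
  Δ.edges.finite_toSet.isClosed_biUnion fun e _ => by
    rw [← closure_openSegment]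
    exact isClosed_closure

theorem mem_grid : x ∈ Δ.grid ↔ ∃ e ∈ Δ.edges, x ∈ segment ℝ e.1 e.2 := by
  simp [grid, segUnion]

theorem fst_mem_vertices {e : Plane × Plane} (he : e ∈ Δ.edges) : e.1 ∈ Δ.vertices :=
  Finset.mem_union_left _ (Finset.mem_image_of_mem _ he)

theorem snd_mem_vertices {e : Plane × Plane} (he : e ∈ Δ.edges) : e.2 ∈ Δ.vertices :=
  Finset.mem_union_right _ (Finset.mem_image_of_mem _ he)

theorem mem_interiorVertices : x ∈ Δ.interiorVertices ↔ x ∈ Δ.vertices ∧ x ∈ Ω := by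
  classical
  exact Finset.mem_filter

/-- Around the relative interior points of an edge the partition consists of this edge. -/
theorem eventually_mem_segment {e : Plane × Plane} (he : e ∈ Δ.edges)
    (hx : x ∈ openSegment ℝ e.1 e.2) : ∀ᶠ y in 𝓝 x, y ∈ Δ.grid → y ∈ segment ℝ e.1 e.2 := by
  have hclosed : IsClosed (⋃ e' ∈ ({e' | e' ∈ Δ.edges ∧ e' ≠ e} : Set (Plane × Plane)),
      segment ℝ e'.1 e'.2) := by
    refine ((Δ.edges.finite_toSet.subset fun e' he' => he'.1)).isClosed_biUnion fun e' _ => ?_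
    rw [← closure_openSegment]
    exact isClosed_closure
  have hnot : x ∉ ⋃ e' ∈ ({e' | e' ∈ Δ.edges ∧ e' ≠ e} : Set (Plane × Plane)),
      segment ℝ e'.1 e'.2 := by
    simp only [Set.mem_iUnion, not_exists]
    rintro e' ⟨he', hne⟩ hx'
    exact Set.disjoint_left.1 (Δ.disjoint_of_ne e he e' he' hne.symm) hx hx'
  filter_upwards [hclosed.isOpen_compl.mem_nhds hnot] with y hy hyg
  obtain ⟨e', he', hye⟩ := mem_grid.1 hyg
  by_contra hye'
  refine hy ?_
  simp only [Set.mem_iUnion]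
  exact ⟨e', ⟨he', by rintro rfl; exact hye' hye⟩, hye⟩

theorem exists_edge (hx : x ∈ Δ.grid) (hV : x ∉ Δ.vertices) :
    ∃ e ∈ Δ.edges, x ∈ openSegment ℝ e.1 e.2 := by
  obtain ⟨e, he, hxe⟩ := mem_grid.1 hx
  exact ⟨e, he, mem_openSegment_of_ne_left_right
    (by rintro rfl; exact hV (fst_mem_vertices he)) (by rintro rfl; exact hV (snd_mem_vertices he))
    hxe⟩

theorem IsGridSegment.subset_grid {l : Set Plane} (h : Δ.IsGridSegment l) : l ⊆ Δ.grid := by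
  obtain ⟨a, b, -, rfl, h⟩ := h
  refine segment_subset_closure_openSegment.trans ?_
  exact Δ.isClosed_grid.closure_subset_iff.2 (h.trans Set.inter_subset_right)

theorem isGridSegment_edge {e : Plane × Plane} (he : e ∈ Δ.edges) :
    Δ.IsGridSegment (segment ℝ e.1 e.2) :=
  ⟨e.1, e.2, Δ.ne_of_mem e he, rfl, fun _ hx => ⟨Δ.openSegment_subset e he hx,
    mem_grid.2 ⟨e, he, openSegment_subset_segment _ _ _ hx⟩⟩⟩

theorem isGridSegment_sg (hst : s < t) (h : sgo κ c β s t ⊆ Ω ∩ Δ.grid) :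
    Δ.IsGridSegment (sg κ c β s t) :=
  ⟨pnt κ c β s, pnt κ c β t, fun h => hst.ne (by simpa using congrArg (ht κ) h),
    (segment_pnt hst).symm, by rwa [openSegment_pnt hst]⟩

/-- The line carrying an edge also carries the grid segments through its points that are not
vertices. -/
theorem IsGridSegment.aff_eq_zero (h : Δ.IsGridSegment (segment ℝ a b)) (hx : x ∈ segment ℝ a b)
    (hxe : c * ht κ x + β - x 0 = 0)
    (he : ∀ᶠ y in 𝓝 x, y ∈ Δ.grid → c * ht κ y + β - y 0 = 0) :
    ∀ y ∈ segment ℝ a b, c * ht κ y + β - y 0 = 0 := by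
  intro y hy
  have hcont : Tendsto (fun τ : ℝ => (1 - τ) • x + τ • y) (𝓝[>] 0) (𝓝 x) := by
    have : Continuous fun τ : ℝ => (1 - τ) • x + τ • y := by fun_prop
    have := this.tendsto 0
    simp only [sub_zero, one_smul, zero_smul, add_zero] at this
    exact this.mono_left nhdsWithin_le_nhds
  have h1 : ∀ᶠ τ in 𝓝[>] (0 : ℝ), 0 < τ := self_mem_nhdsWithin
  have h2 : ∀ᶠ τ in 𝓝[>] (0 : ℝ), τ < 1 := nhdsWithin_le_nhds (gt_mem_nhds one_pos)
  -- A short move from `x` towards `y` stays on the grid and hence on the line; an affine function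
  -- that vanishes at two points of a line vanishes on all of it.
  obtain ⟨τ, hτ0, hτ1, hτ⟩ := (h1.and (h2.and (hcont.eventually he))).exists
  have h3 := hτ (h.subset_grid (convex_segment a b hx hy (by linarith) hτ0.le (by ring)))
  rw [aff_combo (by ring), hxe, mul_zero, zero_add] at h3
  exact (mul_eq_zero.1 h3).resolve_left hτ0.ne'

theorem exists_mem_notMem_vertices (Δ : PolygonalPartition Ω) (h : a ≠ b) :
    ∃ x ∈ openSegment ℝ a b, x ∉ Δ.vertices := by
  have hinf : (openSegment ℝ a b).Infinite := by
    rw [openSegment_eq_image_lineMap]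
    exact (Set.Ioo_infinite one_pos).image (AffineMap.lineMap_injective ℝ h).injOn
  obtain ⟨x, hx, hxV⟩ := hinf.exists_notMem_finset Δ.vertices
  exact ⟨x, hx, hxV⟩

/-- The segment between the heights `s` and `t` runs inside `Ω` along the grid. -/
structure IsGridInterval (Δ : PolygonalPartition Ω) (κ c β s t : ℝ) : Prop where
  lt : s < t
  subset : sgo κ c β s t ⊆ Ω ∩ Δ.grid

/-- The height function is injective on every edge. -/
def IsTransversal (Δ : PolygonalPartition Ω) (κ : ℝ) : Prop :=
  ∀ e ∈ Δ.edges, ht κ e.1 ≠ ht κ e.2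

theorem isGridInterval_of_segment (h0 : ht κ a ≠ ht κ b) (h : openSegment ℝ a b ⊆ Ω ∩ Δ.grid) :
    ∃ c β s t, Δ.IsGridInterval κ c β s t ∧ segment ℝ a b = sg κ c β s t ∧
      openSegment ℝ a b = sgo κ c β s t := by
  obtain ⟨c, β, ha, hb⟩ := exists_aff h0
  rcases h0.lt_or_gt with h1 | h1
  · refine ⟨c, β, _, _, ⟨h1, ?_⟩, segment_eq_sg ha hb h1, openSegment_eq_sgo ha hb h1⟩
    rwa [← openSegment_eq_sgo ha hb h1]
  · rw [segment_symm, openSegment_symm]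
    rw [openSegment_symm] at h
    refine ⟨c, β, _, _, ⟨h1, ?_⟩, segment_eq_sg hb ha h1, openSegment_eq_sgo hb ha h1⟩
    rwa [← openSegment_eq_sgo hb ha h1]

theorem exists_edge_sgo (hκ : Δ.IsTransversal κ) (hx : x ∈ Δ.grid) (hV : x ∉ Δ.vertices) :
    ∃ c β s t, Δ.IsGridInterval κ c β s t ∧ (∃ e ∈ Δ.edges, segment ℝ e.1 e.2 = sg κ c β s t) ∧
      x ∈ sgo κ c β s t ∧ ∀ᶠ y in 𝓝 x, y ∈ Δ.grid → c * ht κ y + β - y 0 = 0 := by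
  obtain ⟨e, he, hxe⟩ := exists_edge hx hV
  obtain ⟨c, β, s, t, h1, h2, h3⟩ := isGridInterval_of_segment (hκ e he)
    fun x hx => ⟨Δ.openSegment_subset e he hx,
      mem_grid.2 ⟨e, he, openSegment_subset_segment _ _ _ hx⟩⟩
  refine ⟨c, β, s, t, h1, ⟨e, he, h2⟩, h3 ▸ hxe, ?_⟩
  filter_upwards [eventually_mem_segment he hxe] with y hy hyg
  exact (h2 ▸ hy hyg).1

/-- A grid segment contains a point that is no vertex and therefore lies on the line of an edge, on
which the height is injective. -/
theorem IsGridSegment.exists_isGridInterval (hκ : Δ.IsTransversal κ) {l : Set Plane}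
    (h : Δ.IsGridSegment l) : ∃ c β s t, Δ.IsGridInterval κ c β s t ∧ l = sg κ c β s t := by
  obtain ⟨a, b, hab, rfl, hsub⟩ := id h
  obtain ⟨x, hx, hxV⟩ := exists_mem_notMem_vertices Δ hab
  obtain ⟨c, β, s, t, -, -, hxo, hnear⟩ := exists_edge_sgo hκ (hsub hx).2 hxV
  have hz := h.aff_eq_zero (openSegment_subset_segment _ _ _ hx) hxo.1 hnear
  have h0 : ht κ a ≠ ht κ b := fun h0 => hab <| by
    rw [← pnt_ht (hz a (left_mem_segment ℝ a b)), ← pnt_ht (hz b (right_mem_segment ℝ a b)), h0]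
  obtain ⟨c, β, s, t, h1, h2, -⟩ := isGridInterval_of_segment h0 hsub
  exact ⟨c, β, s, t, h1, h2⟩

theorem IsGridInterval.isGridSegment (h : Δ.IsGridInterval κ c β s t) :
    Δ.IsGridSegment (sg κ c β s t) := isGridSegment_sg h.lt h.subset

theorem IsGridInterval.sg_subset_grid (h : Δ.IsGridInterval κ c β s t) :
    sg κ c β s t ⊆ Δ.grid := h.isGridSegment.subset_grid

/-- Two collinear grid segments that share a point of `Ω` form a grid segment together. -/
theorem IsGridInterval.union (h : Δ.IsGridInterval κ c β s t) (h' : Δ.IsGridInterval κ c β s' t')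
    (hxΩ : x ∈ Ω) (hx : x ∈ sg κ c β s t) (hx' : x ∈ sg κ c β s' t') :
    Δ.IsGridInterval κ c β (min s s') (max t t') := by
  refine ⟨(min_le_left _ _).trans_lt (h.lt.trans_le (le_max_left _ _)), fun y hy => ?_⟩
  obtain ⟨hy0, hy1, hy2⟩ := hy
  rcases lt_trichotomy (ht κ y) (ht κ x) with hlt | heq | hgt
  · rcases min_lt_iff.1 hy1 with h1 | h1
    · exact h.subset ⟨hy0, h1, hlt.trans_le hx.2.2⟩
    · exact h'.subset ⟨hy0, h1, hlt.trans_le hx'.2.2⟩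
  -- The common point may be an end of both open segments; it is in `Ω` by hypothesis and on the
  -- grid because the grid is closed.
  · obtain rfl : y = x := by rw [← pnt_ht hy0, ← pnt_ht hx.1, heq]
    exact ⟨hxΩ, h.sg_subset_grid hx⟩
  · rcases lt_max_iff.1 hy2 with h1 | h1
    · exact h.subset ⟨hy0, hx.2.1.trans_lt hgt, h1⟩
    · exact h'.subset ⟨hy0, hx'.2.1.trans_lt hgt, h1⟩

/-- Otherwise the union of the two segments would be a larger grid segment. -/
theorem le_of_maximal (hmax : sg κ c β s t ∈ Δ.gridLines) (h : Δ.IsGridInterval κ c β s t)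
    (h' : Δ.IsGridInterval κ c β s' t')
    (hxΩ : x ∈ Ω) (hx : x ∈ sg κ c β s t) (hx' : x ∈ sg κ c β s' t') : s ≤ s' ∧ t' ≤ t := by
  have hu := h.union h' hxΩ hx hx'
  have hle : sg κ c β s t ⊆ sg κ c β (min s s') (max t t') := fun y hy =>
    ⟨hy.1, (min_le_left _ _).trans hy.2.1, hy.2.2.trans (le_max_left _ _)⟩
  obtain ⟨-, -, h1, h2⟩ := sg_subset_sg hu.lt (hmax.2 hu.isGridSegment hle)
  exact ⟨h1.trans (min_le_right _ _), (le_max_right _ _).trans h2⟩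

theorem eq_of_maximal (hmax : sg κ c β s t ∈ Δ.gridLines) (h : Δ.IsGridInterval κ c β s t)
    (hmax' : sg κ c β s' t' ∈ Δ.gridLines) (h' : Δ.IsGridInterval κ c β s' t')
    (hxΩ : x ∈ Ω) (hx : x ∈ sg κ c β s t) (hx' : x ∈ sg κ c β s' t') : s = s' ∧ t = t' := by
  obtain ⟨h1, h2⟩ := le_of_maximal hmax h h' hxΩ hx hx'
  obtain ⟨h3, h4⟩ := le_of_maximal hmax' h' h hxΩ hx' hx
  exact ⟨h1.antisymm h3, h4.antisymm h2⟩

/-- Every grid segment is contained in a grid line. -/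
theorem exists_gridLine (hΩ : Bornology.IsBounded Ω) (hκ : Δ.IsTransversal κ)
    (h : Δ.IsGridInterval κ c β s t) : ∃ l ∈ Δ.gridLines, sg κ c β s t ⊆ l := by
  obtain ⟨R, hR⟩ : ∃ R, ∀ x ∈ Ω, |ht κ x| ≤ R := by
    obtain ⟨R, hR⟩ := (hΩ.isCompact_closure.image (continuous_ht κ)).isBounded.subset_closedBall 0
    refine ⟨R, fun x hx => ?_⟩
    simpa using hR ⟨x, subset_closure hx, rfl⟩
  have hbound : ∀ s' t', Δ.IsGridInterval κ c β s' t' → -R ≤ s' ∧ t' ≤ R := by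
    intro s' t' h'
    have hmem : ∀ u, s' < u → u < t' → -R ≤ u ∧ u ≤ R := fun u h1 h2 => by
      have := hR _ (h'.subset (pnt_mem_sgo h1 h2)).1
      rw [ht_pnt] at this
      exact abs_le.1 this
    constructor
    · refine le_of_forall_gt_imp_ge_of_dense fun u hu => ?_
      rcases lt_or_ge u t' with h1 | h1
      · exact (hmem u hu h1).1
      · obtain ⟨v, hv1, hv2⟩ := exists_between h'.lt
        exact (hmem v hv1 hv2).1.trans (hv2.le.trans h1)
    · refine le_of_forall_lt_imp_le_of_dense fun u hu => ?_
      rcases lt_or_ge s' u with h1 | h1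
      · exact (hmem u h1 hu).2
      · obtain ⟨v, hv1, hv2⟩ := exists_between h'.lt
        exact (h1.trans hv1.le).trans (hmem v hv1 hv2).2
  -- The segment is prolonged at each end separately, as far as possible; boundedness of `Ω` makes
  -- the supremum and the infimum finite.
  set U := {t' | Δ.IsGridInterval κ c β s t'} with hU
  set D := {s' | Δ.IsGridInterval κ c β s' t} with hD
  have hUb : BddAbove U := ⟨R, fun t' h' => (hbound _ _ h').2⟩
  have hDb : BddBelow D := ⟨-R, fun s' h' => (hbound _ _ h').1⟩
  have htU : t ≤ sSup U := le_csSup hUb h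
  have hsD : sInf D ≤ s := csInf_le hDb h
  have hm : Δ.IsGridInterval κ c β (sInf D) (sSup U) := by
    refine ⟨hsD.trans_lt (h.lt.trans_le htU), ?_⟩
    rintro y ⟨hy0, hy1, hy2⟩
    rcases lt_or_ge (ht κ y) t with h1 | h1
    · obtain ⟨s', hs', h2⟩ := exists_lt_of_csInf_lt ⟨s, h⟩ hy1
      exact IsGridInterval.subset hs' ⟨hy0, h2, h1⟩
    · obtain ⟨t', ht', h2⟩ := exists_lt_of_lt_csSup ⟨t, h⟩ hy2
      exact IsGridInterval.subset ht' ⟨hy0, h.lt.trans_le h1, h2⟩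
  refine ⟨_, ⟨hm.isGridSegment, fun l hl hle => ?_⟩,
    fun y hy => ⟨hy.1, hsD.trans hy.2.1, hy.2.2.trans htU⟩⟩
  obtain ⟨c', β', s', t', h', rfl⟩ := hl.exists_isGridInterval hκ
  obtain ⟨rfl, rfl, h1, h2⟩ := sg_subset_sg hm.lt hle
  have h3 : t' ≤ sSup U := le_csSup hUb
    ⟨h.lt.trans_le (htU.trans h2), fun y hy => h'.subset ⟨hy.1, (h1.trans hsD).trans_lt hy.2.1, hy.2.2⟩⟩
  have h4 : sInf D ≤ s' := csInf_le hDb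
    ⟨(h1.trans hsD).trans_lt h.lt, fun y hy =>
      h'.subset ⟨hy.1, hy.2.1, hy.2.2.trans_le (htU.trans h2)⟩⟩
  exact fun y hy => ⟨hy.1, h4.trans hy.2.1, hy.2.2.trans h3⟩

/-- Grid lines are parallel to the edges through their points that are not vertices, and contain
them. -/
theorem edge_of_gridLine (hκ : Δ.IsTransversal κ) (hmax : sg κ c β s t ∈ Δ.gridLines)
    (h : Δ.IsGridInterval κ c β s t) (hxΩ : x ∈ Ω) (hx : x ∈ sg κ c β s t) (hV : x ∉ Δ.vertices) :
    (∃ s' t', Δ.IsGridInterval κ c β s' t' ∧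
      (∃ e ∈ Δ.edges, segment ℝ e.1 e.2 = sg κ c β s' t') ∧ x ∈ sgo κ c β s' t' ∧
      s ≤ s' ∧ t' ≤ t) ∧
    ∀ᶠ y in 𝓝 x, y ∈ Δ.grid → c * ht κ y + β - y 0 = 0 := by
  obtain ⟨c', β', s', t', h', he, hxo, hnear⟩ := exists_edge_sgo hκ (h.sg_subset_grid hx) hV
  have hseg := h.isGridSegment
  rw [← segment_pnt h.lt] at hseg
  have hz := hseg.aff_eq_zero (by rwa [segment_pnt h.lt]) hxo.1 hnear
  rw [segment_pnt h.lt] at hz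
  obtain ⟨rfl, rfl⟩ := aff_unique (κ := κ) (a := pnt κ c β s) (b := pnt κ c β t)
    (by simpa using h.lt.ne) (aff_pnt κ c β s) (aff_pnt κ c β t)
    (hz _ (pnt_mem_sg le_rfl h.lt.le)) (hz _ (pnt_mem_sg h.lt.le le_rfl))
  obtain ⟨h1, h2⟩ := le_of_maximal hmax h h' hxΩ hx ⟨hxo.1, hxo.2.1.le, hxo.2.2.le⟩
  exact ⟨⟨s', t', h', he, hxo, h1, h2⟩, hnear⟩

/-- Every grid line contains an edge, and an edge determines it: two collinear grid lines that share
a point of `Ω` coincide by maximality. -/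
theorem finite_gridLines (hκ : Δ.IsTransversal κ) : Δ.gridLines.Finite := by
  have key : ∀ l ∈ Δ.gridLines, ∃ e ∈ Δ.edges, segment ℝ e.1 e.2 ⊆ l := by
    intro l hl
    obtain ⟨c, β, s, t, h, rfl⟩ := IsGridSegment.exists_isGridInterval hκ hl.1
    obtain ⟨x, hx, hxV⟩ := exists_mem_notMem_vertices Δ
      (a := pnt κ c β s) (b := pnt κ c β t) fun h0 => h.lt.ne (by simpa using congrArg (ht κ) h0)
    rw [openSegment_pnt h.lt] at hx
    obtain ⟨⟨s', t', h', ⟨e, he, hes⟩, -, h1, h2⟩, -⟩ := edge_of_gridLine hκ hl h (h.subset hx).1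
      ⟨hx.1, hx.2.1.le, hx.2.2.le⟩ hxV
    exact ⟨e, he, hes ▸ fun y hy => ⟨hy.1, h1.trans hy.2.1, hy.2.2.trans h2⟩⟩
  choose! e he hel using key
  refine Set.Finite.of_finite_image (f := e)
    (Δ.edges.finite_toSet.subset (Set.image_subset_iff.2 fun l hl => he l hl)) ?_
  intro l hl l' hl' hll
  have h1 := hel l hl
  have h2 := hel l' hl'
  rw [← hll] at h2
  obtain ⟨c, β, s, t, h, rfl⟩ := IsGridSegment.exists_isGridInterval hκ hl.1
  obtain ⟨c', β', s', t', h', rfl⟩ := IsGridSegment.exists_isGridInterval hκ hl'.1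
  set e₀ := e (sg κ c β s t)
  have ha := left_mem_segment ℝ e₀.1 e₀.2
  have hb := right_mem_segment ℝ e₀.1 e₀.2
  obtain ⟨rfl, rfl⟩ := aff_unique (hκ _ (he _ hl)) (h1 ha).1 (h1 hb).1 (h2 ha).1 (h2 hb).1
  obtain ⟨x, hx, -⟩ := exists_mem_notMem_vertices Δ (Δ.ne_of_mem _ (he _ hl))
  have hxs := openSegment_subset_segment _ _ _ hx
  obtain ⟨rfl, rfl⟩ := eq_of_maximal hl h hl' h' (Δ.openSegment_subset _ (he _ hl) hx)
    (h1 hxs) (h2 hxs)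
  rfl

/-- After a suitable shear, grid lines serve as segments and interior vertices as `V`. Near a grid
point that is no vertex the grid is a single straight edge, so no second grid line passes there and
none ends there. The two grids have to agree only inside `Ω`. -/
theorem exists_segmentSystem (hΩ : Bornology.IsBounded Ω) (Δ : PolygonalPartition Ω) :
    ∃ (Γ : SegmentSystem Ω) (f : Γ.ι ≃ Δ.gridLines), Γ.V = Δ.interiorVertices ∧
      (∀ L, (f L : Set Plane) = Γ.seg L) ∧ Ω \ Γ.grid = Ω \ Δ.grid := by
  obtain ⟨κ, hκ⟩ := exists_ht_ne Δ.edges Δ.ne_of_mem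
  have hκ' : Δ.IsTransversal κ := hκ
  have : Fintype Δ.gridLines := (finite_gridLines hκ').fintype
  choose c β s t h hl using fun l : Δ.gridLines => IsGridSegment.exists_isGridInterval hκ' l.2.1
  have hmax : ∀ l, sg κ (c l) (β l) (s l) (t l) ∈ Δ.gridLines := fun l => hl l ▸ l.2
  let Γ : SegmentSystem Ω :=
    { ι := Δ.gridLines
      κ := κ
      c := c
      β := β
      s := s
      t := t
      V := Δ.interiorVertices
      s_lt_t := fun l => (h l).lt
      mem_of_lt := fun l x h0 h1 h2 => ((h l).subset ⟨h0, h1, h2⟩).1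
      V_subset := fun A hA => (mem_interiorVertices.1 hA).2
      V_of_two := by
        intro x hx l l' hne hxl hxl'
        have hcc : c l ≠ c l' := by
          intro hcc
          refine hne (Subtype.ext ?_)
          have h0 := hxl'.1
          rw [← hcc] at h0
          have hββ : β l = β l' := by
            have := hxl.1
            linarith
          have h' := h l'
          have hm' := hmax l'
          rw [← hcc, ← hββ] at h' hm' hxl'
          obtain ⟨h1, h2⟩ := eq_of_maximal (hmax l) (h l) hm' h' hx hxl hxl'
          rw [hl l, hl l', hcc, hββ, h1, h2]
        refine ⟨mem_interiorVertices.2 ⟨?_, hx⟩, hcc⟩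
        by_contra hV
        obtain ⟨-, hnear⟩ := edge_of_gridLine hκ' (hmax l) (h l) hx hxl hV
        have hseg := (h l').isGridSegment
        rw [← segment_pnt (h l').lt] at hseg
        have hz := hseg.aff_eq_zero (by rw [segment_pnt (h l').lt]; exact hxl') hxl.1 hnear
        rw [segment_pnt (h l').lt] at hz
        exact hcc (aff_unique (κ := κ) (a := pnt κ (c l') (β l') (s l'))
          (b := pnt κ (c l') (β l') (t l')) (by simpa using (h l').lt.ne)
          (hz _ (pnt_mem_sg le_rfl (h l').lt.le)) (hz _ (pnt_mem_sg (h l').lt.le le_rfl))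
          (aff_pnt κ _ _ _) (aff_pnt κ _ _ _)).1
      V_of_end := by
        intro x hx l hxl hends
        refine mem_interiorVertices.2 ⟨?_, hx⟩
        by_contra hV
        have hxs : x ∈ sg κ (c l) (β l) (s l) (t l) := by
          refine ⟨hxl, ?_⟩
          rcases hends with h1 | h1 <;> rw [h1]
          · exact ⟨le_rfl, (h l).lt.le⟩
          · exact ⟨(h l).lt.le, le_rfl⟩
        obtain ⟨⟨s', t', -, -, hxo, h1, h2⟩, -⟩ :=
          edge_of_gridLine hκ' (hmax l) (h l) hx hxs hV
        have h3 := hxo.2.1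
        have h4 := hxo.2.2
        rcases hends with h5 | h5 <;> linarith }
  refine ⟨Γ, Equiv.refl _, rfl, hl, ?_⟩
  ext x
  refine and_congr_right fun hx => not_congr ⟨fun hxg => ?_, fun hxg => ?_⟩
  · obtain ⟨l, hxl⟩ := Set.mem_iUnion.1 hxg
    exact (h l).sg_subset_grid hxl
  · obtain ⟨e, he, hxe⟩ := mem_grid.1 hxg
    obtain ⟨c', β', s', t', h', h2⟩ :=
      (isGridSegment_edge he).exists_isGridInterval hκ'
    obtain ⟨l, hlm, hsub⟩ := exists_gridLine hΩ hκ' h'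
    exact Set.mem_iUnion.2 ⟨⟨l, hlm⟩, (hl ⟨l, hlm⟩).le (hsub (h2 ▸ hxe))⟩

end PolygonalPartition

end PolySpline

/-! ### The dimension formula for quasi-cross-cut partitions -/

namespace PolySpline

variable {Ω : Set Plane}

namespace PolygonalPartition

variable {Δ : PolygonalPartition Ω} {d μ : ℕ} {φ : Set Plane} {x y : Plane}

theorem isOpen_sdiff_grid (hΩ : IsOpen Ω) (Δ : PolygonalPartition Ω) : IsOpen (Ω \ Δ.grid) :=
  hΩ.sdiff Δ.isClosed_grid

/-- The cell containing a point off the grid. -/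
def cell (Δ : PolygonalPartition Ω) (x : Plane) : Set Plane := connectedComponentIn (Ω \ Δ.grid) x

theorem cell_mem_cells (hx : x ∈ Ω \ Δ.grid) : Δ.cell x ∈ Δ.cells := ⟨x, hx, rfl⟩

theorem mem_cell (hx : x ∈ Ω \ Δ.grid) : x ∈ Δ.cell x := mem_connectedComponentIn hx

theorem eq_cell (hφ : φ ∈ Δ.cells) (hx : x ∈ φ) : φ = Δ.cell x := by
  obtain ⟨y, -, rfl⟩ := hφ
  exact connectedComponentIn_eq hx

theorem subset_of_mem_cells (hφ : φ ∈ Δ.cells) : φ ⊆ Ω \ Δ.grid := by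
  obtain ⟨y, -, rfl⟩ := hφ
  exact connectedComponentIn_subset _ _

theorem isOpen_of_mem_cells (hΩ : IsOpen Ω) (hφ : φ ∈ Δ.cells) : IsOpen φ := by
  obtain ⟨y, -, rfl⟩ := hφ
  exact (Δ.isOpen_sdiff_grid hΩ).connectedComponentIn

theorem isPreconnected_of_mem_cells (hφ : φ ∈ Δ.cells) : IsPreconnected φ := by
  obtain ⟨y, -, rfl⟩ := hφ
  exact isPreconnected_connectedComponentIn

theorem nonempty_of_mem_cells (hφ : φ ∈ Δ.cells) : φ.Nonempty := by
  obtain ⟨y, hy, rfl⟩ := hφ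
  exact ⟨y, mem_connectedComponentIn hy⟩

/-- Cells are open and connected, so one polynomial for each cell amounts to a locally constant
choice of polynomials off the grid. -/
theorem mem_splineSpace_iff_isPiecewise (hΩ : IsOpen Ω) {Γ : SegmentSystem Ω}
    (hΓ : Ω \ Γ.grid = Ω \ Δ.grid) (s : Ω → ℝ) :
    s ∈ splineSpace Δ d μ ↔ SmoothOn μ s Ω ∧ Γ.IsPiecewise d s := by
  classical
  have hiff : ∀ z ∈ Ω, (z ∉ Γ.grid ↔ z ∈ Ω \ Δ.grid) := fun z hz => by
    rw [← hΓ]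
    exact ⟨fun h => ⟨hz, h⟩, fun h => h.2⟩
  refine and_congr_right fun _ => ⟨fun h => ?_, ?_⟩
  · choose! P hdeg hP using h
    refine ⟨fun z => if h : z ∈ Ω \ Δ.grid then
      ⟨P (Δ.cell z), (MvPolynomial.mem_restrictTotalDegree _ _ _).2 (hdeg _ (cell_mem_cells h))⟩
      else 0, fun z hz hzg => ?_, fun z hz hzg => ?_⟩
    · have hz' := (hiff z hz).1 hzg
      filter_upwards [(isOpen_of_mem_cells hΩ (cell_mem_cells hz')).mem_nhds (mem_cell hz')] with w hw
      have hw' := subset_of_mem_cells (cell_mem_cells hz') hw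
      rw [dif_pos hw', dif_pos hz']
      exact Subtype.ext (congrArg P (eq_cell (cell_mem_cells hz') hw).symm)
    · have hz' := (hiff z hz).1 hzg
      simp only [dif_pos hz']
      exact hP _ (cell_mem_cells hz') ⟨z, hz⟩ (mem_cell hz')
  · rintro ⟨F, hF, hs⟩ φ hφ
    have hsub := subset_of_mem_cells hφ
    obtain ⟨p, hp⟩ := exists_const_of_isPreconnected (isPreconnected_of_mem_cells hφ) (g := F)
      fun z hz => nhdsWithin_le_nhds (hF z (hsub hz).1 ((hiff z (hsub hz).1).2 (hsub hz)))
    refine ⟨p, p.totalDegree_le, fun x hx => ?_⟩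
    rw [hs x x.2 ((hiff x x.2).2 (hsub hx)), hp x hx]

/-- The dimension of the spline space over a quasi-cross-cut partition. -/
theorem finrank_splineSpace_of_isQuasiCrossCut (hΩ : IsPolygonalDomain Ω)
    (hqc : Δ.IsQuasiCrossCut) (hμ : μ ≤ d) [FiniteDimensional ℝ (splineSpace Δ d μ)] :
    (Module.finrank ℝ (splineSpace Δ d μ) : ℤ) =
      ((d + 2).choose 2 : ℤ) + (Δ.crossCuts.ncard : ℤ) * ((d - μ + 1).choose 2 : ℤ)
        + ∑ A ∈ Δ.interiorVertices, kNum d μ (Δ.lineCount A) := by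
  obtain ⟨Γ, f, hV, hf, hgrid⟩ := exists_segmentSystem hΩ.isBounded Δ
  have := hΩ.simplyConnected
  have hsg : ∀ L, (f L : Set Plane) = sg Γ.κ (Γ.c L) (Γ.β L) (Γ.s L) (Γ.t L) := hf
  have hpt : ∀ L u, Γ.pt L u = pnt Γ.κ (Γ.c L) (Γ.β L) u := fun _ _ => rfl
  have hfr : ∀ a ∈ frontier Ω, a ∉ Ω := fun a ha h => by
    rw [hΩ.isOpen.frontier_eq] at ha
    exact ha.2 h
  have hcross : ∀ L, (f L : Set Plane) ∈ Δ.crossCuts → Γ.IsCross L := by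
    rintro L ⟨-, a, b, hab, ha, hb⟩
    rw [hsg] at hab
    obtain ⟨h1, h2⟩ := pnt_eq_or hab.symm (Γ.s_lt_t L)
    unfold SegmentSystem.IsCross
    rw [hpt, hpt]
    constructor
    · rcases h1 with h | h <;> rw [h]
      exacts [hfr a ha, hfr b hb]
    · rcases h2 with h | h <;> rw [h]
      exacts [hfr a ha, hfr b hb]
  have hcross' : ∀ L, Γ.IsCross L → (f L : Set Plane) ∈ Δ.crossCuts := by
    rintro L ⟨h1, h2⟩
    have hcl : (f L : Set Plane) ⊆ closure Ω := by
      rw [hsg]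
      refine (sg_subset_closure (Γ.s_lt_t L)).trans (closure_mono fun x hx => ?_)
      exact Γ.mem_of_lt L x hx.1 hx.2.1 hx.2.2
    rw [hsg] at hcl
    refine ⟨(f L).2, _, _, (hsg L).trans (segment_pnt (Γ.s_lt_t L)).symm, ?_, ?_⟩
    all_goals rw [hΩ.isOpen.frontier_eq]
    · exact ⟨hcl (pnt_mem_sg le_rfl (Γ.s_lt_t L).le), h1⟩
    · exact ⟨hcl (pnt_mem_sg (Γ.s_lt_t L).le le_rfl), h2⟩
  -- This is where the quasi-cross-cut property enters: a ray has one end on the frontier of the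
  -- open set `Ω`, hence outside it, and its ends are determined by the segment.
  have hend : ∀ L, ¬(Γ.pt L (Γ.s L) ∈ Ω ∧ Γ.pt L (Γ.t L) ∈ Ω) := by
    rintro L ⟨hs, ht'⟩
    rcases hqc _ (f L).2 with h | h
    · exact (hcross L h).1 hs
    · obtain ⟨-, a, b, hab, ha, hb⟩ := h
      rw [hsg] at hab
      obtain ⟨h1, h2⟩ := pnt_eq_or hab.symm (Γ.s_lt_t L)
      rw [hpt] at hs ht'
      have h1' := h1.resolve_left fun h => hfr a ha (h ▸ hs)
      have h2' := h2.resolve_left fun h => hfr a ha (h ▸ ht')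
      have := congrArg (ht Γ.κ) (h1'.trans h2'.symm)
      rw [ht_pnt, ht_pnt] at this
      exact (Γ.s_lt_t L).ne this
  have hcard : Nat.card {L : Γ.ι // Γ.IsCross L} = Δ.crossCuts.ncard := by
    rw [← Nat.card_coe_set_eq]
    exact Nat.card_congr
      { toFun := fun L => ⟨f L, hcross' L L.2⟩
        invFun := fun l => ⟨f.symm ⟨l, l.2.1⟩, hcross _ (by simp)⟩
        left_inv := fun L => by simp
        right_inv := fun l => by simp }
  have hcount : ∀ A, Nat.card {L : Γ.ι // A ∈ Γ.seg L} = Δ.lineCount A := by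
    intro A
    unfold lineCount
    rw [← Nat.card_coe_set_eq]
    have hmem : ∀ l, (l ∈ Δ.crossCuts ∨ l ∈ Δ.rays) ↔ l ∈ Δ.gridLines := fun l =>
      ⟨fun h => h.elim (fun h => h.1) fun h => h.1, fun h => hqc l h⟩
    simp only [hmem]
    exact Nat.card_congr
      { toFun := fun L => ⟨f L, (f L).2, (hf L).ge L.2⟩
        invFun := fun l => ⟨f.symm ⟨l, l.2.1⟩, (hf _).le (by simpa using l.2.2)⟩
        left_inv := fun L => by simp
        right_inv := fun l => by simp }
  rw [SegmentSystem.finrank_eq_add_finrank_jumpData hΩ.isOpen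
      (mem_splineSpace_iff_isPiecewise hΩ.isOpen hgrid), Nat.cast_add,
    SegmentSystem.finrank_jumpData hμ hend, hcard, hV, add_assoc]
  simp only [hcount]

end PolygonalPartition

end PolySpline

namespace PolySpline

/-! ### Polynomials along an edge -/

section Edge

open Polynomial

theorem natDegree_aeval_le {A : Type*} [CommRing A] [Algebra ℝ A] {p : Poly} {d : ℕ}
    (hp : p.totalDegree ≤ d) {f : Fin 2 → A[X]} (hf : ∀ i, (f i).natDegree ≤ 1) :
    (MvPolynomial.aeval f p).natDegree ≤ d := by
  rw [MvPolynomial.aeval_def, MvPolynomial.eval₂_eq]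
  refine natDegree_sum_le_of_forall_le _ _ fun m hm => natDegree_mul_le.trans ?_
  rw [IsScalarTower.algebraMap_apply ℝ A A[X], Polynomial.algebraMap_eq, natDegree_C, zero_add]
  refine (natDegree_prod_le _ _).trans (le_trans ?_ ((MvPolynomial.le_totalDegree hm).trans hp))
  refine Finset.sum_le_sum fun i _ => natDegree_pow_le.trans ?_
  exact (Nat.mul_le_mul_left _ (hf i)).trans_eq (mul_one _)

theorem totalDegree_pderiv_le (i : Fin 2) (p : Poly) :
    (MvPolynomial.pderiv i p).totalDegree ≤ p.totalDegree := by
  conv_lhs => rw [p.as_sum, map_sum]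
  refine (MvPolynomial.totalDegree_finsetSum_le fun m hm => ?_)
  rw [MvPolynomial.pderiv_monomial]
  refine (MvPolynomial.totalDegree_monomial_le _ _).trans ?_
  refine le_trans ?_ (MvPolynomial.le_totalDegree hm)
  rw [Finsupp.sum_fintype _ _ fun _ => rfl, Finsupp.sum_fintype _ _ fun _ => rfl]
  refine Finset.sum_le_sum fun j _ => ?_
  rw [Finsupp.tsub_apply]
  exact Nat.sub_le _ _

/-- The unit normal of an edge. -/
def normal (e : Plane × Plane) : Plane :=
  !₂[(e.1 1 - e.2 1) / ‖e.2 - e.1‖, (e.2 0 - e.1 0) / ‖e.2 - e.1‖]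

/-- The polynomial `p` in coordinates along an edge and perpendicular to it. -/
def edgeFrame (e : Plane × Plane) : Poly →ₐ[ℝ] ℝ[X][X] := frame e.1 (e.2 - e.1) (normal e)

variable {e : Plane × Plane} {p q : Poly} {d : ℕ}

/-- The determinant of the edge vector and its unit normal is the length of the edge. -/
theorem det_normal_pos (he : e.1 ≠ e.2) :
    0 < (e.2 - e.1) 0 * normal e 1 - (e.2 - e.1) 1 * normal e 0 := by
  have h := norm_pos_iff.2 (sub_ne_zero.2 he.symm)
  have h2 : ‖e.2 - e.1‖ ^ 2 = (e.2 - e.1) 0 ^ 2 + (e.2 - e.1) 1 ^ 2 := by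
    rw [EuclideanSpace.norm_sq_eq, Fin.sum_univ_two, Real.norm_eq_abs, Real.norm_eq_abs, sq_abs,
      sq_abs]
  have h3 : (e.2 - e.1) 0 * normal e 1 - (e.2 - e.1) 1 * normal e 0 =
      ‖e.2 - e.1‖ ^ 2 / ‖e.2 - e.1‖ := by
    rw [h2]
    simp [normal]
    ring
  rw [h3]
  positivity

/-- Both sides obey the Leibniz rule along `edgeFrame`, so comparing them on constants and on the
variables suffices. -/
theorem edgeFrame_normalDeriv (e : Plane × Plane) (p : Poly) :
    edgeFrame e (normalDeriv e p) = derivative (edgeFrame e p) := by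
  induction p using MvPolynomial.induction_on with
  | C a => simp [normalDeriv, edgeFrame, frame]
  | add p q hp hq =>
    rw [map_add, derivative_add, ← hp, ← hq, ← map_add]
    congr 1
    simp only [normalDeriv, map_add, smul_add]
    abel
  | mul_X p i hp =>
    have h : normalDeriv e (p * MvPolynomial.X i) = normalDeriv e p * MvPolynomial.X i +
        p * normalDeriv e (MvPolynomial.X i) := by
      simp only [normalDeriv, Derivation.leibniz, smul_eq_mul]
      simp only [MvPolynomial.smul_eq_C_mul]
      ring
    have hX : edgeFrame e (normalDeriv e (MvPolynomial.X i)) =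
        derivative (edgeFrame e (MvPolynomial.X i)) := by
      fin_cases i <;> simp [normalDeriv, edgeFrame, frame, normal, MvPolynomial.pderiv_X, Algebra.smul_def]
    rw [h, map_add, map_mul, map_mul, hp, hX, map_mul, derivative_mul]

theorem edgeFrame_iterate_normalDeriv (e : Plane × Plane) (p : Poly) (r : ℕ) :
    edgeFrame e ((normalDeriv e)^[r] p) = derivative^[r] (edgeFrame e p) := by
  induction r with
  | zero => rfl
  | succ r ih => rw [Function.iterate_succ_apply', Function.iterate_succ_apply', edgeFrame_normalDeriv, ih]

theorem edgeRestrict_eq_coeff_zero (e : Plane × Plane) (p : Poly) :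
    edgeRestrict e p = (edgeFrame e p).coeff 0 := by
  have : (constantCoeff : ℝ[X][X] →+* ℝ[X]).comp (edgeFrame e : Poly →+* ℝ[X][X]) =
      (MvPolynomial.aeval (fun i => C (e.1 i) + C (e.2 i - e.1 i) * X) : Poly →ₐ[ℝ] ℝ[X]) := by
    refine MvPolynomial.ringHom_ext (fun r => ?_) (fun i => ?_)
    · simp [edgeFrame, frame]
    · simp [edgeFrame, frame]
  exact (congrArg (fun φ : Poly →+* ℝ[X] => φ p) this).symm

/-- The normal derivatives along an edge are the coefficients in the adapted coordinates. -/
theorem edgeRestrict_iterate_normalDeriv (e : Plane × Plane) (p : Poly) (r : ℕ) :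
    edgeRestrict e ((normalDeriv e)^[r] p) = (r.factorial : ℝ) • (edgeFrame e p).coeff r := by
  rw [edgeRestrict_eq_coeff_zero, edgeFrame_iterate_normalDeriv, coeff_iterate_derivative, zero_add,
    Nat.descFactorial_self, Nat.cast_smul_eq_nsmul]

theorem natDegree_edgeFrame_le (hp : p.totalDegree ≤ d) : (edgeFrame e p).natDegree ≤ d :=
  natDegree_aeval_le hp fun i => by compute_degree

theorem totalDegree_iterate_normalDeriv_le (e : Plane × Plane) (p : Poly) (r : ℕ) :
    ((normalDeriv e)^[r] p).totalDegree ≤ p.totalDegree := by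
  induction r with
  | zero => rfl
  | succ r ih =>
    rw [Function.iterate_succ_apply']
    refine le_trans ?_ ih
    refine (MvPolynomial.totalDegree_add _ _).trans (max_le ?_ ?_)
    · exact (MvPolynomial.totalDegree_smul_le _ _).trans (totalDegree_pderiv_le _ _)
    · exact (MvPolynomial.totalDegree_smul_le _ _).trans (totalDegree_pderiv_le _ _)

/-- Up to a factorial the coefficient is the restriction of a normal derivative. The bound shows
that writing out the `d + 1` coefficients in `eeeMatrix` loses nothing. -/
theorem natDegree_coeff_edgeFrame_le (hp : p.totalDegree ≤ d) (r : ℕ) :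
    ((edgeFrame e p).coeff r).natDegree ≤ d := by
  have h : (edgeRestrict e ((normalDeriv e)^[r] p)).natDegree ≤ d :=
    natDegree_aeval_le ((totalDegree_iterate_normalDeriv_le e p r).trans hp)
      fun i => by compute_degree
  rw [edgeRestrict_iterate_normalDeriv, natDegree_smul _ (by positivity)] at h
  exact h

/-- A polynomial whose normal derivatives vanish along an edge is zero. -/
theorem eq_zero_of_edgeRestrict {μ : ℕ} (he : e.1 ≠ e.2) (hp : p.totalDegree ≤ d)
    (hμ : X ^ (μ + 1) ∣ edgeFrame e p)
    (h : ∀ r ∈ Finset.Icc (μ + 1) d, ∀ k : Fin (d + 1),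
      (edgeRestrict e ((normalDeriv e)^[r] p)).coeff k = 0) : p = 0 := by
  refine frame_injective e.1 (det_normal_pos he).ne' ?_
  change edgeFrame e p = edgeFrame e 0
  rw [map_zero]
  ext r k : 2
  rw [coeff_zero, coeff_zero]
  -- Transversal orders up to `μ` vanish by smoothness, orders above `d` by degree, and those in
  -- between by the equations.
  rcases Nat.lt_or_ge r (μ + 1) with hr | hr
  · rw [X_pow_dvd_iff.1 hμ r hr, coeff_zero]
  rcases Nat.lt_or_ge d r with hr' | hr'
  · rw [coeff_eq_zero_of_natDegree_lt ((natDegree_edgeFrame_le hp).trans_lt hr'), coeff_zero]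
  rcases Nat.lt_or_ge k (d + 1) with hk | hk
  · have := h r (Finset.mem_Icc.2 ⟨hr, hr'⟩) ⟨k, hk⟩
    rw [edgeRestrict_iterate_normalDeriv, coeff_smul, smul_eq_mul] at this
    exact (mul_eq_zero.1 this).resolve_left (by positivity)
  · exact coeff_eq_zero_of_natDegree_lt ((natDegree_coeff_edgeFrame_le hp r).trans_lt hk)

theorem eq_zero_of_X_pow_dvd_edgeFrame (he : e.1 ≠ e.2) (hp : p.totalDegree ≤ d)
    (h : X ^ (d + 1) ∣ edgeFrame e p) : p = 0 :=
  eq_zero_of_edgeRestrict he hp h fun r hr => by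
    rw [Finset.mem_Icc] at hr
    omega

end Edge

end PolySpline

namespace PolySpline

variable {Ω : Set Plane}

/-! ### The two sides of an edge -/

/-- The determinant of the direction of the edge and `y - e.1`, positive on one side of the edge
and negative on the other. -/
def side (e : Plane × Plane) (y : Plane) : ℝ :=
  (e.2 - e.1) 0 * (y - e.1) 1 - (e.2 - e.1) 1 * (y - e.1) 0

/-- The longitudinal coordinate relative to an edge. -/
def along (e : Plane × Plane) (y : Plane) : ℝ :=
  ((e.2 - e.1) 0 * (y - e.1) 0 + (e.2 - e.1) 1 * (y - e.1) 1) /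
    ((e.2 - e.1) 0 ^ 2 + (e.2 - e.1) 1 ^ 2)

variable {e : Plane × Plane} {x y : Plane}

@[fun_prop]
theorem continuous_along (e : Plane × Plane) : Continuous (along e) := by
  unfold along
  fun_prop

theorem sq_add_sq_pos (he : e.1 ≠ e.2) : 0 < (e.2 - e.1) 0 ^ 2 + (e.2 - e.1) 1 ^ 2 := by
  have h := norm_pos_iff.2 (sub_ne_zero.2 he.symm)
  have h2 : ‖e.2 - e.1‖ ^ 2 = (e.2 - e.1) 0 ^ 2 + (e.2 - e.1) 1 ^ 2 := by
    rw [EuclideanSpace.norm_sq_eq, Fin.sum_univ_two, Real.norm_eq_abs, Real.norm_eq_abs, sq_abs,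
      sq_abs]
  rw [← h2]
  positivity

theorem side_combo (e : Plane × Plane) (u : ℝ) : side e (e.1 + u • (e.2 - e.1)) = 0 := by
  simp [side]
  ring

theorem along_combo (he : e.1 ≠ e.2) (u : ℝ) : along e (e.1 + u • (e.2 - e.1)) = u := by
  have := (sq_add_sq_pos he).ne'
  unfold along
  rw [div_eq_iff this]
  simp
  ring

theorem combo_along (he : e.1 ≠ e.2) (h : side e y = 0) : e.1 + along e y • (e.2 - e.1) = y := by
  have h0 := (sq_add_sq_pos he).ne'
  unfold side at h
  have h1 : ∀ i, along e y * (e.2 - e.1) i = (y - e.1) i := by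
    intro i
    unfold along
    rw [div_mul_eq_mul_div, div_eq_iff h0]
    fin_cases i
    · simp only [Fin.zero_eta]
      linear_combination ((e.2 - e.1) 1) * h
    · simp only [Fin.mk_one]
      linear_combination (-(e.2 - e.1) 0) * h
  ext i
  have := h1 i
  simp only [PiLp.add_apply, PiLp.smul_apply, smul_eq_mul, this]
  simp

theorem side_add_normal (e : Plane × Plane) (y : Plane) (τ : ℝ) :
    side e (y + τ • normal e) = side e y +
      τ * ((e.2 - e.1) 0 * normal e 1 - (e.2 - e.1) 1 * normal e 0) := by
  simp [side]
  ring

theorem mem_openSegment_iff_side (he : e.1 ≠ e.2) :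
    y ∈ openSegment ℝ e.1 e.2 ↔ side e y = 0 ∧ 0 < along e y ∧ along e y < 1 := by
  rw [openSegment_eq_image']
  constructor
  · rintro ⟨u, ⟨h1, h2⟩, rfl⟩
    exact ⟨side_combo e u, by rwa [along_combo he], by rwa [along_combo he]⟩
  · rintro ⟨h0, h1, h2⟩
    exact ⟨along e y, ⟨h1, h2⟩, combo_along he h0⟩

theorem side_eq_zero_of_mem_segment (hy : y ∈ segment ℝ e.1 e.2) : side e y = 0 := by
  rw [segment_eq_image'] at hy
  obtain ⟨u, -, rfl⟩ := hy
  exact side_combo e u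

theorem side_lin (e : Plane × Plane) {p q : ℝ} (hpq : p + q = 1) (y z : Plane) :
    side e (p • y + q • z) = p * side e y + q * side e z := by
  simp [side]
  linear_combination ((e.2 0 - e.1 0) * (- e.1 1) - (e.2 1 - e.1 1) * (- e.1 0)) * (-hpq)

theorem convex_side_pos (e : Plane × Plane) : Convex ℝ {y | 0 < side e y} := by
  intro y hy z hz p q hp hq hpq
  change 0 < side e _
  rw [side_lin e hpq]
  have hy' : 0 < side e y := hy
  have hz' : 0 < side e z := hz
  rcases hp.eq_or_lt with rfl | hp
  · obtain rfl : q = 1 := by linarith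
    simpa using hz'
  · positivity

theorem convex_side_neg (e : Plane × Plane) : Convex ℝ {y | side e y < 0} := by
  intro y hy z hz p q hp hq hpq
  change side e _ < 0
  rw [side_lin e hpq]
  have hy' : side e y < 0 := hy
  have hz' : side e z < 0 := hz
  rcases hp.eq_or_lt with rfl | hp
  · obtain rfl : q = 1 := by linarith
    simpa using hz'
  · nlinarith

theorem tendsto_add_normal (y v : Plane) (s : Set ℝ) :
    Tendsto (fun τ : ℝ => y + τ • v) (𝓝[s] 0) (𝓝 y) := by
  have h : Continuous fun τ : ℝ => y + τ • v := by fun_prop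
  have := h.tendsto 0
  simp only [zero_smul, add_zero] at this
  exact this.mono_left nhdsWithin_le_nhds

theorem eventually_side_pos (he : e.1 ≠ e.2) (hy : side e y = 0) :
    ∀ᶠ τ in 𝓝[>] (0 : ℝ), 0 < side e (y + τ • normal e) := by
  have h : ∀ᶠ τ in 𝓝[>] (0 : ℝ), 0 < τ := self_mem_nhdsWithin
  filter_upwards [h] with τ hτ
  rw [side_add_normal, hy, zero_add]
  exact mul_pos hτ (det_normal_pos he)

theorem eventually_side_neg (he : e.1 ≠ e.2) (hy : side e y = 0) :
    ∀ᶠ τ in 𝓝[<] (0 : ℝ), side e (y + τ • normal e) < 0 := by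
  have h : ∀ᶠ τ in 𝓝[<] (0 : ℝ), τ < 0 := self_mem_nhdsWithin
  filter_upwards [h] with τ hτ
  rw [side_add_normal, hy, zero_add]
  exact mul_neg_of_neg_of_pos hτ (det_normal_pos he)

namespace PolygonalPartition

variable {Δ : PolygonalPartition Ω} {φ φ₁ φ₂ : Set Plane}

/-- Near a relative interior point of an edge `Ω` minus the grid consists of two half-discs. -/
theorem exists_ball (hΩ : IsOpen Ω) (he : e ∈ Δ.edges) (hx : x ∈ openSegment ℝ e.1 e.2) :
    ∃ r > 0, ∀ y ∈ Metric.ball x r, y ∈ Ω ∧ (side e y = 0 → y ∈ openSegment ℝ e.1 e.2) ∧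
      (y ∈ Δ.grid → side e y = 0) := by
  have hne := Δ.ne_of_mem e he
  obtain ⟨-, h0, h1⟩ := (mem_openSegment_iff_side hne).1 hx
  have hc := (continuous_along e).continuousAt (x := x)
  refine Metric.eventually_nhds_iff_ball.1 ?_
  filter_upwards [hΩ.mem_nhds (Δ.openSegment_subset e he hx), hc.eventually_const_lt h0,
    hc.eventually_lt_const h1, eventually_mem_segment he hx] with y h2 h3 h4 h5
  exact ⟨h2, fun h => (mem_openSegment_iff_side hne).2 ⟨h, h3, h4⟩,
    fun h => side_eq_zero_of_mem_segment (h5 h)⟩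

/-- A half-disc is connected and avoids the grid, so it lies in one cell; since `x` is in the
closure of `φ`, that cell is `φ` for one of the two halves. -/
theorem halfDisc_subset {r : ℝ} (hr : 0 < r)
    (hball : ∀ y ∈ Metric.ball x r, y ∈ Ω ∧ (side e y = 0 → y ∈ openSegment ℝ e.1 e.2) ∧
      (y ∈ Δ.grid → side e y = 0)) (he : e ∈ Δ.edges) (hφ : φ ∈ Δ.cells) (hx : x ∈ closure φ) :
    Metric.ball x r ∩ {y | 0 < side e y} ⊆ φ ∨ Metric.ball x r ∩ {y | side e y < 0} ⊆ φ := by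
  obtain ⟨z, hz, hzφ⟩ := mem_closure_iff.1 hx _ Metric.isOpen_ball (Metric.mem_ball_self hr)
  have key : ∀ H : Set Plane, Convex ℝ H → (∀ y ∈ H, side e y ≠ 0) → z ∈ H →
      Metric.ball x r ∩ H ⊆ φ := by
    intro H hH hne hzH
    rw [eq_cell hφ hzφ]
    refine ((convex_ball x r).inter hH).isPreconnected.subset_connectedComponentIn ⟨hz, hzH⟩ ?_
    exact fun y hy => ⟨(hball y hy.1).1, fun hg => hne y hy.2 ((hball y hy.1).2.2 hg)⟩
  have hz0 : side e z ≠ 0 := fun h => (subset_of_mem_cells hφ hzφ).2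
    (mem_grid.2 ⟨e, he, openSegment_subset_segment _ _ _ ((hball z hz).2.1 h)⟩)
  rcases hz0.lt_or_gt with h | h
  · exact Or.inr (key _ (convex_side_neg e) (fun y hy => ne_of_lt hy) h)
  · exact Or.inl (key _ (convex_side_pos e) (fun y hy => ne_of_gt hy) h)

/-- The two cells adjacent to an edge lie on different sides of it. -/
theorem exists_sides (hΩ : IsOpen Ω) (he : e ∈ Δ.edges)
    (hadj : AdjacentAlong Ω Δ.edges e φ₁ φ₂) (hx : x ∈ openSegment ℝ e.1 e.2) :
    ∃ r > 0, (∀ y ∈ Metric.ball x r, y ∈ Ω ∧ (side e y = 0 → y ∈ openSegment ℝ e.1 e.2)) ∧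
      ((Metric.ball x r ∩ {y | 0 < side e y} ⊆ φ₁ ∧ Metric.ball x r ∩ {y | side e y < 0} ⊆ φ₂) ∨
      (Metric.ball x r ∩ {y | 0 < side e y} ⊆ φ₂ ∧ Metric.ball x r ∩ {y | side e y < 0} ⊆ φ₁)) := by
  obtain ⟨r, hr, hball⟩ := exists_ball hΩ he hx
  obtain ⟨h1, h2, hne, hc1, hc2⟩ := hadj
  have hxs := openSegment_subset_segment _ _ _ hx
  refine ⟨r, hr, fun y hy => ⟨(hball y hy).1, (hball y hy).2.1⟩, ?_⟩
  have hdisj : ∀ y, y ∈ φ₁ → y ∈ φ₂ → False := fun y hy1 hy2 =>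
    hne ((eq_cell h1 hy1).trans (eq_cell h2 hy2).symm)
  have hex := Δ.ne_of_mem e he
  have hx0 := ((mem_openSegment_iff_side hex).1 hx).1
  have hb : ∀ s : Set ℝ, ∀ᶠ τ in 𝓝[s] (0 : ℝ), x + τ • normal e ∈ Metric.ball x r := fun s =>
    (tendsto_add_normal x _ s).eventually_mem (Metric.ball_mem_nhds x hr)
  obtain ⟨τ, hτ, hτb⟩ := ((eventually_side_pos hex hx0).and (hb (Set.Ioi 0))).exists
  obtain ⟨σ, hσ, hσb⟩ := ((eventually_side_neg hex hx0).and (hb (Set.Iio 0))).exists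
  rcases halfDisc_subset hr hball he h1 (hc1 hxs) with h3 | h3 <;>
    rcases halfDisc_subset hr hball he h2 (hc2 hxs) with h4 | h4
  · exact (hdisj _ (h3 ⟨hτb, hτ⟩) (h4 ⟨hτb, hτ⟩)).elim
  · exact Or.inl ⟨h3, h4⟩
  · exact Or.inr ⟨h4, h3⟩
  · exact (hdisj _ (h3 ⟨hσb, hσ⟩) (h4 ⟨hσb, hσ⟩)).elim

theorem eventually_mem_union (hΩ : IsOpen Ω) (he : e ∈ Δ.edges)
    (hadj : AdjacentAlong Ω Δ.edges e φ₁ φ₂) (hx : x ∈ openSegment ℝ e.1 e.2) :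
    ∀ᶠ y in 𝓝 x, y ∉ Δ.grid → y ∈ φ₁ ∪ φ₂ := by
  obtain ⟨r, hr, hball, h⟩ := exists_sides hΩ he hadj hx
  filter_upwards [Metric.ball_mem_nhds x hr] with y hy hyg
  have h0 : side e y ≠ 0 := fun h0 => hyg
    (mem_grid.2 ⟨e, he, openSegment_subset_segment _ _ _ ((hball y hy).2 h0)⟩)
  rcases h with ⟨h1, h2⟩ | ⟨h1, h2⟩ <;> rcases h0.lt_or_gt with h0 | h0
  exacts [Or.inr (h2 ⟨hy, h0⟩), Or.inl (h1 ⟨hy, h0⟩), Or.inl (h2 ⟨hy, h0⟩), Or.inr (h1 ⟨hy, h0⟩)]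

theorem closure_mem_nhds (hΩ : IsOpen Ω) (he : e ∈ Δ.edges)
    (hadj : AdjacentAlong Ω Δ.edges e φ₁ φ₂) (hx : x ∈ openSegment ℝ e.1 e.2) :
    Ω ∩ closure (φ₁ ∪ φ₂) ∈ 𝓝 x := by
  obtain ⟨r, hr, hball, h⟩ := exists_sides hΩ he hadj hx
  filter_upwards [Metric.ball_mem_nhds x hr] with y hy
  refine ⟨(hball y hy).1, ?_⟩
  rcases eq_or_ne (side e y) 0 with h0 | h0
  · exact closure_mono Set.subset_union_left
      (hadj.2.2.2.1 (openSegment_subset_segment _ _ _ ((hball y hy).2 h0)))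
  refine subset_closure ?_
  rcases h with ⟨h1, h2⟩ | ⟨h1, h2⟩ <;> rcases h0.lt_or_gt with h0 | h0
  exacts [Or.inr (h2 ⟨hy, h0⟩), Or.inl (h1 ⟨hy, h0⟩), Or.inl (h2 ⟨hy, h0⟩), Or.inr (h1 ⟨hy, h0⟩)]

/-- If two polynomials on adjacent cells form a function of class `C^m`, then their difference
vanishes to order `m` along the common edge. -/
theorem X_pow_dvd_edgeFrame (hΩ : IsOpen Ω) (he : e ∈ Δ.edges)
    (hadj : AdjacentAlong Ω Δ.edges e φ₁ φ₂) {m : ℕ} {f : Plane → ℝ} {p q : Poly}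
    (hf : ∀ y ∈ openSegment ℝ e.1 e.2, ContDiffAt ℝ m f y)
    (hp : ∀ y ∈ φ₁, f y = ev y p) (hq : ∀ y ∈ φ₂, f y = ev y q) :
    Polynomial.X ^ (m + 1) ∣ edgeFrame e (p - q) := by
  have hne := Δ.ne_of_mem e he
  obtain ⟨x, hx⟩ : (openSegment ℝ e.1 e.2).Nonempty := ⟨_, midpoint_mem_openSegment _ _⟩
  obtain ⟨r, hr, hball, h⟩ := exists_sides hΩ he hadj hx
  set S : Set ℝ := {u | e.1 + u • (e.2 - e.1) ∈ Metric.ball x r} with hS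
  have hSinf : S.Infinite := by
    have hopen : IsOpen S := Metric.isOpen_ball.preimage (by fun_prop)
    refine infinite_of_mem_nhds (along e x) (hopen.mem_nhds ?_)
    change _ ∈ Metric.ball x r
    rw [combo_along hne ((mem_openSegment_iff_side hne).1 hx).1]
    exact Metric.mem_ball_self hr
  have key : ∀ {p q : Poly} {φ₁ φ₂ : Set Plane}, (∀ y ∈ φ₁, f y = ev y p) →
      (∀ y ∈ φ₂, f y = ev y q) → Metric.ball x r ∩ {y | 0 < side e y} ⊆ φ₁ →
      Metric.ball x r ∩ {y | side e y < 0} ⊆ φ₂ →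
      Polynomial.X ^ (m + 1) ∣ edgeFrame e (p - q) := by
    intro p q φ₁ φ₂ hp hq h1 h2
    refine X_pow_dvd_frame (f := f) hSinf fun u hu => ?_
    have hs := side_combo e u
    have hb : ∀ s : Set ℝ, ∀ᶠ τ in 𝓝[s] (0 : ℝ),
        e.1 + u • (e.2 - e.1) + τ • normal e ∈ Metric.ball x r := fun s =>
      (tendsto_add_normal _ _ s).eventually_mem (Metric.isOpen_ball.mem_nhds hu)
    refine ⟨hf _ ((hball _ hu).2 hs), ?_, ?_⟩
    · filter_upwards [hb _, eventually_side_pos hne hs] with τ h3 h4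
      exact hp _ (h1 ⟨h3, h4⟩)
    · filter_upwards [hb _, eventually_side_neg hne hs] with τ h3 h4
      exact hq _ (h2 ⟨h3, h4⟩)
  rcases h with ⟨h1, h2⟩ | ⟨h1, h2⟩
  · exact key hp hq h1 h2
  -- The order of the two cells is arbitrary; exchanging them only changes the sign of the
  -- difference.
  · obtain ⟨g, hg⟩ := key hq hp h1 h2
    exact ⟨-g, by rw [← neg_sub q p, map_neg, hg]; ring⟩

end PolygonalPartition

end PolySpline

namespace PolySpline

variable {Ω : Set Plane} {Δ Δ' : PolygonalPartition Ω} {d μ : ℕ} {s s' : Ω → ℝ}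
  {φ φ₁ φ₂ : Set Plane} {e : Plane × Plane} {x : Plane} {p q : Poly}

open PolygonalPartition

/-! ### The polynomial pieces of a spline -/

theorem eq_of_agreesOn (hΩ : IsOpen Ω) (hφ : φ ∈ Δ.cells) (hp : AgreesOn s φ p)
    (hq : AgreesOn s φ q) : p = q := by
  obtain ⟨x, hx⟩ := nonempty_of_mem_cells hφ
  refine poly_eq_of_eventually (y := x) ?_
  filter_upwards [(isOpen_of_mem_cells hΩ hφ).mem_nhds hx] with z hz
  have hzΩ := (subset_of_mem_cells hφ hz).1
  exact (hp ⟨z, hzΩ⟩ hz).symm.trans (hq ⟨z, hzΩ⟩ hz)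

theorem piece_eq (hΩ : IsOpen Ω) (hφ : φ ∈ Δ.cells) (hp : AgreesOn s φ p) : piece s φ = p := by
  have h : ∃ p, AgreesOn s φ p := ⟨p, hp⟩
  rw [piece, dif_pos h]
  exact eq_of_agreesOn hΩ hφ h.choose_spec hp

theorem agreesOn_piece (hs : s ∈ splineSpace Δ d μ) (hφ : φ ∈ Δ.cells) :
    AgreesOn s φ (piece s φ) := by
  have h : ∃ p, AgreesOn s φ p := (hs.2 φ hφ).imp fun p hp => hp.2
  rw [piece, dif_pos h]
  exact h.choose_spec

theorem totalDegree_piece_le (hΩ : IsOpen Ω) (hs : s ∈ splineSpace Δ d μ) (hφ : φ ∈ Δ.cells) :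
    (piece s φ).totalDegree ≤ d := by
  obtain ⟨p, hp, hsp⟩ := hs.2 φ hφ
  rwa [piece_eq hΩ hφ hsp]

theorem piece_sum_smul (hΩ : IsOpen Ω) {ι : Type*} [Fintype ι] {N : ι → Ω → ℝ}
    (hN : ∀ i, N i ∈ splineSpace Δ d μ) (hφ : φ ∈ Δ.cells) (c : ι → ℝ) :
    piece (∑ i, c i • N i) φ = ∑ i, c i • piece (N i) φ := by
  refine piece_eq hΩ hφ fun x hx => ?_
  rw [Finset.sum_apply, map_sum]
  refine Finset.sum_congr rfl fun i _ => ?_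
  rw [Pi.smul_apply, MvPolynomial.smul_eval, smul_eq_mul, agreesOn_piece (hN i) hφ x hx]

/-- The pieces of a spline on adjacent cells agree if their normal derivatives of higher order
agree along the common edge. -/
theorem piece_eq_piece_of_edgeRestrict (hΩ : IsOpen Ω) (hs : s ∈ splineSpace Δ d μ)
    (he : e ∈ Δ.edges) (hadj : AdjacentAlong Ω Δ.edges e φ₁ φ₂)
    (h : ∀ r ∈ Finset.Icc (μ + 1) d, ∀ k : Fin (d + 1),
      (edgeRestrict e ((normalDeriv e)^[r] (piece s φ₁ - piece s φ₂))).coeff k = 0) :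
    piece s φ₁ = piece s φ₂ := by
  obtain ⟨f, hf, hsf⟩ := hs.1
  have hφ : ∀ {φ}, φ ∈ Δ.cells → ∀ y ∈ φ, f y = ev y (piece s φ) := fun hφ y hy => by
    have hyΩ := (subset_of_mem_cells hφ hy).1
    rw [← hsf ⟨y, hyΩ⟩ hyΩ]
    exact agreesOn_piece hs hφ ⟨y, hyΩ⟩ hy
  refine sub_eq_zero.1 (eq_zero_of_edgeRestrict (μ := μ) (Δ.ne_of_mem e he)
    ((MvPolynomial.totalDegree_sub _ _).trans (max_le (totalDegree_piece_le hΩ hs hadj.1)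
      (totalDegree_piece_le hΩ hs hadj.2.1))) ?_ h)
  exact X_pow_dvd_edgeFrame hΩ he hadj
    (fun y hy => hf.contDiffAt (hΩ.mem_nhds (Δ.openSegment_subset e he hy))) (hφ hadj.1) (hφ hadj.2.1)

/-- The condition of extended edge elimination means that the pieces on both sides agree. -/
theorem eeeCondition_iff (hΩ : IsOpen Ω) (hs : s ∈ splineSpace Δ d μ)
    (he : e ∈ Δ.edges) (hadj : AdjacentAlong Ω Δ.edges e φ₁ φ₂) :
    EEECondition d s φ₁ φ₂ ↔ piece s φ₁ = piece s φ₂ := by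
  constructor
  · rintro ⟨f, hf, hsf⟩
    have hφ : ∀ {φ}, φ ∈ Δ.cells → φ ⊆ φ₁ ∪ φ₂ → ∀ y ∈ φ, f y = ev y (piece s φ) :=
      fun hφ hsub y hy => by
        have hyΩ := (subset_of_mem_cells hφ hy).1
        rw [← hsf ⟨y, hyΩ⟩ ⟨hyΩ, subset_closure (hsub hy)⟩]
        exact agreesOn_piece hs hφ ⟨y, hyΩ⟩ hy
    refine sub_eq_zero.1 (eq_zero_of_X_pow_dvd_edgeFrame (Δ.ne_of_mem e he)
      ((MvPolynomial.totalDegree_sub _ _).trans (max_le (totalDegree_piece_le hΩ hs hadj.1)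
        (totalDegree_piece_le hΩ hs hadj.2.1))) ?_)
    exact X_pow_dvd_edgeFrame hΩ he hadj
      (fun y hy => hf.contDiffAt (closure_mem_nhds hΩ he hadj hy))
      (hφ hadj.1 Set.subset_union_left) (hφ hadj.2.1 Set.subset_union_right)
  · intro h
    refine ⟨fun y => ev y (piece s φ₁), (contDiff_ev _ _).contDiffOn, ?_⟩
    rintro ⟨x, hx⟩ ⟨-, hcl⟩
    obtain ⟨f, hf, hsf⟩ := hs.1
    have hc : ContinuousAt f x := hf.continuousOn.continuousAt (hΩ.mem_nhds hx)
    rw [hsf _ hx]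
    -- The common polynomial gives the values inside the two cells; continuity of the spline carries
    -- this over to their closure in `Ω`.
    refine tendsto_nhds_unique_of_frequently_eq hc.tendsto
      (continuous_ev (piece s φ₁)).continuousAt.tendsto ?_
    refine (mem_closure_iff_frequently.1 hcl).mono ?_
    rintro y (hy | hy)
    · have hyΩ := (subset_of_mem_cells hadj.1 hy).1
      rw [← hsf ⟨y, hyΩ⟩ hyΩ]
      exact agreesOn_piece hs hadj.1 ⟨y, hyΩ⟩ hy
    · have hyΩ := (subset_of_mem_cells hadj.2.1 hy).1
      rw [← hsf ⟨y, hyΩ⟩ hyΩ, h]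
      exact agreesOn_piece hs hadj.2.1 ⟨y, hyΩ⟩ hy

/-! ### Splines over a coarser partition -/

theorem mem_extendedEdges : e ∈ Δ.extendedEdges Δ' ↔
    e ∈ Δ'.edges ∧ ¬ segment ℝ e.1 e.2 ⊆ Δ.grid := by
  classical
  exact Finset.mem_filter

theorem cell_subset_cell (hgrid : Δ.grid ⊆ Δ'.grid) (hφ : φ ∈ Δ'.cells) :
    ∃ ψ ∈ Δ.cells, φ ⊆ ψ := by
  obtain ⟨y, hy, rfl⟩ := hφ
  exact ⟨_, ⟨y, ⟨hy.1, fun h => hy.2 (hgrid h)⟩, rfl⟩,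
    connectedComponentIn_mono _ (Set.sdiff_subset_sdiff_right hgrid)⟩

theorem splineSpace_le (hgrid : Δ.grid ⊆ Δ'.grid) : splineSpace Δ d μ ≤ splineSpace Δ' d μ := by
  rintro s ⟨h1, h2⟩
  refine ⟨h1, fun φ hφ => ?_⟩
  obtain ⟨ψ, hψ, hsub⟩ := cell_subset_cell hgrid hφ
  obtain ⟨p, hp, hsp⟩ := h2 ψ hψ
  exact ⟨p, hp, fun x hx => hsp x (hsub hx)⟩

/-- The pieces of a spline over `Δ` agree across the extended edges. -/
theorem piece_eq_piece_of_mem (hΩ : IsOpen Ω) (hgrid : Δ.grid ⊆ Δ'.grid)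
    (hs : s ∈ splineSpace Δ d μ) (he : e ∈ Δ.extendedEdges Δ')
    (hadj : AdjacentAlong Ω Δ'.edges e φ₁ φ₂) : piece s φ₁ = piece s φ₂ := by
  obtain ⟨he', hne⟩ := mem_extendedEdges.1 he
  -- As the grid of `Δ` is closed, an edge not covered by it has a relative interior point off it.
  obtain ⟨x, hx, hxg⟩ : ∃ x ∈ openSegment ℝ e.1 e.2, x ∉ Δ.grid := by
    by_contra! h
    exact hne (segment_subset_closure_openSegment.trans (Δ.isClosed_grid.closure_subset_iff.2 h))
  have hxΩ := Δ'.openSegment_subset e he' hx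
  have hcell := cell_mem_cells (Δ := Δ) ⟨hxΩ, hxg⟩
  have hmem := (isOpen_of_mem_cells hΩ hcell).mem_nhds (mem_cell (Δ := Δ) ⟨hxΩ, hxg⟩)
  obtain ⟨p, -, hp⟩ := hs.2 _ hcell
  -- The cell of `Δ` around `x` is a neighbourhood of `x`, so it contains both cells of `Δ'` that
  -- meet along the edge.
  have key : ∀ φ ∈ Δ'.cells, x ∈ closure φ → piece s φ = p := by
    intro φ hφ hxφ
    obtain ⟨ψ, hψ, hsub⟩ := cell_subset_cell hgrid hφ
    obtain ⟨y, hy, hyφ⟩ := mem_closure_iff_nhds.1 hxφ _ hmem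
    have e1 : ψ = Δ.cell x := (eq_cell hψ (hsub hyφ)).trans (eq_cell hcell hy).symm
    exact piece_eq hΩ hφ fun z hz => hp z (e1 ▸ hsub hz)
  have hxs := openSegment_subset_segment _ _ _ hx
  rw [key _ hadj.1 (hadj.2.2.2.1 hxs), key _ hadj.2.1 (hadj.2.2.2.2 hxs)]

/-- In polar coordinates this is the image of an open interval times the unit circle, which is
connected. -/
theorem isPreconnected_punctured_ball (x : Plane) {r : ℝ} :
    IsPreconnected (Metric.ball x r \ {x}) := by
  have hrank : 1 < Module.rank ℝ Plane := by
    rw [← Module.finrank_eq_rank, finrank_euclideanSpace_fin]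
    norm_num
  have h := (isPreconnected_Ioo (a := 0) (b := r)).prod (isPreconnected_sphere hrank (0 : Plane) 1)
  have himage := h.image (fun q : ℝ × Plane => x + q.1 • q.2) (by fun_prop)
  convert! himage using 1
  ext z
  constructor
  · rintro ⟨hz, hne⟩
    have hpos : 0 < ‖z - x‖ := norm_pos_iff.2 (sub_ne_zero.2 hne)
    refine ⟨(‖z - x‖, ‖z - x‖⁻¹ • (z - x)), ⟨⟨hpos, by rwa [← dist_eq_norm]⟩, ?_⟩, ?_⟩
    · simp [norm_smul, hpos.ne']
    · simp [smul_smul, hpos.ne']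
  · rintro ⟨⟨τ, v⟩, ⟨⟨h1, h2⟩, hv⟩, rfl⟩
    have hv1 : ‖v‖ = 1 := by simpa using hv
    have h1' : 0 < τ := h1
    have hnorm : ‖τ • v‖ = τ := by rw [norm_smul, hv1, mul_one, Real.norm_of_nonneg h1'.le]
    refine ⟨by simpa [hnorm] using h2, fun h0 => ?_⟩
    have h3 : τ • v = 0 := by simpa using h0
    rw [h3, norm_zero] at hnorm
    exact h1'.ne hnorm

/-- A spline over `Δ'` whose pieces agree across the extended edges is a spline over `Δ`. -/
theorem mem_splineSpace_of_piece_eq_piece (hΩ : IsPolygonalDomain Ω) (hs : s ∈ splineSpace Δ' d μ)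
    (h : ∀ e ∈ Δ.extendedEdges Δ', ∃ φ₁ φ₂, AdjacentAlong Ω Δ'.edges e φ₁ φ₂ ∧
      piece s φ₁ = piece s φ₂) : s ∈ splineSpace Δ d μ := by
  have hO := hΩ.isOpen
  obtain ⟨Γ, -, -, -, hΓ⟩ := exists_segmentSystem hΩ.isBounded Δ'
  have hdense : ∀ y ∈ Ω, ∃ᶠ z in 𝓝 y, z ∉ Δ'.grid := fun y hy =>
    ((Γ.frequently_notMem_grid y).and_eventually (hO.mem_nhds hy)).mono fun z hz =>
      (hΓ.le ⟨hz.2, hz.1⟩).2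
  let F : Plane → Poly := fun z => piece s (Δ'.cell z)
  have hF : ∀ {φ}, φ ∈ Δ'.cells → ∀ z ∈ φ, F z = piece s φ := fun hφ z hz =>
    congrArg (piece s) (eq_cell hφ hz).symm
  have hoff : ∀ y ∈ Ω, y ∉ Δ'.grid → ∀ᶠ z in 𝓝 y, F z = F y := by
    intro y hy hyg
    have hc := cell_mem_cells (Δ := Δ') ⟨hy, hyg⟩
    filter_upwards [(isOpen_of_mem_cells hO hc).mem_nhds (mem_cell (Δ := Δ') ⟨hy, hyg⟩)] with z hz
    exact hF hc z hz
  have hnonvertex : ∀ y ∈ Ω \ Δ.grid, y ∉ Δ'.vertices →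
      ∃ k, ∀ᶠ z in 𝓝 y, z ∉ Δ'.grid → F z = k := by
    rintro y ⟨hy, hyΔ⟩ hV
    by_cases hyg : y ∈ Δ'.grid
    · obtain ⟨e, he, hye⟩ := exists_edge hyg hV
      obtain ⟨φ₁, φ₂, hadj, heq⟩ := h e (mem_extendedEdges.2 ⟨he, fun hsub =>
        hyΔ (hsub (openSegment_subset_segment _ _ _ hye))⟩)
      refine ⟨piece s φ₁, ?_⟩
      filter_upwards [eventually_mem_union hO he hadj hye] with z hz hzg
      rcases hz hzg with hz | hz
      · exact hF hadj.1 z hz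
      · rw [heq, hF hadj.2.1 z hz]
    · exact ⟨F y, (hoff y hy hyg).mono fun z hz _ => hz⟩
  have hall : ∀ y ∈ Ω \ Δ.grid, ∃ k, ∀ᶠ z in 𝓝 y, z ∉ Δ'.grid → F z = k := by
    rintro y hy
    by_cases hyg : y ∈ Δ'.grid
    swap
    · exact ⟨F y, (hoff y hy.1 hyg).mono fun z hz _ => hz⟩
    -- A vertex of `Δ'` may lie off the grid of `Δ`. In a small punctured disc around it there are
    -- no further vertices, so the pieces agree there by the previous case.
    have hVc : IsClosed ((Δ'.vertices : Set Plane) \ {y}) :=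
      (Δ'.vertices.finite_toSet.subset Set.sdiff_subset).isClosed
    have hev : ∀ᶠ z in 𝓝 y, z ∈ Ω \ Δ.grid ∧ (z ∈ Δ'.vertices → z = y) := by
      filter_upwards [(Δ.isOpen_sdiff_grid hO).mem_nhds hy,
        hVc.isOpen_compl.mem_nhds (by simp : y ∈ ((Δ'.vertices : Set Plane) \ {y})ᶜ)] with z h1 h2
      exact ⟨h1, fun h3 => by_contra fun h4 => h2 ⟨h3, h4⟩⟩
    obtain ⟨r, hr, hball⟩ := Metric.eventually_nhds_iff_ball.1 hev
    obtain ⟨k, hk⟩ := exists_const_off (N := Δ'.grid) (g := F)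
      (isPreconnected_punctured_ball y) (fun z hz => hdense z (hball z hz.1).1.1)
      fun z hz => hnonvertex z (hball z hz.1).1 fun hV => hz.2 ((hball z hz.1).2 hV)
    refine ⟨k, ?_⟩
    filter_upwards [Metric.ball_mem_nhds y hr] with z hz hzg
    exact hk z ⟨hz, fun h => hzg (h ▸ hyg)⟩ hzg
  refine ⟨hs.1, fun φ hφ => ?_⟩
  have hsub := subset_of_mem_cells hφ
  -- Connectedness of the cell of `Δ` turns local agreement of the pieces into a single polynomial;
  -- values on the finer grid follow by continuity below.
  obtain ⟨p, hp⟩ := exists_const_off (N := Δ'.grid) (g := F) (isPreconnected_of_mem_cells hφ)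
    (fun z hz => hdense z (hsub hz).1) fun z hz => hall z (hsub hz)
  have hoffp : ∀ z (hz : z ∈ Ω), z ∈ φ → z ∉ Δ'.grid → s ⟨z, hz⟩ = ev z p := by
    intro z hz hzφ hzg
    rw [← hp z hzφ hzg]
    exact agreesOn_piece hs (cell_mem_cells ⟨hz, hzg⟩) ⟨z, hz⟩ (mem_cell ⟨hz, hzg⟩)
  have hφo := isOpen_of_mem_cells hO hφ
  refine ⟨p, ?_, fun x hx => ?_⟩
  · obtain ⟨y, hy⟩ := nonempty_of_mem_cells hφ
    obtain ⟨z, hzg, hz⟩ := ((hdense y (hsub hy).1).and_eventually (hφo.mem_nhds hy)).exists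
    rw [← hp z hz hzg]
    exact totalDegree_piece_le hO hs (cell_mem_cells ⟨(hsub hz).1, hzg⟩)
  · obtain ⟨f, hf, hsf⟩ := hs.1
    have hc : ContinuousAt f x := hf.continuousOn.continuousAt (hO.mem_nhds x.2)
    rw [hsf x x.2]
    refine tendsto_nhds_unique_of_frequently_eq hc.tendsto
      (continuous_ev p).continuousAt.tendsto ?_
    refine ((hdense x x.2).and_eventually (hφo.mem_nhds hx)).mono ?_
    rintro z ⟨hzg, hz⟩
    rw [← hsf ⟨z, (hsub hz).1⟩ (hsub hz).1]
    exact hoffp z (hsub hz).1 hz hzg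

end PolySpline

/-! ### The matrix of the conditions and its kernel -/

namespace PolySpline

variable {Ω : Set Plane} {Δ Δ' : PolygonalPartition Ω} {d μ : ℕ} {φ₁ φ₂ : Plane × Plane → Set Plane}

open PolygonalPartition

/-- Pieces depend linearly on the spline, and restricted normal derivatives are visibly linear once
written as coefficients of `edgeFrame`. -/
theorem eeeMatrix_mulVec (hΩ : IsOpen Ω) {ι : Type*} [Fintype ι] {N : ι → Ω → ℝ}
    (hN : ∀ i, N i ∈ splineSpace Δ' d μ)
    (hφ : ∀ e ∈ Δ.extendedEdges Δ', AdjacentAlong Ω Δ'.edges e (φ₁ e) (φ₂ e)) (c : ι → ℝ)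
    (row : Δ.extendedEdges Δ' × Finset.Icc (μ + 1) d × Fin (d + 1)) :
    (eeeMatrix Δ Δ' d μ N φ₁ φ₂).mulVec c row =
      (edgeRestrict row.1.1 ((normalDeriv row.1.1)^[row.2.1.1]
        (piece (∑ i, c i • N i) (φ₁ row.1.1) - piece (∑ i, c i • N i) (φ₂ row.1.1)))).coeff
          row.2.2 := by
  obtain ⟨e, r, k⟩ := row
  have hadj := hφ e.1 e.2
  have hsum : piece (∑ i, c i • N i) (φ₁ e.1) - piece (∑ i, c i • N i) (φ₂ e.1) =
      ∑ i, c i • (piece (N i) (φ₁ e.1) - piece (N i) (φ₂ e.1)) := by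
    simp only [piece_sum_smul hΩ hN hadj.1, piece_sum_smul hΩ hN hadj.2.1, smul_sub,
      Finset.sum_sub_distrib]
  simp only [Matrix.mulVec, dotProduct, eeeMatrix, hsum, edgeRestrict_iterate_normalDeriv, map_sum,
    map_smul, Polynomial.finsetSum_coeff, Polynomial.coeff_smul, smul_eq_mul, Finset.mul_sum]
  exact Finset.sum_congr rfl fun i _ => by ring

theorem eeeMatrix_mulVec_eq_zero_iff (hΩ : IsOpen Ω) {ι : Type*} [Fintype ι] {N : ι → Ω → ℝ}
    (hN : ∀ i, N i ∈ splineSpace Δ' d μ)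
    (hφ : ∀ e ∈ Δ.extendedEdges Δ', AdjacentAlong Ω Δ'.edges e (φ₁ e) (φ₂ e)) (c : ι → ℝ) :
    (eeeMatrix Δ Δ' d μ N φ₁ φ₂).mulVec c = 0 ↔ ∀ e ∈ Δ.extendedEdges Δ',
      piece (∑ i, c i • N i) (φ₁ e) = piece (∑ i, c i • N i) (φ₂ e) := by
  have hs : ∑ i, c i • N i ∈ splineSpace Δ' d μ :=
    sum_mem fun i _ => Submodule.smul_mem _ _ (hN i)
  constructor
  · intro h e he
    refine piece_eq_piece_of_edgeRestrict hΩ hs (mem_extendedEdges.1 he).1 (hφ e he)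
      fun r hr k => ?_
    have := congrFun h (⟨e, he⟩, ⟨r, hr⟩, k)
    rwa [eeeMatrix_mulVec hΩ hN hφ] at this
  · intro h
    funext row
    rw [eeeMatrix_mulVec hΩ hN hφ, h _ row.1.2, sub_self, edgeRestrict_iterate_normalDeriv]
    simp

theorem mem_splineSpace_iff (hΩ : IsPolygonalDomain Ω) (hgrid : Δ.grid ⊆ Δ'.grid)
    (hφ : ∀ e ∈ Δ.extendedEdges Δ', AdjacentAlong Ω Δ'.edges e (φ₁ e) (φ₂ e)) {s : Ω → ℝ} :
    s ∈ splineSpace Δ d μ ↔ s ∈ splineSpace Δ' d μ ∧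
      ∀ e ∈ Δ.extendedEdges Δ', piece s (φ₁ e) = piece s (φ₂ e) :=
  ⟨fun hs => ⟨splineSpace_le hgrid hs, fun e he =>
      piece_eq_piece_of_mem hΩ.isOpen hgrid hs he (hφ e he)⟩,
    fun ⟨hs, h⟩ => mem_splineSpace_of_piece_eq_piece hΩ hs fun e he => ⟨_, _, hφ e he, h e he⟩⟩

/-- The splines over `Δ` correspond to the kernel of the matrix of the conditions. -/
theorem exists_ker_equiv (hΩ : IsPolygonalDomain Ω) (hgrid : Δ.grid ⊆ Δ'.grid)
    {ι : Type*} [Fintype ι] (N : Module.Basis ι ℝ (splineSpace Δ' d μ))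
    (hφ : ∀ e ∈ Δ.extendedEdges Δ', AdjacentAlong Ω Δ'.edges e (φ₁ e) (φ₂ e)) :
    Nonempty (LinearMap.ker (eeeMatrix Δ Δ' d μ (fun i => (N i : Ω → ℝ)) φ₁ φ₂).mulVecLin ≃ₗ[ℝ]
      splineSpace Δ d μ) := by
  set M := eeeMatrix Δ Δ' d μ (fun i => (N i : Ω → ℝ)) φ₁ φ₂
  have hmem : ∀ c : ι → ℝ, M.mulVec c = 0 ↔ ∑ i, c i • (N i : Ω → ℝ) ∈ splineSpace Δ d μ := by
    intro c
    rw [eeeMatrix_mulVec_eq_zero_iff hΩ.isOpen (fun i => (N i).2) hφ, mem_splineSpace_iff hΩ hgrid hφ,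
      and_iff_right (sum_mem fun i _ => Submodule.smul_mem _ _ (N i).2)]
  let T : (ι → ℝ) →ₗ[ℝ] (Ω → ℝ) := (splineSpace Δ' d μ).subtype.comp (N.equivFun.symm : _ →ₗ[ℝ] _)
  have hT : ∀ c, T c = ∑ i, c i • (N i : Ω → ℝ) := fun c => by
    simp [T, Module.Basis.equivFun_symm_apply]
  have hTinj : Function.Injective T :=
    Subtype.val_injective.comp N.equivFun.symm.injective
  refine ⟨LinearEquiv.ofBijective ((T.comp (LinearMap.ker M.mulVecLin).subtype).codRestrict
    (splineSpace Δ d μ) fun c => ?_) ⟨fun c c' h => ?_, fun s => ?_⟩⟩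
  · have := (hmem c).1 (LinearMap.mem_ker.1 c.2)
    rw [← hT] at this
    exact this
  · have h' : T c.1 = T c'.1 :=
      congrArg (fun s : splineSpace Δ d μ => (s : Ω → ℝ)) h
    exact Subtype.ext (hTinj h')
  · have hs' := splineSpace_le hgrid s.2
    have hTs : T (N.equivFun ⟨s, hs'⟩) = s := by simp [T]
    refine ⟨⟨N.equivFun ⟨s, hs'⟩, ?_⟩, Subtype.ext hTs⟩
    rw [LinearMap.mem_ker, Matrix.mulVecLin_apply, hmem, ← hT, hTs]
    exact s.2

end PolySpline

end

/-! ### The main theorem -/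

open PolySpline in
theorem mainTheorem3 (Ω : Set Plane) (hΩ : IsPolygonalDomain Ω)
    (Δ Δ' : PolygonalPartition Ω) (hext : Δ'.IsExtensionOf Δ) (hqc : Δ'.IsQuasiCrossCut)
    (d μ : ℕ) (hμ : μ ≤ d)
    {ι : Type*} [Fintype ι] (N : Module.Basis ι ℝ (splineSpace Δ' d μ))
    (φ₁ φ₂ : Plane × Plane → Set Plane)
    (hφ : ∀ e ∈ Δ.extendedEdges Δ', AdjacentAlong Ω Δ'.edges e (φ₁ e) (φ₂ e)) :
    (∀ c : ι → ℝ,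
      (eeeMatrix Δ Δ' d μ (fun i => (N i : Ω → ℝ)) φ₁ φ₂).mulVec c = 0 ↔
        ∀ e ∈ Δ.extendedEdges Δ',
          EEECondition d (∑ i, c i • (N i : Ω → ℝ)) (φ₁ e) (φ₂ e)) ∧
    FiniteDimensional ℝ (splineSpace Δ d μ) ∧
    (Module.finrank ℝ (splineSpace Δ d μ) : ℤ) =
      ((d + 2).choose 2 : ℤ)
        + (Δ'.crossCuts.ncard : ℤ) * ((d - μ + 1).choose 2 : ℤ)
        + ∑ A ∈ Δ'.interiorVertices, kNum d μ (Δ'.lineCount A)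
        - ((eeeMatrix Δ Δ' d μ (fun i => (N i : Ω → ℝ)) φ₁ φ₂).rank : ℤ) := by
  have hN : ∀ i, (N i : Ω → ℝ) ∈ splineSpace Δ' d μ := fun i => (N i).2
  obtain ⟨E⟩ := exists_ker_equiv hΩ hext.grid_subset N hφ
  refine ⟨fun c => ?_, Module.Finite.equiv E, ?_⟩
  · rw [eeeMatrix_mulVec_eq_zero_iff hΩ.isOpen hN hφ]
    refine forall₂_congr fun e he => (eeeCondition_iff (μ := μ) hΩ.isOpen ?_
      (mem_extendedEdges.1 he).1 (hφ e he)).symm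
    exact sum_mem fun i _ => Submodule.smul_mem _ _ (hN i)
  · have : FiniteDimensional ℝ (splineSpace Δ' d μ) := Module.Finite.of_basis N
    have h1 := LinearMap.finrank_range_add_finrank_ker
      (eeeMatrix Δ Δ' d μ (fun i => (N i : Ω → ℝ)) φ₁ φ₂).mulVecLin
    -- The columns are indexed by a basis of the spline space over `Δ'`, so rank-nullity compares
    -- its dimension with the rank and the dimension over `Δ`.
    rw [Module.finrank_fintype_fun_eq_card, ← Module.finrank_eq_card_basis N, E.finrank_eq] at h1
    rw [← PolygonalPartition.finrank_splineSpace_of_isQuasiCrossCut hΩ hqc hμ, ← h1, Matrix.rank]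
    push_cast
    ring
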